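/- **Setting.** $R$ is a finite commutative ring with $1\neq0$ and $\lg=\log_2$. Arithmetic cost is the number of ring operations of a straight-line program over $R$; $M_R(N)$ is the least number of ring operations multiplying two $N\times N$ matrices over $R$, and $\omega\ge 2$, $K$ are such that $M_R(N)\le K N^\omega$ for all $N\ge1$. Adversaries are non-uniform circuits over $R$ that may use ring operations, zero tests, and the reading of single bits of ring elements in a fixed binary encoding; their size is the number of operations. For $\mu\in[0,1]$ let $\mathcal D_\mu$ be the distribution on $R$ that is $0$ with probability $1-\mu$ and uniform on $R$ with probability $\mu$. *LPN in dimension $N$ with subspace dimension $\kappa$, noise rate $\mu$ and $c$ columns* has $b$-bit security against size $T$ if every adversary of size at most $T$ distinguishes $(L,LH+S)$ from $(L,U)$ with advantage at most $2^{-b}$, where $L\in R^{N\times\kappa}$, $H\in R^{\kappa\times c}$, $U\in R^{N\times c}$ are uniform and $S\in R^{N\times c}$ has independent $\mathcal D_\mu$ entries. Fix $\delta\in(0,\frac12)$, $\epsilon\in(0,1)$, $\lambda>0$. For problem size $n$ and adversary size $T$ let $\iota$ be the smallest positive integer such that for all integers $\kappa$ with $\iota\le\kappa\le n$, LPN in dimension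 $\lfloor\kappa/\delta\rfloor$ with subspace dimension $\kappa$, noise rate $(\kappa/\delta)^{\epsilon-1}$ and $2n$ columns has $(\lambda+\lg\lg n+1)$-bit security against size $T$; put $\nu_T(\delta,\epsilon,\lambda)=\max\left(\frac{\lambda}{\lg|R|},\iota\right)$. **Protocol** (client inputs $A,B\in R^{n\times n}$; parameters $n=n_0,n_1,\dots,n_d$, $\lambda'$; noise rates $\mu_i=n_{i-1}^{\epsilon-1}$). Write $P_i=L_1\cdots L_i$, $P_0=I$. 1. *Round 1.* The client sends uniform $L_i\in R^{n_{i-1}\times n_i}$ ($1\le i\le d$). The server returns all the products $P_j^\top P_i$ ($0\le i,j\le d$; those with $i=0$ are transposes of those with $j=0$ and are not sent twice). 2. *Check.* For uniform test matrices $X_i\in R^{n_i\times\lambda'}$, a claimed sequence $Q_1,\dots,Q_d$ of the products $Q_0L_1\cdots L_i$ is accepted if $Q_iX_i=Q_{i-1}(L_iX_i)$ for all $i$. The client checks the products of round 1 in this way (with $Q_0=P_j^\top$ for each $j$) and aborts if a check fails. It then draws uniform $H\in R^{n\times n_d}$, $G\in R^{n_d\times n}$, and $S_i\in R^{n\times n_{i-1}}$,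 $T_i\in R^{n_{i-1}\times n}$ with independent $\mathcal D_{\mu_i}$ entries, and, with the received $P_i$, forms $A'=HP_d^\top+\sum_{i=0}^{d-1}S_{i+1}P_i^\top$ and $B'=P_dG+\sum_{i=0}^{d-1}P_iT_{i+1}$. 3. *Round 2.* The client sends $A_{\rm enc}=A+A'$ and $B_{\rm enc}=B+B'$. The server returns $A_{\rm enc}P_i$ and $P_i^\top B_{\rm enc}$ for $1\le i\le d$, and $A_{\rm enc}B_{\rm enc}$. 4. The client checks the $A_{\rm enc}P_i$ as above with fresh test matrices and aborts if the check fails. It computes $A'P_i=H(P_d^\top P_i)+\sum_{j=0}^{d-1}S_{j+1}(P_j^\top P_i)$, $AP_i=A_{\rm enc}P_i-A'P_i$ (and $AP_0=A$), $AB'=(AP_d)G+\sum_{i=0}^{d-1}(AP_i)T_{i+1}$, $A'B_{\rm enc}=H(P_d^\top B_{\rm enc})+\sum_{i=0}^{d-1}S_{i+1}(P_i^\top B_{\rm enc})$, and returns $A_{\rm enc}B_{\rm enc}-AB'-A'B_{\rm enc}$. **Statement.** For all $\epsilon\in(0,1)$, $\omega\ge2$ and $K$ there are a constant $C$ and a polynomial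 $q$ such that the following holds for every $R$ as above (with $M_R(N)\le KN^\omega$ for all $N\geq 1$), every binary encoding of $R$, all $\delta\in(0,\frac12)$, $\lambda>0$, $n,t\in\mathbb N$: if $\nu:=\nu_{t+q(n)}(\delta,\epsilon,\lambda)\le\delta n$, then there are parameters $d$, $n_0=n,n_1,\dots,n_d$, $\lambda'$ for which the two-round protocol above satisfies: * (Correctness) with an honest server the client never aborts and returns exactly $AB$; * (Computational zero-knowledge) for every dishonest server and distinguisher of total size at most $t$ and all $A,B$, the distinguisher tells the server's view (the client's messages and whether and when it aborts) apart from the simulated view, produced by running the client on $A=B=0$, with advantage at most $2^{-\lambda}$; * (Detection) for every, even unbounded, server, the probability that the client does not abort although some reply of round 1 or some reply $A_{\rm enc}P_i$ is wrong is at most $2^{-\lambda}$; * (Client cost) the expected cost of the client (random elements and noise bits drawn, elements sent and received, equality tests, ring operations) is at most $C\,n^2\left(n^\epsilon+\nu\right)$; * (Server cost) the cost of the honest server (ring operations, elements sent and received) is at most $M_R(n)+C\,\delta^{\omega-2}n^\omega$. -/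

import Mathlib

open scoped Matrix

universe u

namespace Delegation

noncomputable section

/-! ### Straight-line programs and their cost -/

/-- One operation of a straight-line program over `R`, with operands among the wires `V`;
`U` names extra unary operations. -/
inductive Op (R : Type u) (U V : Type) : Type u
  | const (c : R)
  | add (a b : V)
  | sub (a b : V)
  | mul (a b : V)
  | un (f : U) (a : V)

/-- The value of an operation, where `sem` interprets the extra unary operations. -/
def Op.eval {R : Type u} [CommRing R] {U V : Type} (sem : U → R → R) (x : V → R) :
    Op R U V → R
  | .const c => c
  | .add a b => x a + x b
  | .sub a b => x a - x b
  | .mul a b => x a * x b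
  | .un f a => sem f (x a)

/-- Straight-line programs (circuits): each step adds one wire to the wires `V` available so far,
and the end names the wires that carry the outputs `O`. -/
inductive Circuit (R : Type u) (U O : Type) : Type → Type (max 1 u)
  | done {V : Type} (out : O → V) : Circuit R U O V
  | step {V : Type} (g : Op R U V) (next : Circuit R U O (Option V)) : Circuit R U O V

/-- The number of operations. -/
def Circuit.size {R : Type u} {U O : Type} : {V : Type} → Circuit R U O V → ℕ
  | _, .done _ => 0
  | _, .step _ next => next.size + 1

/-- The outputs of a circuit on given inputs. -/
def Circuit.eval {R : Type u} [CommRing R] {U O : Type} (sem : U → R → R) :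
    {V : Type} → Circuit R U O V → (V → R) → O → R
  | _, .done out, x => fun o => x (out o)
  | _, .step g next, x => next.eval sem (fun w => Option.elim w (g.eval sem x) x)

/-- Arithmetic circuits, in which the honest parties compute: only ring operations. -/
abbrev ArithCircuit (R : Type u) (V O : Type) := Circuit R Empty O V

/-- The function computed by an arithmetic circuit. -/
abbrev ArithCircuit.run {R : Type u} [CommRing R] {V O : Type} (c : ArithCircuit R V O)
    (x : V → R) : O → R :=
  Circuit.eval (fun f : Empty => f.elim) c x

/-- Non-algebraic operations of an adversary: a zero test, and reading a bit of an element. -/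
inductive TestOp : Type
  | isZero
  | bit (i : ℕ)

/-- Meaning of the non-algebraic operations, for a binary encoding `enc` of the ring. -/
def TestOp.eval {R : Type u} [CommRing R] [Fintype R] [DecidableEq R]
    (enc : R ≃ Fin (Fintype.card R)) : TestOp → R → R
  | .isZero, x => if x = 0 then 1 else 0
  | .bit i, x => if (enc x : ℕ).testBit i = true then 1 else 0

/-- Circuits of (non-uniform) adversaries: ring operations, zero tests and bit operations.
Coins are not needed: the best coins can be fixed as constants. -/
abbrev AdvCircuit (R : Type u) (V O : Type) := Circuit R TestOp O V

/-- The function computed by an adversary's circuit. -/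
abbrev AdvCircuit.run {R : Type u} [CommRing R] [Fintype R] [DecidableEq R]
    (enc : R ≃ Fin (Fintype.card R)) {V O : Type} (c : AdvCircuit R V O) (x : V → R) : O → R :=
  Circuit.eval (TestOp.eval enc) c x

/-- The entries of a matrix as a family indexed by positions. -/
def flat {R : Type u} {a b : ℕ} (M : Matrix (Fin a) (Fin b) R) : Fin a × Fin b → R :=
  fun x => M x.1 x.2

/-- The matrix with the given entries. -/
def unflat {R : Type u} {a b : ℕ} (x : Fin a × Fin b → R) : Matrix (Fin a) (Fin b) R :=
  Matrix.of fun r c => x (r, c)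

/-- The least number of ring operations that multiply two `N × N` matrices over `R`. -/
def matMulCost (R : Type u) [CommRing R] (N : ℕ) : ℕ :=
  sInf {s | ∃ c : ArithCircuit R ((Fin N × Fin N) ⊕ (Fin N × Fin N)) (Fin N × Fin N),
    (∀ A B : Matrix (Fin N) (Fin N) R, c.run (Sum.elim (flat A) (flat B)) = flat (A * B)) ∧
    c.size = s}

/-- `N × N` matrices over `R` can be multiplied with at most `K * N ^ ω` ring operations. -/
def MatMulBound (R : Type u) [CommRing R] (K ω : ℝ) : Prop :=
  ∀ N : ℕ, 1 ≤ N → (matMulCost R N : ℝ) ≤ K * (N : ℝ) ^ ω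

/-! ### Finite probability -/

/-- Average over a uniformly random family of ring elements. -/
def unifAvg {R : Type u} [Fintype R] [DecidableEq R] {I : Type} [Fintype I] [DecidableEq I]
    (f : (I → R) → ℝ) : ℝ :=
  (∑ x : I → R, f x) / (Fintype.card R : ℝ) ^ Fintype.card I

/-- Average over independent random bits, the `i`-th of which is `true` with probability `μ i`. -/
def maskAvg {I : Type} [Fintype I] [DecidableEq I] (μ : I → ℝ) (f : (I → Bool) → ℝ) : ℝ :=
  ∑ σ : I → Bool, (∏ i, if σ i = true then μ i else 1 - μ i) * f σ

open Classical in
/-- The indicator of an event. -/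
def ind (P : Prop) : ℝ := if P then 1 else 0

/-- Noise: an entry is kept where the mask is `true` and is zero elsewhere. A uniform entry with an
independent mask bit of bias `μ` is zero with probability `1 - μ` and uniform with
probability `μ`. -/
def masked {R : Type u} [Zero R] {I : Type} (σ : I → Bool) (x : I → R) : I → R :=
  fun i => if σ i = true then x i else 0

/-! ### Learning parity with noise -/

section LPN

variable {R : Type u} [CommRing R] [Fintype R] [DecidableEq R]

/-- Positions of an LPN sample: an `N × κ` and an `N × c` matrix. -/
abbrev LPNIdx (N κ c : ℕ) := (Fin N × Fin κ) ⊕ (Fin N × Fin c)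

/-- Probability that the adversary outputs `1` on `(L, L H + S)`. -/
def lpnReal (enc : R ≃ Fin (Fintype.card R)) (N κ c : ℕ) (μ : ℝ)
    (D : AdvCircuit R (LPNIdx N κ c) Unit) : ℝ :=
  maskAvg (I := Fin N × Fin c) (fun _ => μ) fun σ =>
    unifAvg fun L : Fin N × Fin κ → R =>
      unifAvg fun H : Fin κ × Fin c → R =>
        unifAvg fun S : Fin N × Fin c → R =>
          ind (D.run enc
            (Sum.elim L (flat (unflat L * unflat H + unflat (masked σ S)))) () = 1)

/-- Probability that the adversary outputs `1` on `(L, U)`. -/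
def lpnIdeal (enc : R ≃ Fin (Fintype.card R)) (N κ c : ℕ)
    (D : AdvCircuit R (LPNIdx N κ c) Unit) : ℝ :=
  unifAvg fun L : Fin N × Fin κ → R =>
    unifAvg fun U : Fin N × Fin c → R => ind (D.run enc (Sum.elim L U) () = 1)

/-- LPN in dimension `N` with subspace dimension `κ`, `c` columns and noise rate `μ` has
`bits`-bit security against adversaries of size at most `T`. -/
def LPNSecure (enc : R ≃ Fin (Fintype.card R)) (N κ c : ℕ) (μ : ℝ) (T : ℕ) (bits : ℝ) : Prop :=
  ∀ D : AdvCircuit R (LPNIdx N κ c) Unit, D.size ≤ T →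
    |lpnReal enc N κ c μ D - lpnIdeal enc N κ c D| ≤ (2 : ℝ) ^ (-bits)

/-- The smallest positive `ι` such that LPN in dimension `κ / δ`, with subspace dimension `κ` and
noise rate `(κ / δ) ^ (ε - 1)`, has `(sec + lg lg n + 1)`-bit security for every `κ` from `ι` up to
the problem size `n`. -/
def lpnThreshold (enc : R ≃ Fin (Fintype.card R)) (δ ε sec : ℝ) (n T : ℕ) : ℕ :=
  sInf {ι | 0 < ι ∧ ∀ κ : ℕ, ι ≤ κ → κ ≤ n →
    LPNSecure enc ⌊(κ : ℝ) / δ⌋₊ κ (2 * n) (((κ : ℝ) / δ) ^ (ε - 1)) T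
      (sec + Real.logb 2 (Real.logb 2 n) + 1)}

/-- The quantity `ν(δ, ε, λ)`, for problem size `n` and adversaries of size `T`. -/
def nu (enc : R ≃ Fin (Fintype.card R)) (δ ε sec : ℝ) (n T : ℕ) : ℝ :=
  max (sec / Real.logb 2 (Fintype.card R)) (lpnThreshold enc δ ε sec n T)

end LPN

/-! ### The protocol -/

/-- Public parameters: the number `d` of levels, the subspace dimensions `dim 0, …, dim d`
(where `dim 0` is the size of the matrices to be multiplied), the noise rates (`rate i` is the rate
for level `i + 1`) and the number of product checks. -/
structure Params where
  d : ℕ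
  dim : ℕ → ℕ
  rate : ℕ → ℝ
  checks : ℕ

namespace Params

variable (p : Params)

/-- Positions of an input matrix. -/
abbrev NIdx := Fin (p.dim 0) × Fin (p.dim 0)
/-- Positions of the subspace matrices; block `i` is `L_{i+1}`. -/
abbrev LIdx := Σ i : Fin p.d, Fin (p.dim i) × Fin (p.dim (i + 1))
/-- Positions of `H`. -/
abbrev HIdx := Fin (p.dim 0) × Fin (p.dim p.d)
/-- Positions of `G`. -/
abbrev GIdx := Fin (p.dim p.d) × Fin (p.dim 0)
/-- Positions of the left noise matrices; block `i` is `S_{i+1}`. -/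
abbrev SIdx := Σ i : Fin p.d, Fin (p.dim 0) × Fin (p.dim i)
/-- Positions of the right noise matrices; block `i` is `T_{i+1}`. -/
abbrev TIdx := Σ i : Fin p.d, Fin (p.dim i) × Fin (p.dim 0)
/-- Positions of the test matrices of a product check. -/
abbrev XIdx := Σ i : Fin p.d, Fin (p.dim (i + 1)) × Fin p.checks
/-- Ring elements drawn by the client: `L`, `H`, `G`, the values of `S` and `T`, and the test
matrices of the first and of the second round. -/
abbrev RandIdx := p.LIdx ⊕ p.HIdx ⊕ p.GIdx ⊕ p.SIdx ⊕ p.TIdx ⊕ p.XIdx ⊕ p.XIdx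
/-- Noise bits drawn by the client. -/
abbrev MaskIdx := p.SIdx ⊕ p.TIdx
/-- First reply: block `(j, i)` stands for `L_jᵀ ⋯ L_1ᵀ L_1 ⋯ L_{i+1}`. The products with no
factor on the right are the transposes of those with `j = 0`, and are not sent again. -/
abbrev Reply1Idx := Σ j : Fin (p.d + 1), Σ i : Fin p.d, Fin (p.dim j) × Fin (p.dim (i + 1))
/-- Part of the second reply: block `i` stands for `A_enc L_1 ⋯ L_{i+1}`. -/
abbrev LeftIdx := Σ i : Fin p.d, Fin (p.dim 0) × Fin (p.dim (i + 1))
/-- Part of the second reply: block `i` stands for `(L_1 ⋯ L_{i+1})ᵀ B_enc`. -/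
abbrev RightIdx := Σ i : Fin p.d, Fin (p.dim (i + 1)) × Fin (p.dim 0)
/-- Second reply: the partial products with `A_enc`, the product `A_enc B_enc`, and the partial
products with `B_enc`. -/
abbrev Reply2Idx := p.LeftIdx ⊕ p.NIdx ⊕ p.RightIdx
/-- Equations tested by the client in the first round. -/
abbrev Chk1Idx := Σ j : Fin (p.d + 1), Σ _ : Fin p.d, Fin (p.dim j) × Fin p.checks
/-- Equations tested by the client in the second round. -/
abbrev Chk2Idx := Σ _ : Fin p.d, Fin (p.dim 0) × Fin p.checks
/-- What the server has received when it sends its second reply: `L`, `A_enc`, `B_enc`. -/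
abbrev MsgIdx := p.LIdx ⊕ p.NIdx ⊕ p.NIdx

end Params

section Protocol

variable {R : Type u} [CommRing R] (p : Params)

/-- Block `i` of a family of matrices. -/
def blk {d : ℕ} {a b : Fin d → ℕ} (x : (Σ i : Fin d, Fin (a i) × Fin (b i)) → R) (i : Fin d) :
    Matrix (Fin (a i)) (Fin (b i)) R :=
  Matrix.of fun r c => x ⟨i, (r, c)⟩

/-- The subspace matrix `L_{i+1}`. -/
def blkL (L : p.LIdx → R) (i : ℕ) (h : i < p.d) :
    Matrix (Fin (p.dim i)) (Fin (p.dim (i + 1))) R :=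
  Matrix.of fun r c => L ⟨⟨i, h⟩, (r, c)⟩

/-- The products `M`, `M L_1`, `M L_1 L_2`, …. -/
def prodsFrom {a : ℕ} (M : Matrix (Fin a) (Fin (p.dim 0)) R) (L : p.LIdx → R) :
    (i : ℕ) → Matrix (Fin a) (Fin (p.dim i)) R
  | 0 => M
  | i + 1 => prodsFrom M L i * (if h : i < p.d then blkL p L i h else 0 :
      Matrix (Fin (p.dim i)) (Fin (p.dim (i + 1))) R)

/-- The products `L_1 ⋯ L_i`. -/
def subProd (L : p.LIdx → R) (i : ℕ) : Matrix (Fin (p.dim 0)) (Fin (p.dim i)) R :=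
  prodsFrom p (1 : Matrix (Fin (p.dim 0)) (Fin (p.dim 0)) R) L i

/-- The sequence `M, P_1, …, P_d`, where the `P_i` are the claimed values of `M L_1 ⋯ L_i`. -/
def chain {a : ℕ} (M : Matrix (Fin a) (Fin (p.dim 0)) R)
    (P : (i : Fin p.d) → Matrix (Fin a) (Fin (p.dim (i + 1))) R) :
    (i : ℕ) → Matrix (Fin a) (Fin (p.dim i)) R
  | 0 => M
  | i + 1 => if h : i < p.d then P ⟨i, h⟩ else 0

/-- Row `j` of the first reply. -/
def row (r : p.Reply1Idx → R) (j : ℕ) (hj : j < p.d + 1) (i : Fin p.d) :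
    Matrix (Fin (p.dim j)) (Fin (p.dim (i + 1))) R :=
  Matrix.of fun a b => r ⟨⟨j, hj⟩, i, (a, b)⟩

/-- The client's value of `L_1 ⋯ L_i`, taken from the first reply. -/
def prodL (r : p.Reply1Idx → R) : (i : ℕ) → Matrix (Fin (p.dim 0)) (Fin (p.dim i)) R :=
  chain p 1 (row p r 0 p.d.succ_pos)

/-- The client's value of `L_jᵀ ⋯ L_1ᵀ L_1 ⋯ L_i`, taken from the first reply. -/
def prodLL (r : p.Reply1Idx → R) (j : ℕ) (hj : j < p.d + 1) :
    (i : ℕ) → Matrix (Fin (p.dim j)) (Fin (p.dim i)) R :=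
  chain p (prodL p r j)ᵀ (row p r j hj)

/-- Left-hand side `P_i X` of the check of the partial product `P_i`. -/
def checkLhs {a : ℕ} (P : (i : Fin p.d) → Matrix (Fin a) (Fin (p.dim (i + 1))) R)
    (X : p.XIdx → R) (i : Fin p.d) : Matrix (Fin a) (Fin p.checks) R :=
  P i * blk X i

/-- Right-hand side `P_{i-1} (L_i X)` of that check. -/
def checkRhs {a : ℕ} (M : Matrix (Fin a) (Fin (p.dim 0)) R)
    (P : (i : Fin p.d) → Matrix (Fin a) (Fin (p.dim (i + 1))) R)
    (L : p.LIdx → R) (X : p.XIdx → R) (i : Fin p.d) : Matrix (Fin a) (Fin p.checks) R :=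
  chain p M P i * (blkL p L i i.isLt * blk X i)

/-- The random ring elements of the client, as they are used in the protocol. -/
def rL (ρ : p.RandIdx → R) : p.LIdx → R := fun x => ρ (.inl x)
/-- The matrix `H`. -/
def rH (ρ : p.RandIdx → R) : Matrix (Fin (p.dim 0)) (Fin (p.dim p.d)) R :=
  unflat fun x => ρ (.inr (.inl x))
/-- The matrix `G`. -/
def rG (ρ : p.RandIdx → R) : Matrix (Fin (p.dim p.d)) (Fin (p.dim 0)) R :=
  unflat fun x => ρ (.inr (.inr (.inl x)))
/-- The sparse matrix `S_{i+1}`. -/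
def rS (σ : p.MaskIdx → Bool) (ρ : p.RandIdx → R) (i : Fin p.d) :
    Matrix (Fin (p.dim 0)) (Fin (p.dim i)) R :=
  blk (masked (fun x => σ (.inl x)) fun x => ρ (.inr (.inr (.inr (.inl x))))) i
/-- The sparse matrix `T_{i+1}`. -/
def rT (σ : p.MaskIdx → Bool) (ρ : p.RandIdx → R) (i : Fin p.d) :
    Matrix (Fin (p.dim i)) (Fin (p.dim 0)) R :=
  blk (masked (fun x => σ (.inr x)) fun x => ρ (.inr (.inr (.inr (.inr (.inl x)))))) i
/-- The test matrices of the first round (used for all rows of the first reply at once). -/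
def rX1 (ρ : p.RandIdx → R) : p.XIdx → R :=
  fun x => ρ (.inr (.inr (.inr (.inr (.inr (.inl x))))))
/-- The test matrices of the second round. -/
def rX2 (ρ : p.RandIdx → R) : p.XIdx → R :=
  fun x => ρ (.inr (.inr (.inr (.inr (.inr (.inr x))))))

/-- The equations that the client tests after the first reply: left-hand sides. -/
def check1Lhs (ρ : p.RandIdx → R) (r : p.Reply1Idx → R) : p.Chk1Idx → R :=
  fun x => checkLhs p (row p r x.1 x.1.isLt) (rX1 p ρ) x.2.1 x.2.2.1 x.2.2.2
/-- The equations that the client tests after the first reply: right-hand sides. -/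
def check1Rhs (ρ : p.RandIdx → R) (r : p.Reply1Idx → R) : p.Chk1Idx → R :=
  fun x => checkRhs p (prodL p r x.1)ᵀ (row p r x.1 x.1.isLt) (rL p ρ) (rX1 p ρ) x.2.1 x.2.2.1 x.2.2.2

/-- The client does not abort after the first reply. -/
def Check1 (ρ : p.RandIdx → R) (r : p.Reply1Idx → R) : Prop :=
  check1Lhs p ρ r = check1Rhs p ρ r

/-- The mask `A' = H (L_1 ⋯ L_d)ᵀ + ∑ S_{i+1} (L_1 ⋯ L_i)ᵀ`. -/
def maskA (σ : p.MaskIdx → Bool) (ρ : p.RandIdx → R) (r : p.Reply1Idx → R) :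
    Matrix (Fin (p.dim 0)) (Fin (p.dim 0)) R :=
  rH p ρ * (prodL p r p.d)ᵀ + ∑ i : Fin p.d, rS p σ ρ i * (prodL p r i)ᵀ

/-- The mask `B' = (L_1 ⋯ L_d) G + ∑ (L_1 ⋯ L_i) T_{i+1}`. -/
def maskB (σ : p.MaskIdx → Bool) (ρ : p.RandIdx → R) (r : p.Reply1Idx → R) :
    Matrix (Fin (p.dim 0)) (Fin (p.dim 0)) R :=
  prodL p r p.d * rG p ρ + ∑ i : Fin p.d, prodL p r i * rT p σ ρ i

/-- `A_enc`, sent in the second round. -/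
def encA (σ : p.MaskIdx → Bool) (ρ : p.RandIdx → R) (r : p.Reply1Idx → R)
    (A : Matrix (Fin (p.dim 0)) (Fin (p.dim 0)) R) : Matrix (Fin (p.dim 0)) (Fin (p.dim 0)) R :=
  A + maskA p σ ρ r

/-- `B_enc`, sent in the second round. -/
def encB (σ : p.MaskIdx → Bool) (ρ : p.RandIdx → R) (r : p.Reply1Idx → R)
    (B : Matrix (Fin (p.dim 0)) (Fin (p.dim 0)) R) : Matrix (Fin (p.dim 0)) (Fin (p.dim 0)) R :=
  B + maskB p σ ρ r

/-- What the server has received after both messages of the client. -/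
def message (L : p.LIdx → R) (Ae Be : Matrix (Fin (p.dim 0)) (Fin (p.dim 0)) R) :
    p.MsgIdx → R :=
  Sum.elim L (Sum.elim (flat Ae) (flat Be))

/-- The claimed values of `A_enc L_1 ⋯ L_{i+1}` in the second reply. -/
def repLeft (r : p.Reply2Idx → R) (i : Fin p.d) :
    Matrix (Fin (p.dim 0)) (Fin (p.dim (i + 1))) R :=
  blk (fun x : p.LeftIdx => r (.inl x)) i
/-- The claimed value of `A_enc B_enc` in the second reply. -/
def repProd (r : p.Reply2Idx → R) : Matrix (Fin (p.dim 0)) (Fin (p.dim 0)) R :=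
  unflat fun x => r (.inr (.inl x))
/-- The claimed value of `(L_1 ⋯ L_i)ᵀ B_enc`, which for `i = 0` the client knows. -/
def repRight (Be : Matrix (Fin (p.dim 0)) (Fin (p.dim 0)) R) (r : p.Reply2Idx → R) :
    (i : ℕ) → Matrix (Fin (p.dim i)) (Fin (p.dim 0)) R
  | 0 => Be
  | i + 1 => if h : i < p.d then blk (fun x : p.RightIdx => r (.inr (.inr x))) ⟨i, h⟩ else 0

/-- The equations that the client tests after the second reply: left-hand sides. -/
def check2Lhs (ρ : p.RandIdx → R) (r : p.Reply2Idx → R) : p.Chk2Idx → R :=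
  fun x => checkLhs p (repLeft p r) (rX2 p ρ) x.1 x.2.1 x.2.2
/-- The equations that the client tests after the second reply: right-hand sides. -/
def check2Rhs (ρ : p.RandIdx → R) (Ae : Matrix (Fin (p.dim 0)) (Fin (p.dim 0)) R)
    (r : p.Reply2Idx → R) : p.Chk2Idx → R :=
  fun x => checkRhs p Ae (repLeft p r) (rL p ρ) (rX2 p ρ) x.1 x.2.1 x.2.2

/-- The client does not abort after the second reply. -/
def Check2 (ρ : p.RandIdx → R) (Ae : Matrix (Fin (p.dim 0)) (Fin (p.dim 0)) R)
    (r : p.Reply2Idx → R) : Prop :=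
  check2Lhs p ρ r = check2Rhs p ρ Ae r

/-- The client's value of `A L_1 ⋯ L_i`: the input itself for `i = 0`, and otherwise
`A_enc L_1 ⋯ L_i - A' L_1 ⋯ L_i`. -/
def prodAL (σ : p.MaskIdx → Bool) (ρ : p.RandIdx → R) (r₁ : p.Reply1Idx → R)
    (A : Matrix (Fin (p.dim 0)) (Fin (p.dim 0)) R) (r₂ : p.Reply2Idx → R) :
    (i : ℕ) → Matrix (Fin (p.dim 0)) (Fin (p.dim i)) R :=
  chain p A fun i => repLeft p r₂ i -
    (rH p ρ * prodLL p r₁ p.d p.d.lt_succ_self (i + 1) +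
      ∑ j : Fin p.d, rS p σ ρ j * prodLL p r₁ j (Nat.lt_succ_of_lt j.isLt) (i + 1))

/-- The client's output: `A_enc B_enc - A B' - A' B_enc`, where
`A B' = (A L_1 ⋯ L_d) G + ∑ (A L_1 ⋯ L_i) T_{i+1}` and
`A' B_enc = H ((L_1 ⋯ L_d)ᵀ B_enc) + ∑ S_{i+1} ((L_1 ⋯ L_i)ᵀ B_enc)`. -/
def output (σ : p.MaskIdx → Bool) (ρ : p.RandIdx → R) (r₁ : p.Reply1Idx → R)
    (A Be : Matrix (Fin (p.dim 0)) (Fin (p.dim 0)) R) (r₂ : p.Reply2Idx → R) :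
    Matrix (Fin (p.dim 0)) (Fin (p.dim 0)) R :=
  repProd p r₂ -
    (prodAL p σ ρ r₁ A r₂ p.d * rG p ρ + ∑ i : Fin p.d, prodAL p σ ρ r₁ A r₂ i * rT p σ ρ i) -
    (rH p ρ * repRight p Be r₂ p.d + ∑ i : Fin p.d, rS p σ ρ i * repRight p Be r₂ i)

/-- The honest server's first reply. -/
def honest1 (L : p.LIdx → R) : p.Reply1Idx → R :=
  fun x => prodsFrom p (subProd p L x.1)ᵀ L (x.2.1 + 1) x.2.2.1 x.2.2.2

/-- The honest server's second reply. -/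
def honest2 (m : p.MsgIdx → R) : p.Reply2Idx → R :=
  let L : p.LIdx → R := fun x => m (.inl x)
  let Ae : Matrix (Fin (p.dim 0)) (Fin (p.dim 0)) R := unflat fun x => m (.inr (.inl x))
  let Be : Matrix (Fin (p.dim 0)) (Fin (p.dim 0)) R := unflat fun x => m (.inr (.inr x))
  Sum.elim (fun x => prodsFrom p Ae L (x.1 + 1) x.2.1 x.2.2)
    (Sum.elim (flat (Ae * Be)) fun x =>
      ((subProd p L (x.1 + 1))ᵀ * Be) x.2.1 x.2.2)

/-! ### What the protocol achieves -/

/-- With an honest server the client never aborts and always outputs the exact product. -/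
def IsCorrect (R : Type u) [CommRing R] (p : Params) : Prop :=
  ∀ (A B : Matrix (Fin (p.dim 0)) (Fin (p.dim 0)) R) (σ : p.MaskIdx → Bool) (ρ : p.RandIdx → R),
    let r₁ := honest1 p (rL p ρ)
    let Ae := encA p σ ρ r₁ A
    let Be := encB p σ ρ r₁ B
    let r₂ := honest2 p (message p (rL p ρ) Ae Be)
    Check1 p ρ r₁ ∧ Check2 p ρ Ae r₂ ∧ output p σ ρ r₁ A Be r₂ = A * B

/-- Average over all random choices of the client. -/
def clientAvg [Fintype R] [DecidableEq R] (f : (p.MaskIdx → Bool) → (p.RandIdx → R) → ℝ) : ℝ :=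
  maskAvg (Sum.elim (fun x : p.SIdx => p.rate x.1) (fun x : p.TIdx => p.rate x.1)) fun σ =>
    unifAvg fun ρ => f σ ρ

/-- Whatever the server (of unbounded power) does, the probability that the client does not abort
although one of the replies that it checks is not the correct one is at most `2 ^ (-sec)`. -/
def DetectsDeviation (R : Type u) [CommRing R] [Fintype R] [DecidableEq R] (p : Params)
    (sec : ℝ) : Prop :=
  ∀ (A B : Matrix (Fin (p.dim 0)) (Fin (p.dim 0)) R)
    (s₁ : (p.LIdx → R) → (p.Reply1Idx → R)) (s₂ : (p.MsgIdx → R) → (p.Reply2Idx → R)),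
    clientAvg p (fun σ ρ =>
      let r₁ := s₁ (rL p ρ)
      let Ae := encA p σ ρ r₁ A
      let Be := encB p σ ρ r₁ B
      let m := message p (rL p ρ) Ae Be
      let r₂ := s₂ m
      ind (Check1 p ρ r₁ ∧ Check2 p ρ Ae r₂ ∧
        ¬ (r₁ = honest1 p (rL p ρ) ∧ repLeft p r₂ = repLeft p (honest2 p m)))) ≤
      (2 : ℝ) ^ (-sec)

/-- A dishonest server, which computes its two replies by circuits of its own, together with a
distinguisher that inspects the server's view: `L` alone if the client aborts after the first
reply, and otherwise `L`, `A_enc`, `B_enc` and a bit that tells whether the client aborts after the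
second reply. -/
structure Adversary (R : Type u) (p : Params) where
  reply1 : AdvCircuit R p.LIdx p.Reply1Idx
  reply2 : AdvCircuit R p.MsgIdx p.Reply2Idx
  distAbort : AdvCircuit R p.LIdx Unit
  dist : AdvCircuit R (p.MsgIdx ⊕ Unit) Unit

/-- Total number of operations of an adversary. -/
def Adversary.size {p : Params} (adv : Adversary R p) : ℕ :=
  adv.reply1.size + adv.reply2.size + adv.distAbort.size + adv.dist.size

open Classical in
/-- Probability that the distinguisher outputs `1` on the view of the dishonest server in an
interaction with the client on inputs `A`, `B`. -/
def viewProb [Fintype R] [DecidableEq R] (enc : R ≃ Fin (Fintype.card R)) {p : Params}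
    (adv : Adversary R p) (A B : Matrix (Fin (p.dim 0)) (Fin (p.dim 0)) R) : ℝ :=
  clientAvg p fun σ ρ =>
    let L := rL p ρ
    let r₁ := adv.reply1.run enc L
    let Ae := encA p σ ρ r₁ A
    let Be := encB p σ ρ r₁ B
    let m := message p L Ae Be
    let r₂ := adv.reply2.run enc m
    let verdict : R := if Check2 p ρ Ae r₂ then 1 else 0
    if Check1 p ρ r₁ then ind (adv.dist.run enc (Sum.elim m fun _ => verdict) () = 1)
    else ind (adv.distAbort.run enc L () = 1)

/-- Computational zero-knowledge for the server with `sec`-bit security against dishonest servers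
and distinguishers of total size at most `t`: for all inputs, the view is simulated, without
knowledge of the inputs, by running the client on zero matrices. -/
def IsCZK [Fintype R] [DecidableEq R] (enc : R ≃ Fin (Fintype.card R)) (p : Params)
    (t : ℕ) (sec : ℝ) : Prop :=
  ∀ adv : Adversary R p, adv.size ≤ t →
    ∀ A B : Matrix (Fin (p.dim 0)) (Fin (p.dim 0)) R,
      |viewProb enc adv A B - viewProb enc adv 0 0| ≤ (2 : ℝ) ^ (-sec)

/-- The client's computation between the two rounds: the message and both sides of the tests. -/
def ComputesStage2 (σ : p.MaskIdx → Bool)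
    (c : ArithCircuit R (p.NIdx ⊕ p.NIdx ⊕ p.RandIdx ⊕ p.Reply1Idx)
      (p.NIdx ⊕ p.NIdx ⊕ p.Chk1Idx ⊕ p.Chk1Idx)) : Prop :=
  ∀ (A B : Matrix (Fin (p.dim 0)) (Fin (p.dim 0)) R) (ρ : p.RandIdx → R) (r₁ : p.Reply1Idx → R),
    c.run (Sum.elim (flat A) (Sum.elim (flat B) (Sum.elim ρ r₁))) =
      Sum.elim (flat (encA p σ ρ r₁ A)) (Sum.elim (flat (encB p σ ρ r₁ B))
        (Sum.elim (check1Lhs p ρ r₁) (check1Rhs p ρ r₁)))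

/-- The client's computation after the second round, where it still has its inputs, its random
elements, the first reply and its second message: the output and both sides of the tests. -/
def ComputesStage3 (σ : p.MaskIdx → Bool)
    (c : ArithCircuit R
      (p.NIdx ⊕ p.NIdx ⊕ p.NIdx ⊕ p.RandIdx ⊕ p.Reply1Idx ⊕ p.Reply2Idx)
      (p.NIdx ⊕ p.Chk2Idx ⊕ p.Chk2Idx)) : Prop :=
  ∀ (A Ae Be : Matrix (Fin (p.dim 0)) (Fin (p.dim 0)) R) (ρ : p.RandIdx → R)
    (r₁ : p.Reply1Idx → R) (r₂ : p.Reply2Idx → R),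
    c.run (Sum.elim (flat A) (Sum.elim (flat Ae) (Sum.elim (flat Be)
        (Sum.elim ρ (Sum.elim r₁ r₂))))) =
      Sum.elim (flat (output p σ ρ r₁ A Be r₂))
        (Sum.elim (check2Lhs p ρ r₂) (check2Rhs p ρ Ae r₂))

/-- The number of ring elements exchanged in the two rounds. -/
def communication : ℕ :=
  Fintype.card p.MsgIdx + Fintype.card p.Reply1Idx + Fintype.card p.Reply2Idx

/-- The expected cost of the client is at most `bound`. Each drawn ring element, each drawn noise
bit, each element sent or received, each test of an equation, and each ring operation costs one.
The ring operations performed may depend on the positions of the noise (`σ`), but not on any ring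
element. -/
def ClientCostLE (R : Type u) [CommRing R] (p : Params) (bound : ℝ) : Prop :=
  ∃ (c₂ : (p.MaskIdx → Bool) → ArithCircuit R (p.NIdx ⊕ p.NIdx ⊕ p.RandIdx ⊕ p.Reply1Idx)
      (p.NIdx ⊕ p.NIdx ⊕ p.Chk1Idx ⊕ p.Chk1Idx))
    (c₃ : (p.MaskIdx → Bool) → ArithCircuit R
      (p.NIdx ⊕ p.NIdx ⊕ p.NIdx ⊕ p.RandIdx ⊕ p.Reply1Idx ⊕ p.Reply2Idx)
      (p.NIdx ⊕ p.Chk2Idx ⊕ p.Chk2Idx)),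
    (∀ σ, ComputesStage2 p σ (c₂ σ)) ∧ (∀ σ, ComputesStage3 p σ (c₃ σ)) ∧
    maskAvg (Sum.elim (fun x : p.SIdx => p.rate x.1) (fun x : p.TIdx => p.rate x.1))
      (fun σ => ((Fintype.card p.RandIdx + Fintype.card p.MaskIdx + communication p +
        Fintype.card p.Chk1Idx + Fintype.card p.Chk2Idx + (c₂ σ).size + (c₃ σ).size : ℕ) : ℝ))
      ≤ bound

/-- The cost of the honest server is at most `bound`. Each element sent or received and each ring
operation costs one. -/
def ServerCostLE (R : Type u) [CommRing R] (p : Params) (bound : ℝ) : Prop :=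
  ∃ (c₁ : ArithCircuit R p.LIdx p.Reply1Idx) (c₂ : ArithCircuit R p.MsgIdx p.Reply2Idx),
    (∀ L : p.LIdx → R, c₁.run L = honest1 p L) ∧
    (∀ m : p.MsgIdx → R, c₂.run m = honest2 p m) ∧
    ((communication p + c₁.size + c₂.size : ℕ) : ℝ) ≤ bound

end Protocol

end

end Delegation

/-!
The parameters are the dimensions `n_0 = n` and `n_{i+1} = max ⌈δ n_i⌉ ι`, up to the first one that
is at most `max ι 8`, and slightly more than `λ + lg lg n` checks.

*Correctness* is an identity of matrices (`isCorrect`).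

*Detection*: a nonzero row vector over a ring with `1 ≠ 0` is orthogonal to a random column with
probability at most `1 / 2`, since the column can be shifted by a multiple of a unit vector
(`unifAvg_dot_eq_zero_le`). Hence the first wrong product of a sequence passes each of its tests
with probability at most `1 / 2` (`detectsDeviation`). Over a ring with small ideals nothing better
than `1 / 2` holds, so the number of checks must be at least of the order of `λ`, and the cost of
the client is within the bound only if `λ` is at most of the order of `n ^ ε`. This follows from the hypothesis: LPN in dimension
`κ = n` is secure, while the following attack succeeds with a probability of about
`(1 - μ) ^ (n + 1)`, where `n μ ≤ n ^ ε`. From `n + 1` rows of `L`, division-free Gaussian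
elimination computes a row vector `c` with `a c ≠ 0` and `a c L = 0`, where `a` generates a minimal
ideal of `R`, and the attack tests whether `a c y = 0` for a column `y` of the other matrix
(`le_of_lpnSecure`, `le_of_lpnSecure_self`).

*Zero-knowledge*: up to the probability that a wrong first reply is accepted, the view depends only
on `L` and on `[A_encᵀ | B_enc] = [Aᵀ | B] + P_d V + ∑ P_i N_{i+1}`, where `V = [Hᵀ | G]` is uniform
and `N_{i+1} = [S_{i+1}ᵀ | T_{i+1}]` is noise with `2 n` columns. As
`P_{k+1} V + P_k N_{k+1} = P_k (L_{k+1} V + N_{k+1})`, LPN with subspace dimension `n_{k+1}` permits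
to replace the expression in parentheses by a uniform matrix (`abs_hybridProb_sub_le`), and after
`d` such steps the message is a one-time pad (`hybridProb_zero`). The assumption concerns samples
with `⌊n_{k+1} / δ⌋ ≥ n_k` rows and a noise rate that may be lower than the one of the protocol;
rows can be forgotten, and noise can be added, which, against non-uniform adversaries, may be fixed
(`abs_sub_le_of_lpnSecure`).

*Costs*: the dimensions decrease geometrically, so their sum is at most `5 n` and the expected
number of errors in a row of noise is of the order of `n ^ ε`. The client multiplies by sparse
matrices, by matrices with `n_d` columns, and by test matrices (`clientCostLE`). The server cuts its
products, apart from `A_enc B_enc`, into square blocks of size at most `2 δ n` (`serverCostLE`).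
Since the cost of the honest server is polynomial, its first reply can also be computed within the
reduction to LPN.

Circuits are handled through the relation `Comp`, which asserts that some circuit of bounded size
computes given quantities from others, and probabilities as weighted averages `prodAvg`.
-/

namespace Delegation

noncomputable section

set_option linter.unusedSectionVars false

/-! ### Composing circuits -/

section Circuits

variable {R : Type u} {U : Type}

/-- The same operation on renamed wires. -/
def Op.mapWires {V W : Type} (g : V → W) : Op R U V → Op R U W
  | .const c => .const c
  | .add a b => .add (g a) (g b)
  | .sub a b => .sub (g a) (g b)
  | .mul a b => .mul (g a) (g b)
  | .un f a => .un f (g a)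

/-- The same circuit on renamed input wires. -/
def Circuit.mapIn {O : Type} : {V W : Type} → (V → W) → Circuit R U O V → Circuit R U O W
  | _, _, g, .done out => .done (g ∘ out)
  | _, _, g, .step f next => .step (f.mapWires g) (next.mapIn (Option.map g))

/-- The same circuit with selected or duplicated outputs. -/
def Circuit.mapOut {O O' : Type} (g : O' → O) : {V : Type} → Circuit R U O V → Circuit R U O' V
  | _, .done out => .done (out ∘ g)
  | _, .step f next => .step f (next.mapOut g)

/-- Run a first circuit, then a second one on the inputs and outputs of the first. -/
def Circuit.seq {O O' : Type} :
    {V : Type} → Circuit R U O V → Circuit R U O' (V ⊕ O) → Circuit R U O' V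
  | _, .done out, c => c.mapIn (Sum.elim id out)
  | _, .step f next, c => .step f (next.seq (c.mapIn (Sum.map some id)))

/-- An arithmetic operation as an operation of a circuit with extra unary operations. -/
def Op.ofArith {V : Type} : Op R Empty V → Op R U V
  | .const c => .const c
  | .add a b => .add a b
  | .sub a b => .sub a b
  | .mul a b => .mul a b

/-- An arithmetic circuit as a circuit that could use extra unary operations. -/
def Circuit.ofArith {O : Type} : {V : Type} → Circuit R Empty O V → Circuit R U O V
  | _, .done out => .done out
  | _, .step f next => .step f.ofArith next.ofArith

theorem Circuit.size_mapIn {O V W : Type} (g : V → W) (c : Circuit R U O V) :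
    (c.mapIn g).size = c.size := by
  induction c generalizing W with
  | done out => rfl
  | step f next ih => simp [mapIn, size, ih]

theorem Circuit.size_mapOut {O O' V : Type} (g : O' → O) (c : Circuit R U O V) :
    (c.mapOut g).size = c.size := by
  induction c with
  | done out => rfl
  | step f next ih => simp [mapOut, size, ih]

theorem Circuit.size_seq {O O' V : Type} (c : Circuit R U O V) (c' : Circuit R U O' (V ⊕ O)) :
    (c.seq c').size = c.size + c'.size := by
  induction c with
  | done out => simp [seq, size, size_mapIn]
  | step f next ih => simp [seq, size, ih, size_mapIn]; omega

theorem Circuit.size_ofArith {O V : Type} (c : Circuit R Empty O V) :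
    (c.ofArith (U := U)).size = c.size := by
  induction c with
  | done out => rfl
  | step f next ih => simp [ofArith, size, ih]

/-- The quantity `f x` is one of the quantities `e x`, always at the same position. -/
def IsWire {X : Type*} {V : Type} (e : X → V → R) (f : X → R) : Prop :=
  ∃ v, ∀ x, f x = e x v

section

variable {X : Type*} {V V' : Type} {e : X → V → R}

theorem IsWire.self (v : V) : IsWire e (fun x => e x v) := ⟨v, fun _ => rfl⟩

theorem IsWire.inl {f : X → R} (h : IsWire e f) (e' : X → V' → R) :
    IsWire (fun x => Sum.elim (e x) (e' x)) f := by
  obtain ⟨v, hv⟩ := h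
  exact ⟨.inl v, hv⟩

theorem IsWire.inr {f : X → R} (h : IsWire e f) (e' : X → V' → R) :
    IsWire (fun x => Sum.elim (e' x) (e x)) f := by
  obtain ⟨v, hv⟩ := h
  exact ⟨.inr v, hv⟩

theorem IsWire.congr {f g : X → R} (h : IsWire e f) (hfg : ∀ x, g x = f x) : IsWire e g := by
  obtain ⟨v, hv⟩ := h
  exact ⟨v, fun x => (hfg x).trans (hv x)⟩

end

variable [CommRing R] (sem : U → R → R)

theorem Op.eval_mapWires {V W : Type} (g : V → W) (f : Op R U V) (x : W → R) :
    (f.mapWires g).eval sem x = f.eval sem (x ∘ g) := by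
  cases f <;> rfl

theorem Circuit.eval_mapIn {O V W : Type} (g : V → W) (c : Circuit R U O V) (x : W → R) :
    (c.mapIn g).eval sem x = c.eval sem (x ∘ g) := by
  induction c generalizing W with
  | done out => rfl
  | step f next ih =>
    simp only [mapIn, eval, ih, Op.eval_mapWires]
    congr 1
    funext w
    cases w <;> rfl

theorem Circuit.eval_mapOut {O O' V : Type} (g : O' → O) (c : Circuit R U O V) (x : V → R) :
    (c.mapOut g).eval sem x = c.eval sem x ∘ g := by
  induction c with
  | done out => rfl
  | step f next ih => simp only [mapOut, eval, ih]

theorem Circuit.eval_seq {O O' V : Type} (c : Circuit R U O V) (c' : Circuit R U O' (V ⊕ O))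
    (x : V → R) : (c.seq c').eval sem x = c'.eval sem (Sum.elim x (c.eval sem x)) := by
  induction c with
  | done out =>
    simp only [seq, eval, eval_mapIn]
    congr 1
    funext w
    cases w <;> rfl
  | step f next ih =>
    simp only [seq, eval, ih, eval_mapIn]
    congr 1
    funext w
    cases w <;> rfl

theorem Circuit.eval_ofArith {O V : Type} (c : Circuit R Empty O V) (x : V → R) :
    (c.ofArith (U := U)).eval sem x = ArithCircuit.run c x := by
  induction c with
  | done out => rfl
  | step f next ih =>
    simp only [ofArith, eval, ih, ArithCircuit.run]
    congr 1
    funext w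
    cases w
    · cases f with
      | un f a => exact f.elim
      | _ => rfl
    · rfl

/-- The quantities `F x` can be computed from the quantities `e x` with at most `s` operations,
by one circuit for all `x : X`. -/
def Comp {X : Type*} {V O : Type} (e : X → V → R) (F : X → O → R) (s : ℕ) : Prop :=
  ∃ c : Circuit R U O V, c.size ≤ s ∧ ∀ x, c.eval sem (e x) = F x

/-- A single quantity can be computed with at most `s` operations. -/
abbrev CompOne {X : Type*} {V : Type} (e : X → V → R) (f : X → R) (s : ℕ) : Prop :=
  Comp sem e (fun x (_ : Unit) => f x) s

section

variable {sem} {X : Type*} {V V' O O' : Type} {e : X → V → R}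

theorem Comp.mono {F : X → O → R} {s s' : ℕ} (h : Comp sem e F s) (hs : s ≤ s') :
    Comp sem e F s' := by
  obtain ⟨c, hc, h⟩ := h
  exact ⟨c, hc.trans hs, h⟩

theorem Comp.congr {F G : X → O → R} {s : ℕ} (h : Comp sem e F s) (hs : ∀ x, G x = F x) :
    Comp sem e G s := by
  obtain ⟨c, hc, h⟩ := h
  exact ⟨c, hc, fun x => (h x).trans (hs x).symm⟩

theorem Comp.of_wires {F : X → O → R} (h : ∀ o, IsWire e (fun x => F x o)) : Comp sem e F 0 := by
  choose w hw using h
  exact ⟨.done w, le_rfl, fun x => funext fun o => (hw o x).symm⟩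

/-- A computation may be transported to inputs among which its own inputs are found. -/
theorem Comp.weaken {e' : X → V' → R} {F : X → O → R} {s : ℕ} (h : Comp sem e F s)
    (hw : ∀ v, IsWire e' (fun x => e x v)) : Comp sem e' F s := by
  obtain ⟨c, hc, h⟩ := h
  choose w hw using hw
  refine ⟨c.mapIn w, (c.size_mapIn w).trans_le hc, fun x => ?_⟩
  rw [Circuit.eval_mapIn, ← h x]
  congr 1
  funext v
  exact (hw v x).symm

theorem Comp.comap {X' : Type*} {F : X → O → R} {s : ℕ} (h : Comp sem e F s) (g : X' → X) :
    Comp sem (fun x => e (g x)) (fun x => F (g x)) s := by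
  obtain ⟨c, hc, h⟩ := h
  exact ⟨c, hc, fun x => h (g x)⟩

theorem Comp.select {F : X → O → R} {s : ℕ} (h : Comp sem e F s) (g : O' → O) :
    Comp sem e (fun x o => F x (g o)) s := by
  obtain ⟨c, hc, h⟩ := h
  refine ⟨c.mapOut g, (c.size_mapOut g).trans_le hc, fun x => ?_⟩
  rw [Circuit.eval_mapOut, h x]
  rfl

/-- Intermediate results `F` may be used by later computations. -/
theorem Comp.bind {F : X → O → R} {G : X → O' → R} {s s' : ℕ} (h : Comp sem e F s)
    (h' : Comp sem (fun x => Sum.elim (e x) (F x)) G s') : Comp sem e G (s + s') := by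
  obtain ⟨c, hc, h⟩ := h
  obtain ⟨c', hc', h'⟩ := h'
  refine ⟨c.seq c', (c.size_seq c').trans_le (add_le_add hc hc'), fun x => ?_⟩
  rw [Circuit.eval_seq, h x, h' x]

theorem Comp.pair {F : X → O → R} {G : X → O' → R} {s s' : ℕ} (h : Comp sem e F s)
    (h' : Comp sem e G s') : Comp sem e (fun x => Sum.elim (F x) (G x)) (s + s') := by
  refine h.bind ?_
  have h2 : Comp sem (fun x => Sum.elim (e x) (F x)) G s' :=
    h'.weaken fun v => (IsWire.self v).inl F
  refine (h2.bind (Comp.of_wires (F := fun x => Sum.elim (F x) (G x)) ?_)).mono (by omega)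
  rintro (o | o)
  · exact ((IsWire.self o).inr e).inl G
  · exact (IsWire.self o).inr _

/-- A family of computations; the costs add up. -/
theorem Comp.sigma {I : Type} [Fintype I] {O : I → Type} {F : (i : I) → X → O i → R}
    {s : I → ℕ} (h : ∀ i, Comp sem e (F i) (s i)) :
    Comp sem e (fun x (y : (i : I) × O i) => F y.1 x y.2) (∑ i, s i) := by
  classical
  suffices H : ∀ S : Finset I,
      Comp sem e (fun x (y : (i : S) × O i.1) => F y.1.1 x y.2)
        (∑ i ∈ S, s i) by
    exact (H Finset.univ).select fun y : (i : I) × O i => ⟨⟨y.1, Finset.mem_univ _⟩, y.2⟩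
  intro S
  induction S using Finset.induction_on with
  | empty => exact Comp.of_wires fun y => absurd y.1.2 (Finset.notMem_empty _)
  | insert a S ha ih =>
    rw [Finset.sum_insert ha]
    have h2 := ((h a).pair ih).bind (G := fun x (y : (i : ↥(insert a S)) × O i.1) => F y.1.1 x y.2)
      (s' := 0) ?_
    · simpa using h2
    · refine Comp.of_wires ?_
      rintro ⟨⟨i, hi⟩, o⟩
      by_cases hia : i = a
      · subst hia
        exact (((IsWire.self o).inl _).inr e)
      · exact (((IsWire.self (e := fun x (y : (i : S) × O i.1) => F y.1.1 x y.2)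
          ⟨⟨i, Finset.mem_of_mem_insert_of_ne hi hia⟩, o⟩).inr _).inr e)

theorem Comp.pi {I : Type} [Fintype I] {F : X → I → R}
    {s : I → ℕ} (h : ∀ i, CompOne sem e (fun x => F x i) (s i)) :
    Comp sem e F (∑ i, s i) :=
  (Comp.sigma h).select fun i => ⟨i, ()⟩

theorem IsWire.comp {f : X → R} (h : IsWire e f) : CompOne sem e f 0 := Comp.of_wires fun _ => h

theorem CompOne.const (r : R) : CompOne sem e (fun _ => r) 1 :=
  ⟨.step (.const r) (.done fun _ => none), le_rfl, fun _ => rfl⟩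

theorem CompOne.un {f : X → R} {s : ℕ} (h : CompOne sem e f s) (g : U) :
    CompOne sem e (fun x => sem g (f x)) (s + 1) :=
  h.bind ⟨.step (.un g (.inr ())) (.done fun _ => none), le_rfl, fun _ => rfl⟩

theorem CompOne.add {f g : X → R} {s s' : ℕ} (h : CompOne sem e f s) (h' : CompOne sem e g s') :
    CompOne sem e (fun x => f x + g x) (s + s' + 1) :=
  (h.pair h').bind
    ⟨.step (.add (.inr (.inl ())) (.inr (.inr ()))) (.done fun _ => none), le_rfl, fun _ => rfl⟩

theorem CompOne.sub {f g : X → R} {s s' : ℕ} (h : CompOne sem e f s) (h' : CompOne sem e g s') :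
    CompOne sem e (fun x => f x - g x) (s + s' + 1) :=
  (h.pair h').bind
    ⟨.step (.sub (.inr (.inl ())) (.inr (.inr ()))) (.done fun _ => none), le_rfl, fun _ => rfl⟩

theorem CompOne.mul {f g : X → R} {s s' : ℕ} (h : CompOne sem e f s) (h' : CompOne sem e g s') :
    CompOne sem e (fun x => f x * g x) (s + s' + 1) :=
  (h.pair h').bind
    ⟨.step (.mul (.inr (.inl ())) (.inr (.inr ()))) (.done fun _ => none), le_rfl, fun _ => rfl⟩

theorem CompOne.sum {I : Type*} (S : Finset I) {f : I → X → R} {s : I → ℕ}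
    (h : ∀ i ∈ S, CompOne sem e (f i) (s i)) :
    CompOne sem e (fun x => ∑ i ∈ S, f i x) (∑ i ∈ S, (s i + 1) + 1) := by
  classical
  induction S using Finset.induction_on with
  | empty => simpa using CompOne.const (0 : R)
  | insert a S ha ih =>
    have h2 := (h a (Finset.mem_insert_self a S)).add
      (ih fun i hi => h i (Finset.mem_insert_of_mem hi))
    refine (h2.congr fun x => ?_).mono ?_
    · funext; simp [Finset.sum_insert ha]
    · simp only [Finset.sum_insert ha]; omega

theorem CompOne.prod {I : Type*} (S : Finset I) {f : I → X → R} {s : I → ℕ}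
    (h : ∀ i ∈ S, CompOne sem e (f i) (s i)) :
    CompOne sem e (fun x => ∏ i ∈ S, f i x) (∑ i ∈ S, (s i + 1) + 1) := by
  classical
  induction S using Finset.induction_on with
  | empty => simpa using CompOne.const (1 : R)
  | insert a S ha ih =>
    have h2 := (h a (Finset.mem_insert_self a S)).mul
      (ih fun i hi => h i (Finset.mem_insert_of_mem hi))
    refine (h2.congr fun x => ?_).mono ?_
    · funext; simp [Finset.prod_insert ha]
    · simp only [Finset.sum_insert ha]; omega

/-- An inner product of `k` pairs of wires costs at most `2 k + 1`. -/
theorem CompOne.dot {I : Type*} (S : Finset I) {f g : I → X → R}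
    (hf : ∀ i ∈ S, IsWire e (f i)) (hg : ∀ i ∈ S, IsWire e (g i)) :
    CompOne sem e (fun x => ∑ i ∈ S, f i x * g i x) (2 * S.card + 1) := by
  refine (CompOne.sum S (s := fun _ => 1) fun i hi => ?_).mono ?_
  · exact (hf i hi).comp.mul (hg i hi).comp
  · simp [mul_comm]

theorem Comp.matMul {a b c : Type} [Fintype a] [Fintype b] [Fintype c]
    {M : X → Matrix a b R} {N : X → Matrix b c R}
    (hM : ∀ i j, IsWire e fun x => M x i j) (hN : ∀ i j, IsWire e fun x => N x i j) :
    Comp sem e (fun x (y : a × c) => (M x * N x) y.1 y.2)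
      (Fintype.card a * Fintype.card c * (2 * Fintype.card b + 1)) := by
  refine (Comp.pi (F := fun x (y : a × c) => (M x * N x) y.1 y.2)
    (s := fun _ => 2 * Fintype.card b + 1) fun y => ?_).mono ?_
  · exact CompOne.dot Finset.univ (fun i _ => hM y.1 i) (fun i _ => hN i y.2)
  · simp

theorem Comp.ofArith {F : X → O → R} {s : ℕ}
    (h : Comp (fun f : Empty => f.elim) e F s) : Comp sem e F s := by
  obtain ⟨c, hc, h⟩ := h
  exact ⟨c.ofArith, c.size_ofArith.trans_le hc, fun x => by rw [Circuit.eval_ofArith]; exact h x⟩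

end

end Circuits

/-! ### Averages over independent choices -/

section ProdAvg

/-- Average over a family of independent elements of `α`, the `i`-th of which has
distribution `w i`. Both `unifAvg` and `maskAvg` are of this form. -/
def prodAvg {I α : Type*} [Fintype I] [DecidableEq I] [Fintype α] (w : I → α → ℝ)
    (f : (I → α) → ℝ) : ℝ :=
  ∑ x, (∏ i, w i (x i)) * f x

/-- Each `w i` is a probability distribution. -/
structure IsDist {I α : Type*} [Fintype α] (w : I → α → ℝ) : Prop where
  nonneg : ∀ i a, 0 ≤ w i a
  sum_eq : ∀ i, ∑ a, w i a = 1

variable {I J α β : Type*} [Fintype I] [DecidableEq I] [Fintype J] [DecidableEq J]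
  [Fintype α] [Fintype β] {w : I → α → ℝ}

theorem IsDist.comp {w : I → α → ℝ} (h : IsDist w) (j : J → I) : IsDist (fun i => w (j i)) :=
  ⟨fun _ _ => h.nonneg _ _, fun _ => h.sum_eq _⟩

theorem prodAvg_const (h : IsDist w) (c : ℝ) : prodAvg w (fun _ => c) = c := by
  classical
  have := Finset.prod_univ_sum (fun _ : I => (Finset.univ : Finset α)) w
  simp only [h.sum_eq, Finset.prod_const_one, Fintype.piFinset_univ] at this
  rw [prodAvg, ← Finset.sum_mul, ← this, one_mul]

theorem prodAvg_congr {f g : (I → α) → ℝ} (h : ∀ x, f x = g x) : prodAvg w f = prodAvg w g :=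
  congrArg (prodAvg w) (funext h)

theorem prodAvg_add (f g : (I → α) → ℝ) :
    prodAvg w (fun x => f x + g x) = prodAvg w f + prodAvg w g := by
  simp only [prodAvg, mul_add, Finset.sum_add_distrib]

theorem prodAvg_sub (f g : (I → α) → ℝ) :
    prodAvg w (fun x => f x - g x) = prodAvg w f - prodAvg w g := by
  simp only [prodAvg, mul_sub, Finset.sum_sub_distrib]

theorem prodAvg_const_mul (c : ℝ) (f : (I → α) → ℝ) :
    prodAvg w (fun x => c * f x) = c * prodAvg w f := by
  simp only [prodAvg, Finset.mul_sum]
  exact Finset.sum_congr rfl fun x _ => by ring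

theorem prodAvg_mono (h : IsDist w) {f g : (I → α) → ℝ} (hfg : ∀ x, f x ≤ g x) :
    prodAvg w f ≤ prodAvg w g :=
  Finset.sum_le_sum fun x _ =>
    mul_le_mul_of_nonneg_left (hfg x) (Finset.prod_nonneg fun _ _ => h.nonneg _ _)

theorem prodAvg_le (h : IsDist w) {f : (I → α) → ℝ} {c : ℝ} (hf : ∀ x, f x ≤ c) :
    prodAvg w f ≤ c :=
  (prodAvg_mono h hf).trans_eq (prodAvg_const h c)

theorem le_prodAvg (h : IsDist w) {f : (I → α) → ℝ} {c : ℝ} (hf : ∀ x, c ≤ f x) :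
    c ≤ prodAvg w f :=
  (prodAvg_const h c).symm.trans_le (prodAvg_mono h hf)

theorem abs_prodAvg_sub_le (h : IsDist w) {f g : (I → α) → ℝ} {c : ℝ}
    (hf : ∀ x, |f x - g x| ≤ c) : |prodAvg w f - prodAvg w g| ≤ c := by
  rw [← prodAvg_sub, abs_le]
  exact ⟨le_prodAvg h fun x => (abs_le.1 (hf x)).1, prodAvg_le h fun x => (abs_le.1 (hf x)).2⟩

theorem abs_prodAvg_sub_le_prodAvg (h : IsDist w) {f g b : (I → α) → ℝ}
    (hf : ∀ x, |f x - g x| ≤ b x) : |prodAvg w f - prodAvg w g| ≤ prodAvg w b := by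
  have h1 := prodAvg_mono h fun x => (abs_le.1 (hf x)).2
  have h2 := prodAvg_mono h fun x => (abs_le.1 (hf x)).1
  have h3 : prodAvg w (fun x => -b x) = -prodAvg w b := by
    simpa using prodAvg_const_mul (w := w) (-1) b
  rw [prodAvg_sub] at h1 h2
  exact abs_le.2 ⟨h3.symm.trans_le h2, h1⟩

theorem prodAvg_comm (w' : J → β → ℝ) (f : (I → α) → (J → β) → ℝ) :
    prodAvg w (fun x => prodAvg w' fun y => f x y) =
      prodAvg w' (fun y => prodAvg w fun x => f x y) := by
  simp only [prodAvg, Finset.mul_sum]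
  rw [Finset.sum_comm]
  exact Finset.sum_congr rfl fun x _ => Finset.sum_congr rfl fun y _ => by ring

theorem prodAvg_equiv (e : J ≃ I) (f : (I → α) → ℝ) :
    prodAvg w f = prodAvg (fun j => w (e j)) (fun y => f (fun i => y (e.symm i))) := by
  refine Fintype.sum_equiv (e.arrowCongr (Equiv.refl α)).symm _ _ fun x => ?_
  congr 1
  · rw [← e.prod_comp]
    rfl
  · congr 1
    funext i
    simp

theorem prodAvg_sum (w : I ⊕ J → α → ℝ) (f : (I ⊕ J → α) → ℝ) :
    prodAvg w f = prodAvg (fun i => w (.inl i)) fun x => prodAvg (fun j => w (.inr j)) fun y =>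
      f (Sum.elim x y) := by
  simp only [prodAvg, Finset.mul_sum]
  rw [← Fintype.sum_prod_type']
  refine Fintype.sum_equiv (Equiv.sumArrowEquivProdArrow I J α) _ _ fun x => ?_
  simp only [Fintype.prod_sum_type, Equiv.sumArrowEquivProdArrow, Equiv.coe_fn_mk]
  rw [← mul_assoc]
  congr 2
  funext i
  cases i <;> rfl

theorem exists_equiv_of_injective {j : J → I} (hj : Function.Injective j) :
    ∃ (S : Set I) (e : J ⊕ S ≃ I), (∀ i, e (.inl i) = j i) ∧
      ∀ (l : J → α) (z : S → α) (x : I → α), (∀ i : S, x (e (.inr i)) = z i) →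
        Function.extend j l x = fun i => (Sum.elim l z : J ⊕ S → α) (e.symm i) := by
  classical
  let e : J ⊕ ↥(Set.range j)ᶜ ≃ I :=
    ((Equiv.ofInjective j hj).sumCongr (Equiv.refl _)).trans (Equiv.Set.sumCompl (Set.range j))
  have h1 : ∀ i, e (.inl i) = j i := fun i => by simp [e]
  refine ⟨(Set.range j)ᶜ, e, h1, fun l z x hx => funext fun i => ?_⟩
  obtain ⟨y, rfl⟩ := e.surjective i
  rw [e.symm_apply_apply]
  rcases y with y | y
  · rw [h1, hj.extend_apply]; rfl
  · rw [Function.extend_apply', hx]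
    · rfl
    · have : e (.inr y) = y := by simp [e]
      rw [this]
      exact y.2

/-- Averages of functions of only some of the coordinates. -/
theorem prodAvg_comp_injective (h : IsDist w) {j : J → I} (hj : Function.Injective j)
    (f : (J → α) → ℝ) :
    prodAvg w (fun x => f (fun i => x (j i))) = prodAvg (fun i => w (j i)) f := by
  classical
  obtain ⟨S, e, he, -⟩ := exists_equiv_of_injective (α := α) hj
  rw [prodAvg_equiv e, prodAvg_sum]
  simp only [he]
  refine congrArg _ (funext fun x => ?_)
  have : ∀ (y : S → α) (i : J), (Sum.elim x y : J ⊕ S → α) (e.symm (j i)) = x i := by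
    intro y i
    rw [← he, e.symm_apply_apply]; rfl
  simp only [this]
  exact prodAvg_const (h.comp _) _

/-- Some coordinates may be drawn a second time without changing the average. -/
theorem prodAvg_resample (h : IsDist w) {j : J → I} (hj : Function.Injective j)
    (f : (I → α) → ℝ) :
    prodAvg w f =
      prodAvg w fun x => prodAvg (fun i => w (j i)) fun l => f (Function.extend j l x) := by
  classical
  obtain ⟨S, e, he, hext⟩ := exists_equiv_of_injective (α := α) hj
  rw [prodAvg_equiv e, prodAvg_sum, prodAvg_equiv e (f := fun x => prodAvg _ _), prodAvg_sum]
  simp only [he]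
  have : ∀ (x : J → α) (y : S → α) (l : J → α), Function.extend j l
      (fun i => (Sum.elim x y : J ⊕ S → α) (e.symm i)) =
      fun i => (Sum.elim l y : J ⊕ S → α) (e.symm i) := fun x y l =>
    hext l y _ fun i => by rw [e.symm_apply_apply]; rfl
  simp only [this]
  rw [prodAvg_const (h.comp _), prodAvg_comm]

theorem prodAvg_prod (w' : I → β → ℝ) (f : (I → α) → (I → β) → ℝ) :
    prodAvg w (fun x => prodAvg w' fun y => f x y) =
      prodAvg (fun i (p : α × β) => w i p.1 * w' i p.2)
        (fun z => f (fun i => (z i).1) (fun i => (z i).2)) := by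
  simp only [prodAvg, Finset.mul_sum]
  rw [← Fintype.sum_prod_type']
  refine (Fintype.sum_equiv (Equiv.arrowProdEquivProdArrow I (fun _ => α) (fun _ => β)) _ _
    fun x => ?_).symm
  simp only [Equiv.arrowProdEquivProdArrow, Equiv.coe_fn_mk, Finset.prod_mul_distrib, mul_assoc]

/-- The distribution of independent choices under a map of each of them. -/
theorem prodAvg_map [DecidableEq β] (h : α → β) (f : (I → β) → ℝ) :
    prodAvg w (fun x => f (fun i => h (x i))) =
      prodAvg (fun i b => ∑ a with h a = b, w i a) f := by
  classical
  simp only [prodAvg, Finset.prod_univ_sum, Finset.sum_mul]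
  rw [← Finset.sum_fiberwise Finset.univ (fun (x : I → α) i => h (x i))]
  refine Finset.sum_congr rfl fun y _ => Finset.sum_congr ?_ fun x hx => ?_
  · ext x
    simp [funext_iff]
  · have : ∀ i, h (x i) = y i := by simpa using hx
    simp only [this]

end ProdAvg

section Averages

variable {R : Type u} [Fintype R] [DecidableEq R] {I J : Type} [Fintype I] [DecidableEq I]
  [Fintype J] [DecidableEq J]

/-- The uniform weights. -/
def unifW (R : Type u) [Fintype R] (I : Type) : I → R → ℝ := fun _ _ => (Fintype.card R : ℝ)⁻¹

theorem unifAvg_eq (f : (I → R) → ℝ) : unifAvg f = prodAvg (unifW R I) f := by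
  simp only [unifAvg, prodAvg, unifW, Finset.prod_const, Finset.card_univ, ← Finset.mul_sum]
  rw [div_eq_inv_mul, inv_pow]

theorem isDist_unifW [Nonempty R] : IsDist (unifW R I) where
  nonneg _ _ := by unfold unifW; positivity
  sum_eq i := by simp [unifW]

theorem prodAvg_unifW_add [AddCommGroup R] (w : I → R) (f : (I → R) → ℝ) :
    prodAvg (unifW R I) (fun x => f (x + w)) = prodAvg (unifW R I) f :=
  Fintype.sum_equiv (Equiv.addRight w) _ _ fun _ => rfl

/-- The weights of a biased bit. -/
def bitW (μ : I → ℝ) : I → Bool → ℝ := fun i b => if b = true then μ i else 1 - μ i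

theorem maskAvg_eq (μ : I → ℝ) (f : (I → Bool) → ℝ) : maskAvg μ f = prodAvg (bitW μ) f := rfl

theorem isDist_bitW {μ : I → ℝ} (h0 : ∀ i, 0 ≤ μ i) (h1 : ∀ i, μ i ≤ 1) : IsDist (bitW μ) where
  nonneg i b := by
    have := h0 i
    have := h1 i
    unfold bitW
    split <;> linarith
  sum_eq i := by simp [bitW]

/-- The weights of a noise entry, which is zero except with probability `μ i`, when it is
uniformly random. -/
def noiseW (R : Type u) [Fintype R] [DecidableEq R] [Zero R] {I : Type*} (μ : I → ℝ) :
    I → R → ℝ :=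
  fun i x => (if x = 0 then 1 - μ i else 0) + μ i * (Fintype.card R : ℝ)⁻¹

theorem isDist_noiseW [Zero R] {μ : I → ℝ} (h0 : ∀ i, 0 ≤ μ i) (h1 : ∀ i, μ i ≤ 1) :
    IsDist (noiseW R μ) where
  nonneg i b := by
    have := h0 i
    have := sub_nonneg.2 (h1 i)
    unfold noiseW
    split <;> positivity
  sum_eq i := by
    have : Nonempty R := ⟨0⟩
    have hq : (Fintype.card R : ℝ) ≠ 0 := by simp
    simp [noiseW, Finset.sum_add_distrib]
    field_simp
    ring

theorem maskAvg_unifAvg_masked [Zero R] (μ : I → ℝ) (f : (I → R) → ℝ) :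
    maskAvg μ (fun σ => unifAvg fun x : I → R => f (masked σ x)) = prodAvg (noiseW R μ) f := by
  have : Nonempty R := ⟨0⟩
  simp only [maskAvg_eq, unifAvg_eq]
  rw [prodAvg_prod]
  refine (prodAvg_map (fun p : Bool × R => if p.1 = true then p.2 else 0) f).trans ?_
  congr 1
  funext i b
  rw [Finset.sum_filter, Fintype.sum_prod_type]
  simp [bitW, noiseW, unifW, Finset.sum_ite_eq', eq_comm (a := b)]
  have hq : (Fintype.card R : ℝ) ≠ 0 := by simp
  split
  · field_simp
    ring
  · ring

/-- Noise of a higher rate is the sum of noise of a lower rate and independent noise. -/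
theorem prodAvg_noiseW_add [CommRing R] {μ μ' μ'' : I → ℝ}
    (h : ∀ i, 1 - μ' i = (1 - μ i) * (1 - μ'' i)) (f : (I → R) → ℝ) :
    prodAvg (noiseW R μ') f =
      prodAvg (noiseW R μ'') fun z => prodAvg (noiseW R μ) fun y => f (y + z) := by
  have h2 := prodAvg_map (w := fun i (p : R × R) => noiseW R μ'' i p.1 * noiseW R μ i p.2)
    (fun p => p.2 + p.1) f
  rw [prodAvg_prod]
  refine Eq.trans ?_ h2.symm
  congr 1
  funext i b
  rw [Finset.sum_filter, Fintype.sum_prod_type]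
  have hq : (Fintype.card R : ℝ) ≠ 0 := by simp
  have h3 : ∀ z y : R, y + z = b ↔ y = b - z := fun z y => eq_sub_iff_add_eq.symm
  simp only [h3, Finset.sum_ite_eq', Finset.mem_univ, if_true]
  simp only [noiseW, sub_eq_zero, mul_add, add_mul, Finset.sum_add_distrib, ite_mul, mul_ite,
    zero_mul, mul_zero, Finset.sum_ite_eq, Finset.sum_ite_eq', Finset.mem_univ, if_true,
    Finset.sum_const, Finset.card_univ, nsmul_eq_mul]
  have h4 : μ' i = μ i + μ'' i - μ i * μ'' i := by linear_combination -(h i)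
  rw [h i, h4]
  split <;> field_simp <;> ring

end Averages

section Indicator

theorem ind_nonneg (P : Prop) : 0 ≤ ind P := by unfold ind; split <;> norm_num

theorem ind_le_one (P : Prop) : ind P ≤ 1 := by unfold ind; split <;> norm_num

theorem ind_of_true {P : Prop} (h : P) : ind P = 1 := if_pos h

theorem ind_of_false {P : Prop} (h : ¬ P) : ind P = 0 := if_neg h

theorem ind_mono {P Q : Prop} (h : P → Q) : ind P ≤ ind Q := by
  by_cases hP : P
  · rw [ind_of_true hP, ind_of_true (h hP)]
  · rw [ind_of_false hP]; exact ind_nonneg Q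

end Indicator

/-! ### Products of the subspace matrices and correctness -/

section Algebra

variable {R : Type u} [CommRing R] (p : Params)

theorem prodsFrom_succ {a : ℕ} (M : Matrix (Fin a) (Fin (p.dim 0)) R) (L : p.LIdx → R) {i : ℕ}
    (h : i < p.d) : prodsFrom p M L (i + 1) = prodsFrom p M L i * blkL p L i h := by
  simp [prodsFrom, h]

theorem prodsFrom_eq_mul {a : ℕ} (M : Matrix (Fin a) (Fin (p.dim 0)) R) (L : p.LIdx → R) (i : ℕ) :
    prodsFrom p M L i = M * subProd p L i := by
  induction i with
  | zero => simp [subProd, prodsFrom]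
  | succ i ih => simp only [subProd, prodsFrom] at *; rw [ih, Matrix.mul_assoc]

theorem subProd_zero (L : p.LIdx → R) : subProd p L 0 = 1 := rfl

theorem subProd_succ (L : p.LIdx → R) {i : ℕ} (h : i < p.d) :
    subProd p L (i + 1) = subProd p L i * blkL p L i h :=
  prodsFrom_succ p 1 L h

theorem chain_succ {a : ℕ} (M : Matrix (Fin a) (Fin (p.dim 0)) R)
    (P : (i : Fin p.d) → Matrix (Fin a) (Fin (p.dim (i + 1))) R) (i : Fin p.d) :
    chain p M P (i + 1) = P i := by
  simp [chain]

/-- The recursion by which products are checked determines them. -/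
theorem forall_eq_prodsFrom_iff {a : ℕ} (M : Matrix (Fin a) (Fin (p.dim 0)) R)
    (P : (i : Fin p.d) → Matrix (Fin a) (Fin (p.dim (i + 1))) R) (L : p.LIdx → R) :
    (∀ i : Fin p.d, P i = prodsFrom p M L (i + 1)) ↔
      ∀ i : Fin p.d, P i = chain p M P i * blkL p L i i.isLt := by
  constructor
  · intro h i
    rw [h i, prodsFrom_succ p M L i.isLt]
    congr 1
    obtain ⟨i, hi⟩ := i
    cases i with
    | zero => rfl
    | succ i =>
      exact ((chain_succ p M P ⟨i, by omega⟩).trans (h ⟨i, by omega⟩)).symm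
  · rintro h ⟨i, hi⟩
    induction i with
    | zero => rw [h, prodsFrom_succ p M L hi]; rfl
    | succ i ih =>
      have h2 := ih (by omega)
      rw [h, prodsFrom_succ p M L hi]
      exact congrArg (· * _) ((chain_succ p M P ⟨i, by omega⟩).trans h2)

theorem chain_eq_prodsFrom {a : ℕ} {M : Matrix (Fin a) (Fin (p.dim 0)) R}
    {P : (i : Fin p.d) → Matrix (Fin a) (Fin (p.dim (i + 1))) R} {L : p.LIdx → R}
    (h : ∀ i : Fin p.d, P i = prodsFrom p M L (i + 1)) {i : ℕ} (hi : i ≤ p.d) :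
    chain p M P i = prodsFrom p M L i := by
  cases i with
  | zero => rfl
  | succ i => exact (chain_succ p M P ⟨i, hi⟩).trans (h ⟨i, hi⟩)

theorem checkLhs_eq_checkRhs {a : ℕ} {M : Matrix (Fin a) (Fin (p.dim 0)) R}
    {P : (i : Fin p.d) → Matrix (Fin a) (Fin (p.dim (i + 1))) R} {L : p.LIdx → R}
    (h : ∀ i : Fin p.d, P i = prodsFrom p M L (i + 1)) (X : p.XIdx → R) (i : Fin p.d) :
    checkLhs p P X i = checkRhs p M P L X i := by
  rw [checkLhs, checkRhs, ← Matrix.mul_assoc,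
    ← (forall_eq_prodsFrom_iff p M P L).1 h i]

theorem row_honest1 (L : p.LIdx → R) (j : ℕ) (hj : j < p.d + 1) (i : Fin p.d) :
    row p (honest1 p L) j hj i = prodsFrom p (subProd p L j)ᵀ L (i + 1) := rfl

theorem prodL_honest1 (L : p.LIdx → R) {i : ℕ} (hi : i ≤ p.d) :
    prodL p (honest1 p L) i = subProd p L i := by
  refine chain_eq_prodsFrom p (M := 1) (fun k => ?_) hi
  rw [row_honest1, subProd_zero, Matrix.transpose_one]

theorem prodLL_honest1 (L : p.LIdx → R) (j : ℕ) (hj : j < p.d + 1) {i : ℕ} (hi : i ≤ p.d) :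
    prodLL p (honest1 p L) j hj i = (subProd p L j)ᵀ * subProd p L i := by
  rw [← prodsFrom_eq_mul, prodLL, prodL_honest1 p L (by omega)]
  exact chain_eq_prodsFrom p (fun k => row_honest1 p L j hj k) hi

theorem honest1_apply (L : p.LIdx → R) (x : p.Reply1Idx) :
    honest1 p L x = ((subProd p L x.1)ᵀ * subProd p L (x.2.1 + 1)) x.2.2.1 x.2.2.2 := by
  rw [← prodsFrom_eq_mul]; rfl

theorem repLeft_honest2 (L : p.LIdx → R) (Ae Be : Matrix (Fin (p.dim 0)) (Fin (p.dim 0)) R)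
    (i : Fin p.d) :
    repLeft p (honest2 p (message p L Ae Be)) i = prodsFrom p Ae L (i + 1) := rfl

theorem repRight_honest2 (L : p.LIdx → R) (Ae Be : Matrix (Fin (p.dim 0)) (Fin (p.dim 0)) R)
    {i : ℕ} (hi : i ≤ p.d) :
    repRight p Be (honest2 p (message p L Ae Be)) i = (subProd p L i)ᵀ * Be := by
  cases i with
  | zero => simp [repRight, subProd_zero]
  | succ i =>
    simp only [repRight, Nat.lt_of_succ_le hi, dif_pos]
    rfl

theorem repProd_honest2 (L : p.LIdx → R) (Ae Be : Matrix (Fin (p.dim 0)) (Fin (p.dim 0)) R) :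
    repProd p (honest2 p (message p L Ae Be)) = Ae * Be := rfl

theorem check1_honest1 (ρ : p.RandIdx → R) : Check1 p ρ (honest1 p (rL p ρ)) := by
  funext x
  refine congrFun (congrFun (checkLhs_eq_checkRhs p (fun i => ?_) (rX1 p ρ) x.2.1) _) _
  rw [row_honest1, prodL_honest1 p _ (Nat.lt_succ_iff.1 x.1.isLt)]

/-- The protocol is correct with any parameters. -/
theorem isCorrect : IsCorrect R p := by
  intro A B σ ρ
  refine ⟨check1_honest1 p ρ, ?_, ?_⟩
  · funext x
    exact congrFun (congrFun (checkLhs_eq_checkRhs p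
      (fun i => repLeft_honest2 p _ _ _ i) (rX2 p ρ) x.1) _) _
  · set L := rL p ρ with hL
    set r₁ := honest1 p L
    set Ae := encA p σ ρ r₁ A with hAe
    set Be := encB p σ ρ r₁ B with hBe
    set r₂ := honest2 p (message p L Ae Be)
    have hmA : maskA p σ ρ r₁ = rH p ρ * (subProd p L p.d)ᵀ +
        ∑ i : Fin p.d, rS p σ ρ i * (subProd p L i)ᵀ := by
      rw [maskA, prodL_honest1 p L le_rfl]
      exact congrArg _ (Finset.sum_congr rfl fun i _ => by rw [prodL_honest1 p L i.isLt.le])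
    have hmB : maskB p σ ρ r₁ = subProd p L p.d * rG p ρ +
        ∑ i : Fin p.d, subProd p L i * rT p σ ρ i := by
      rw [maskB, prodL_honest1 p L le_rfl]
      exact congrArg _ (Finset.sum_congr rfl fun i _ => by rw [prodL_honest1 p L i.isLt.le])
    have hAL : ∀ i, i ≤ p.d → prodAL p σ ρ r₁ A r₂ i = A * subProd p L i := by
      intro i hi
      rw [← prodsFrom_eq_mul]
      refine chain_eq_prodsFrom p (fun k => ?_) hi
      rw [repLeft_honest2, prodsFrom_eq_mul, prodsFrom_eq_mul, sub_eq_iff_eq_add, hAe, encA,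
        Matrix.add_mul, hmA, Matrix.add_mul, Matrix.sum_mul,
        prodLL_honest1 p L _ _ (Nat.succ_le_of_lt k.isLt), Matrix.mul_assoc]
      refine congrArg _ (congrArg _ (Finset.sum_congr rfl fun j _ => ?_))
      rw [prodLL_honest1 p L _ _ (Nat.succ_le_of_lt k.isLt), Matrix.mul_assoc]
    have h1 : prodAL p σ ρ r₁ A r₂ p.d * rG p ρ +
        ∑ i : Fin p.d, prodAL p σ ρ r₁ A r₂ i * rT p σ ρ i = A * maskB p σ ρ r₁ := by
      rw [hmB, Matrix.mul_add, Matrix.mul_sum, hAL _ le_rfl, Matrix.mul_assoc]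
      refine congrArg _ (Finset.sum_congr rfl fun i _ => ?_)
      rw [hAL _ i.isLt.le, Matrix.mul_assoc]
    have h2 : rH p ρ * repRight p Be r₂ p.d + ∑ i : Fin p.d, rS p σ ρ i * repRight p Be r₂ i =
        maskA p σ ρ r₁ * Be := by
      rw [hmA, Matrix.add_mul, Matrix.sum_mul, repRight_honest2 p L Ae Be le_rfl, Matrix.mul_assoc]
      refine congrArg _ (Finset.sum_congr rfl fun i _ => ?_)
      rw [repRight_honest2 p L Ae Be i.isLt.le, Matrix.mul_assoc]
    rw [output, h1, h2, repProd_honest2]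
    change (A + maskA p σ ρ r₁) * (B + maskB p σ ρ r₁) - A * maskB p σ ρ r₁ -
      maskA p σ ρ r₁ * (B + maskB p σ ρ r₁) = A * B
    noncomm_ring

end Algebra

/-! ### Detection of wrong products -/

section Detection

variable {R : Type u} [CommRing R] [Fintype R] [DecidableEq R] (p : Params)

/-- A nonzero row vector is orthogonal to `c` random columns with probability at most `2 ^ (-c)`:
adding one of two different multiples of a unit vector to each column gives `2 ^ c` disjoint
translates of the set of bad choices. -/
theorem unifAvg_dot_eq_zero_le {b c : ℕ} (D : Fin b → R) (hD : D ≠ 0) :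
    unifAvg (fun X : Fin b × Fin c → R => ind (∀ k, ∑ i, D i * X (i, k) = 0)) ≤
      (2 : ℝ) ^ (-(c : ℝ)) := by
  classical
  obtain ⟨i₀, hi₀⟩ := Function.ne_iff.1 hD
  have hi₀ : D i₀ ≠ 0 := hi₀
  let S : Finset (Fin b × Fin c → R) :=
    Finset.univ.filter fun X => ∀ k, ∑ i, D i * X (i, k) = 0
  let g : S × (Fin c → Bool) → (Fin b × Fin c → R) := fun y x =>
    y.1.1 x + if x.1 = i₀ then (if y.2 x.2 then 1 else 0) else 0
  have hg : Function.Injective g := by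
    have key : ∀ y k, ∑ i, D i * g y (i, k) = if y.2 k then D i₀ else 0 := by
      intro y k
      have := (Finset.mem_filter.1 y.1.2).2 k
      simp only [g, mul_add, Finset.sum_add_distrib, this, zero_add]
      rw [Finset.sum_eq_single i₀ (by intro i _ hi; simp [hi]) (by simp)]
      simp
    rintro y y' h
    have h2 : y.2 = y'.2 := by
      funext k
      have h3 := (key y k).symm.trans ((congrArg (fun f => ∑ i, D i * f (i, k)) h).trans (key y' k))
      rcases hb : y.2 k <;> rcases hb' : y'.2 k <;> simp_all
    refine Prod.ext (Subtype.ext (funext fun x => ?_)) h2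
    have := congrFun h x
    simpa only [g, h2, add_left_inj] using this
  have hcard := Fintype.card_le_of_injective g hg
  rw [Fintype.card_prod, Fintype.card_coe, Fintype.card_fun, Fintype.card_fun, Fintype.card_fin,
    Fintype.card_bool] at hcard
  have hR : (0 : ℝ) < (Fintype.card R : ℝ) ^ Fintype.card (Fin b × Fin c) := by
    have : 0 < Fintype.card R := Fintype.card_pos
    positivity
  have hS : ∑ X : Fin b × Fin c → R, ind (∀ k, ∑ i, D i * X (i, k) = 0) = S.card := by
    rw [Finset.natCast_card_filter]
    exact Finset.sum_congr rfl fun X _ => by unfold ind; congr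
  rw [unifAvg, hS, div_le_iff₀ hR, Real.rpow_neg (by norm_num), Real.rpow_natCast,
    ← div_eq_inv_mul, le_div_iff₀ (by positivity)]
  exact_mod_cast hcard

/-- A wrong sequence of products is accepted with probability at most `2 ^ (-checks)`. -/
theorem unifAvg_check_le {a : ℕ} (M : Matrix (Fin a) (Fin (p.dim 0)) R)
    (P : (i : Fin p.d) → Matrix (Fin a) (Fin (p.dim (i + 1))) R) (L : p.LIdx → R)
    (h : ¬ ∀ i : Fin p.d, P i = prodsFrom p M L (i + 1)) :
    unifAvg (fun X : p.XIdx → R => ind (∀ i, checkLhs p P X i = checkRhs p M P L X i)) ≤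
      (2 : ℝ) ^ (-(p.checks : ℝ)) := by
  rw [forall_eq_prodsFrom_iff] at h
  push Not at h
  obtain ⟨i, hi⟩ := h
  have hD : ∃ r, P i r - (chain p M P i * blkL p L i i.isLt) r ≠ 0 := by
    by_contra! hr
    exact hi (funext fun r => sub_eq_zero.1 (hr r))
  obtain ⟨r, hr⟩ := hD
  refine le_trans ?_ (unifAvg_dot_eq_zero_le (c := p.checks) _ hr)
  rw [unifAvg_eq, unifAvg_eq]
  let j : Fin (p.dim (i + 1)) × Fin p.checks → p.XIdx := fun x => ⟨i, x⟩
  have hj : Function.Injective j := fun x y hxy => by simpa [j] using hxy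
  refine le_trans (prodAvg_mono isDist_unifW fun X => ?_)
    (prodAvg_comp_injective (isDist_unifW (I := p.XIdx)) hj _).le
  refine ind_mono fun hX k => ?_
  have h2 := congrFun (congrFun (hX i) r) k
  rw [checkLhs, checkRhs, ← Matrix.mul_assoc, Matrix.mul_apply, Matrix.mul_apply] at h2
  simp only [Pi.sub_apply, sub_mul, Finset.sum_sub_distrib]
  exact sub_eq_zero.2 h2

theorem extend_apply_of_forall_ne {I J : Type*} {j : J → I} {l : J → R} {x : I → R} {i : I}
    (h : ∀ k, j k ≠ i) : Function.extend j l x i = x i :=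
  Function.extend_apply' _ _ _ fun ⟨k, hk⟩ => h k hk

/-- A wrong first reply passes the tests with probability at most `2 ^ (-checks)`. -/
theorem unifAvg_check1_le (s₁ : (p.LIdx → R) → (p.Reply1Idx → R)) :
    unifAvg (fun ρ : p.RandIdx → R =>
      ind (Check1 p ρ (s₁ (rL p ρ)) ∧ s₁ (rL p ρ) ≠ honest1 p (rL p ρ))) ≤
      (2 : ℝ) ^ (-(p.checks : ℝ)) := by
  let j : p.XIdx → p.RandIdx := fun x => .inr (.inr (.inr (.inr (.inr (.inl x)))))
  have hj : Function.Injective j := fun x y hxy => by simpa [j] using hxy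
  rw [unifAvg_eq, prodAvg_resample isDist_unifW hj]
  refine prodAvg_le isDist_unifW fun ρ => ?_
  have hL : ∀ X, rL p (Function.extend j X ρ) = rL p ρ := fun X => funext fun x =>
    extend_apply_of_forall_ne fun k => by simp [j]
  have hX : ∀ X, rX1 p (Function.extend j X ρ) = X := fun X => funext fun x =>
    hj.extend_apply X ρ x
  simp only [hL]
  generalize s₁ (rL p ρ) = r₁
  by_cases hr : r₁ = honest1 p (rL p ρ)
  · refine prodAvg_le isDist_unifW fun X => ?_
    rw [ind_of_false fun h => h.2 hr]
    positivity
  · have hrow : ∃ k : Fin (p.d + 1), ¬ ∀ i : Fin p.d,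
        row p r₁ k k.isLt i = prodsFrom p (prodL p r₁ k)ᵀ (rL p ρ) (i + 1) := by
      by_contra! hall
      have h0 : ∀ k : Fin (p.d + 1), prodL p r₁ k = subProd p (rL p ρ) k := by
        intro k
        refine chain_eq_prodsFrom p (M := 1) (fun i => ?_) (Nat.lt_succ_iff.1 k.isLt)
        have : row p r₁ 0 p.d.succ_pos i =
            prodsFrom p (1 : Matrix (Fin (p.dim 0)) (Fin (p.dim 0)) R)ᵀ (rL p ρ) (i + 1) :=
          hall ⟨0, p.d.succ_pos⟩ i
        rwa [Matrix.transpose_one] at this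
      refine hr (funext fun x => ?_)
      have := congrFun (congrFun (hall x.1 x.2.1) x.2.2.1) x.2.2.2
      rw [h0] at this
      exact this
    obtain ⟨k, hk⟩ := hrow
    refine le_trans ?_ (unifAvg_check_le p _ _ _ hk)
    rw [unifAvg_eq]
    refine prodAvg_mono isDist_unifW fun X => ind_mono fun hc i => ?_
    ext r c
    have := congrFun hc.1 ⟨k, i, (r, c)⟩
    rwa [check1Lhs, check1Rhs, hX, hL] at this

/-- The rates are probabilities. -/
def Params.RatesOk : Prop := ∀ i < p.d, 0 ≤ p.rate i ∧ p.rate i ≤ 1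

variable {p}

theorem Params.RatesOk.isDist (h : p.RatesOk) :
    IsDist (bitW (Sum.elim (fun x : p.SIdx => p.rate x.1) (fun x : p.TIdx => p.rate x.1))) := by
  refine isDist_bitW ?_ ?_ <;> rintro (x | x)
  · exact (h _ x.1.isLt).1
  · exact (h _ x.1.isLt).1
  · exact (h _ x.1.isLt).2
  · exact (h _ x.1.isLt).2

theorem clientAvg_eq (f : (p.MaskIdx → Bool) → (p.RandIdx → R) → ℝ) :
    clientAvg p f =
      prodAvg (bitW (Sum.elim (fun x : p.SIdx => p.rate x.1) (fun x : p.TIdx => p.rate x.1)))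
        fun σ => prodAvg (unifW R p.RandIdx) fun ρ => f σ ρ := by
  simp only [clientAvg, maskAvg_eq, unifAvg_eq]

theorem detectsDeviation (hp : p.RatesOk) {sec : ℝ} (hsec : sec + 1 ≤ p.checks) :
    DetectsDeviation R p sec := by
  intro A B s₁ s₂
  rw [clientAvg_eq]
  refine prodAvg_le hp.isDist fun σ => ?_
  have hpow : (2 : ℝ) ^ (-(p.checks : ℝ)) + (2 : ℝ) ^ (-(p.checks : ℝ)) ≤ (2 : ℝ) ^ (-sec) := by
    rw [← two_mul]
    nth_rewrite 1 [← Real.rpow_one 2]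
    rw [← Real.rpow_add (by norm_num)]
    exact Real.rpow_le_rpow_of_exponent_le (by norm_num) (by linarith)
  refine le_trans ?_ hpow
  -- a wrong first reply, or a correct first reply followed by a wrong second reply
  refine le_trans (prodAvg_mono (g := fun ρ =>
    ind (Check1 p ρ (s₁ (rL p ρ)) ∧ s₁ (rL p ρ) ≠ honest1 p (rL p ρ)) +
    ind (let Ae := encA p σ ρ (s₁ (rL p ρ)) A
      let m := message p (rL p ρ) Ae (encB p σ ρ (s₁ (rL p ρ)) B)
      Check2 p ρ Ae (s₂ m) ∧ repLeft p (s₂ m) ≠ repLeft p (honest2 p m)))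
    isDist_unifW fun ρ => ?_) ?_
  · by_cases h1 : s₁ (rL p ρ) = honest1 p (rL p ρ)
    · refine le_trans (ind_mono ?_) (le_add_of_nonneg_left (ind_nonneg _))
      rintro ⟨-, h2, h3⟩
      exact ⟨h2, fun h => h3 ⟨h1, h⟩⟩
    · exact le_trans (ind_mono fun h => ⟨h.1, h1⟩) (le_add_of_nonneg_right (ind_nonneg _))
  · rw [prodAvg_add]
    refine add_le_add ((unifAvg_eq _).symm.trans_le (unifAvg_check1_le p s₁)) ?_
    let j : p.XIdx → p.RandIdx := fun x => .inr (.inr (.inr (.inr (.inr (.inr x)))))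
    have hj : Function.Injective j := fun x y hxy => by simpa [j] using hxy
    rw [prodAvg_resample isDist_unifW hj]
    refine prodAvg_le isDist_unifW fun ρ => ?_
    have hne : ∀ X : p.XIdx → R, ∀ i, (∀ k, j k ≠ i) → Function.extend j X ρ i = ρ i :=
      fun X i h => extend_apply_of_forall_ne h
    have hL : ∀ X, rL p (Function.extend j X ρ) = rL p ρ := fun X => funext fun x =>
      hne X _ fun k => by simp [j]
    have hX : ∀ X, rX2 p (Function.extend j X ρ) = X := fun X => funext fun x =>
      hj.extend_apply X ρ x
    have hH : ∀ X, rH p (Function.extend j X ρ) = rH p ρ := fun X => by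
      ext r c; exact hne X _ fun k => by simp [j]
    have hG : ∀ X, rG p (Function.extend j X ρ) = rG p ρ := fun X => by
      ext r c; exact hne X _ fun k => by simp [j]
    have hS : ∀ X, rS p σ (Function.extend j X ρ) = rS p σ ρ := fun X => by
      funext i
      ext r c
      simp only [rS, blk, Matrix.of_apply, masked]
      rw [hne X _ fun k => by simp [j]]
    have hT : ∀ X, rT p σ (Function.extend j X ρ) = rT p σ ρ := fun X => by
      funext i
      ext r c
      simp only [rT, blk, Matrix.of_apply, masked]
      rw [hne X _ fun k => by simp [j]]
    have hA : ∀ X r₁, encA p σ (Function.extend j X ρ) r₁ A = encA p σ ρ r₁ A := fun X r₁ => by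
      simp only [encA, maskA, hH, hS]
    have hB : ∀ X r₁, encB p σ (Function.extend j X ρ) r₁ B = encB p σ ρ r₁ B := fun X r₁ => by
      simp only [encB, maskB, hG, hT]
    simp only [hL, hA, hB]
    generalize s₁ (rL p ρ) = r₁
    generalize hm : message p (rL p ρ) (encA p σ ρ r₁ A) (encB p σ ρ r₁ B) = m
    by_cases hr : repLeft p (s₂ m) = repLeft p (honest2 p m)
    · refine prodAvg_le isDist_unifW fun X => ?_
      rw [ind_of_false fun h => h.2 hr]
      positivity
    · have hr' : ¬ ∀ i : Fin p.d, repLeft p (s₂ m) i =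
          prodsFrom p (encA p σ ρ r₁ A) (rL p ρ) (i + 1) := by
        intro h
        refine hr (funext fun i => ?_)
        rw [h, ← hm, repLeft_honest2]
      refine le_trans ?_ (unifAvg_check_le p _ _ _ hr')
      rw [unifAvg_eq]
      refine prodAvg_mono isDist_unifW fun X => ind_mono fun hc i => ?_
      ext r c
      have := congrFun hc.1 ⟨i, (r, c)⟩
      rwa [check2Lhs, check2Rhs, hX, hL] at this

end Detection

/-! ### The computation of the client -/

section Client

variable {R : Type u} [CommRing R] {U : Type} {sem : U → R → R} {X : Type*} {V : Type}
  {e : X → V → R}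

/-- Only the nonzero entries of a sparse vector enter the cost of an inner product. -/
theorem CompOne.sparseDot {I : Type*} [Fintype I] (m : I → Bool) {f g : I → X → R}
    (hf : ∀ i, IsWire e (f i)) (hg : ∀ i, IsWire e (g i)) :
    CompOne sem e (fun x => ∑ i, (if m i = true then f i x else 0) * g i x)
      (2 * (∑ i, if m i = true then 1 else 0) + 1) := by
  have := CompOne.dot (sem := sem) (Finset.univ.filter fun i => m i = true)
    (fun i _ => hf i) (fun i _ => hg i)
  refine (this.congr fun x => ?_).mono ?_
  · funext
    beta_reduce
    rw [Finset.sum_filter]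
    exact Finset.sum_congr rfl fun i _ => by split <;> simp
  · rw [Finset.card_filter]

/-- Constant wires. -/
theorem Comp.zeroOne {O : Type} {F : X → O → R} {s : ℕ}
    (h : Comp sem (fun x => Sum.elim (e x) (fun b : Bool => cond b (1 : R) 0)) F s) :
    Comp sem e F (2 + s) := by
  refine Comp.bind ?_ h
  refine (Comp.pi (s := fun _ => 1) fun i => ?_).mono (by simp)
  exact CompOne.const _

variable (p : Params)

/-- The sum of all dimensions. -/
def Params.total : ℕ := ∑ i ∈ Finset.range (p.d + 1), p.dim i

/-- The number of nonzero entries that `σ` allows in row `a` of the left noise matrices. -/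
def rowWeight (σ : p.MaskIdx → Bool) (a : Fin (p.dim 0)) : ℕ :=
  ∑ i : Fin p.d, ∑ k, if σ (.inl ⟨i, (a, k)⟩) = true then 1 else 0

/-- The number of nonzero entries that `σ` allows in column `c` of the right noise matrices. -/
def colWeight (σ : p.MaskIdx → Bool) (c : Fin (p.dim 0)) : ℕ :=
  ∑ i : Fin p.d, ∑ k, if σ (.inr ⟨i, (k, c)⟩) = true then 1 else 0

/-- The number of nonzero noise entries that `σ` allows. -/
def weight (σ : p.MaskIdx → Bool) : ℕ := ∑ x, if σ x = true then 1 else 0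

theorem sum_rowWeight_add_sum_colWeight (σ : p.MaskIdx → Bool) :
    ∑ a, rowWeight p σ a + ∑ c, colWeight p σ c = weight p σ := by
  rw [weight, Fintype.sum_sum_type]
  congr 1
  · simp only [rowWeight, Fintype.sum_sigma, Fintype.sum_prod_type]
    exact Finset.sum_comm
  · simp only [colWeight, Fintype.sum_sigma, Fintype.sum_prod_type]
    rw [Finset.sum_comm]
    exact Finset.sum_congr rfl fun i _ => Finset.sum_comm

variable {p}

/-- `H N_d + ∑ S_{i+1} N_i`, which occurs in the computation of `A'` and of its products. -/
theorem CompOne.leftMask {σ : p.MaskIdx → Bool} {ρ : X → p.RandIdx → R}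
    (hρ : ∀ v, IsWire e fun x => ρ x v) {b : ℕ}
    {N : X → (i : ℕ) → Matrix (Fin (p.dim i)) (Fin b) R}
    (hN : ∀ i ≤ p.d, ∀ r c, IsWire e fun x => N x i r c) (a : Fin (p.dim 0)) (c : Fin b) :
    CompOne sem e
      (fun x => (rH p (ρ x) * N x p.d + ∑ i : Fin p.d, rS p σ (ρ x) i * N x i) a c)
      (2 * p.dim p.d + 2 * p.d + 3 + 2 * rowWeight p σ a) := by
  have h1 : CompOne sem e (fun x => ∑ k, rH p (ρ x) a k * N x p.d k c) (2 * p.dim p.d + 1) :=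
    (CompOne.dot Finset.univ (fun k _ => hρ _) (fun k _ => hN _ le_rfl _ _)).mono (by simp)
  have h2 := CompOne.sum (sem := sem) (e := e) (Finset.univ : Finset (Fin p.d))
    (f := fun i x => ∑ k, rS p σ (ρ x) i a k * N x i k c)
    fun i _ => CompOne.sparseDot (fun k => σ (.inl ⟨i, (a, k)⟩)) (fun k => hρ _)
      (fun k => hN i i.isLt.le k c)
  refine ((h1.add h2).congr fun x => ?_).mono ?_
  · funext
    simp only [Matrix.add_apply, Matrix.mul_apply, Matrix.sum_apply]
  · simp only [rowWeight, Finset.sum_add_distrib, Finset.sum_const, Finset.card_univ,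
      Fintype.card_fin, smul_eq_mul, mul_one, ← Finset.mul_sum]
    omega

/-- `N_d G + ∑ N_i T_{i+1}`, which occurs in the computation of `B'` and of its products. -/
theorem CompOne.rightMask {σ : p.MaskIdx → Bool} {ρ : X → p.RandIdx → R}
    (hρ : ∀ v, IsWire e fun x => ρ x v) {b : ℕ}
    {N : X → (i : ℕ) → Matrix (Fin b) (Fin (p.dim i)) R}
    (hN : ∀ i ≤ p.d, ∀ r c, IsWire e fun x => N x i r c) (a : Fin b) (c : Fin (p.dim 0)) :
    CompOne sem e
      (fun x => (N x p.d * rG p (ρ x) + ∑ i : Fin p.d, N x i * rT p σ (ρ x) i) a c)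
      (2 * p.dim p.d + 2 * p.d + 3 + 2 * colWeight p σ c) := by
  have h1 : CompOne sem e (fun x => ∑ k, N x p.d a k * rG p (ρ x) k c) (2 * p.dim p.d + 1) :=
    (CompOne.dot Finset.univ (fun k _ => hN _ le_rfl _ _) (fun k _ => hρ _)).mono (by simp)
  have h2 := CompOne.sum (sem := sem) (e := e) (Finset.univ : Finset (Fin p.d))
    (f := fun i x => ∑ k, rT p σ (ρ x) i k c * N x i a k)
    fun i _ => CompOne.sparseDot (fun k => σ (.inr ⟨i, (k, c)⟩)) (fun k => hρ _)
      (fun k => hN i i.isLt.le a k)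
  refine ((h1.add h2).congr fun x => ?_).mono ?_
  · funext
    simp only [Matrix.add_apply, Matrix.mul_apply, Matrix.sum_apply]
    exact congrArg _ (Finset.sum_congr rfl fun i _ => Finset.sum_congr rfl fun k _ =>
      mul_comm _ _)
  · simp only [colWeight, Finset.sum_add_distrib, Finset.sum_const, Finset.card_univ,
      Fintype.card_fin, smul_eq_mul, mul_one, ← Finset.mul_sum]
    omega

/-- The products `L_i X_i` used by the product checks. -/
def testProd (p : Params) (L : p.LIdx → R) (Y : p.XIdx → R) :
    (Σ i : Fin p.d, Fin (p.dim i) × Fin p.checks) → R :=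
  fun y => (blkL p L y.1 y.1.isLt * blk Y y.1) y.2.1 y.2.2

theorem Comp.testProd {L : X → p.LIdx → R} {Y : X → p.XIdx → R}
    (hL : ∀ v, IsWire e fun x => L x v) (hY : ∀ v, IsWire e fun x => Y x v) :
    Comp sem e (fun x => testProd p (L x) (Y x))
      (∑ i : Fin p.d, p.dim i * p.checks * (2 * p.dim (i + 1) + 1)) := by
  have := Comp.sigma (sem := sem) (e := e) fun i : Fin p.d =>
    Comp.matMul (M := fun x => blkL p (L x) i i.isLt) (N := fun x => blk (Y x) i)
      (fun r c => hL ⟨i, (r, c)⟩) (fun r c => hY ⟨i, (r, c)⟩)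
  simp only [Fintype.card_fin] at this
  exact this

theorem Comp.checkLhs {a : ℕ} {P : X → (i : Fin p.d) → Matrix (Fin a) (Fin (p.dim (i + 1))) R}
    {Y : X → p.XIdx → R} (hP : ∀ i r c, IsWire e fun x => P x i r c)
    (hY : ∀ v, IsWire e fun x => Y x v) :
    Comp sem e (fun x (y : Σ _ : Fin p.d, Fin a × Fin p.checks) =>
        checkLhs p (P x) (Y x) y.1 y.2.1 y.2.2)
      (∑ i : Fin p.d, a * p.checks * (2 * p.dim (i + 1) + 1)) := by
  have := Comp.sigma (sem := sem) (e := e) fun i : Fin p.d =>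
    Comp.matMul (M := fun x => P x i) (N := fun x => blk (Y x) i)
      (fun r c => hP i r c) (fun r c => hY ⟨i, (r, c)⟩)
  simp only [Fintype.card_fin] at this
  exact this

theorem Comp.checkRhs {a : ℕ} {M : X → Matrix (Fin a) (Fin (p.dim 0)) R}
    {P : X → (i : Fin p.d) → Matrix (Fin a) (Fin (p.dim (i + 1))) R}
    {L : X → p.LIdx → R} {Y : X → p.XIdx → R} (hM : ∀ r c, IsWire e fun x => M x r c)
    (hP : ∀ i r c, IsWire e fun x => P x i r c)
    (hLY : ∀ v, IsWire e fun x => Delegation.testProd p (L x) (Y x) v) :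
    Comp sem e (fun x (y : Σ _ : Fin p.d, Fin a × Fin p.checks) =>
        checkRhs p (M x) (P x) (L x) (Y x) y.1 y.2.1 y.2.2)
      (∑ i : Fin p.d, a * p.checks * (2 * p.dim i + 1)) := by
  have := Comp.sigma (sem := sem) (e := e) fun i : Fin p.d =>
    Comp.matMul (M := fun x => chain p (M x) (P x) i)
      (N := fun x => blkL p (L x) i i.isLt * blk (Y x) i)
      (fun r c => ?_) (fun r c => hLY ⟨i, (r, c)⟩)
  · simp only [Fintype.card_fin] at this
    exact this
  · obtain ⟨i, hi⟩ := i
    cases i with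
    | zero => exact hM r c
    | succ i =>
      refine (hP ⟨i, by omega⟩ r c).congr fun x => ?_
      exact congrFun (congrFun (chain_succ p (M x) (P x) ⟨i, by omega⟩) r) c

section Wires

variable {ρ : X → p.RandIdx → R} {r₁ : X → p.Reply1Idx → R}

theorem isWire_prodL (hr : ∀ v, IsWire e fun x => r₁ x v) (h0 : IsWire e fun _ => 0)
    (h1 : IsWire e fun _ => 1) {i : ℕ} (hi : i ≤ p.d) (r c) :
    IsWire e fun x => prodL p (r₁ x) i r c := by
  cases i with
  | zero =>
    have : ∀ x, prodL p (r₁ x) 0 r c = if r = c then 1 else 0 := fun x => Matrix.one_apply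
    split at this
    · exact h1.congr this
    · exact h0.congr this
  | succ i =>
    refine (hr ⟨⟨0, p.d.succ_pos⟩, ⟨i, hi⟩, (r, c)⟩).congr fun x => ?_
    exact congrFun (congrFun (chain_succ p 1 (row p (r₁ x) 0 p.d.succ_pos) ⟨i, hi⟩) r) c

theorem isWire_repRight {Be : X → Matrix (Fin (p.dim 0)) (Fin (p.dim 0)) R}
    {r₂ : X → p.Reply2Idx → R} (hB : ∀ r c, IsWire e fun x => Be x r c)
    (hr : ∀ v, IsWire e fun x => r₂ x v) {i : ℕ} (hi : i ≤ p.d) (r c) :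
    IsWire e fun x => repRight p (Be x) (r₂ x) i r c := by
  cases i with
  | zero => exact hB r c
  | succ i =>
    refine (hr (.inr (.inr ⟨⟨i, hi⟩, (r, c)⟩))).congr fun x => ?_
    simp only [repRight, Nat.lt_of_succ_le hi, dif_pos]
    rfl

end Wires

theorem sum_dim_le_total (p : Params) : ∑ i : Fin p.d, p.dim i ≤ p.total := by
  rw [Params.total, Finset.sum_range_succ, Fin.sum_univ_eq_sum_range]
  exact Nat.le_add_right _ _

theorem sum_dim_succ_le_total (p : Params) : ∑ i : Fin p.d, p.dim (i + 1) ≤ p.total := by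
  rw [Params.total, Finset.sum_range_succ', Fin.sum_univ_eq_sum_range fun i => p.dim (i + 1)]
  exact Nat.le_add_right _ _

theorem sum_fin_dim_eq_total (p : Params) : ∑ i : Fin (p.d + 1), p.dim i = p.total := by
  rw [Params.total, Fin.sum_univ_eq_sum_range]

theorem dim_zero_le_total (p : Params) : p.dim 0 ≤ p.total :=
  Finset.single_le_sum (f := p.dim) (fun _ _ => Nat.zero_le _) (Finset.mem_range.2 p.d.succ_pos)

theorem d_lt_total (hp : ∀ i ≤ p.d, 1 ≤ p.dim i) : p.d < p.total := by
  have := Finset.sum_le_sum (s := Finset.range (p.d + 1)) (f := fun _ => 1) (g := p.dim)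
    fun i hi => hp i (Nat.lt_succ_iff.1 (Finset.mem_range.1 hi))
  rw [Params.total]
  simpa [Nat.succ_le_iff] using this

theorem check_cost_le {a : ℕ} {f : ℕ → ℕ} (hf : ∀ i < p.d, 1 ≤ f i)
    (h : ∑ i : Fin p.d, f i ≤ p.total) :
    ∑ i : Fin p.d, a * p.checks * (2 * f i + 1) ≤ 3 * (a * p.checks * p.total) := by
  rw [← Finset.mul_sum]
  calc a * p.checks * ∑ i : Fin p.d, (2 * f i + 1)
      ≤ a * p.checks * ∑ i : Fin p.d, 3 * f i :=
        Nat.mul_le_mul_left _ (Finset.sum_le_sum fun i _ => by have := hf i i.isLt; omega)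
    _ ≤ a * p.checks * (3 * p.total) := by
        rw [← Finset.mul_sum]
        exact Nat.mul_le_mul_left _ (Nat.mul_le_mul_left _ h)
    _ = _ := by ring

theorem testProd_cost_le (hp : ∀ i ≤ p.d, 1 ≤ p.dim i) (hp' : ∀ i ≤ p.d, p.dim i ≤ p.dim 0) :
    ∑ i : Fin p.d, p.dim i * p.checks * (2 * p.dim (i + 1) + 1) ≤
      3 * (p.dim 0 * p.checks * p.total) := by
  refine le_trans (Finset.sum_le_sum fun i _ => ?_)
    (check_cost_le (a := p.dim 0) (f := fun i => p.dim (i + 1)) (fun i hi => hp _ hi)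
      (sum_dim_succ_le_total p))
  exact Nat.mul_le_mul_right _ (Nat.mul_le_mul_right _ (hp' i i.isLt.le))

variable (R) in
/-- The inputs of the second stage of the client. -/
abbrev Stage2 (p : Params) := Matrix (Fin (p.dim 0)) (Fin (p.dim 0)) R ×
  Matrix (Fin (p.dim 0)) (Fin (p.dim 0)) R × (p.RandIdx → R) × (p.Reply1Idx → R)

/-- The cost of the second stage, where the noise matrices have `w` nonzero entries. -/
theorem exists_stage2 (hp : ∀ i ≤ p.d, 1 ≤ p.dim i) (hp' : ∀ i ≤ p.d, p.dim i ≤ p.dim 0)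
    (σ : p.MaskIdx → Bool) :
    ∃ c : ArithCircuit R (p.NIdx ⊕ p.NIdx ⊕ p.RandIdx ⊕ p.Reply1Idx)
      (p.NIdx ⊕ p.NIdx ⊕ p.Chk1Idx ⊕ p.Chk1Idx), ComputesStage2 p σ c ∧
      c.size ≤ 2 + 9 * (p.total * p.checks * p.total) +
        2 * (p.total * p.total * (2 * p.dim p.d + 2 * p.d + 4)) + 2 * p.total * weight p σ := by
  let e : Stage2 R p → p.NIdx ⊕ p.NIdx ⊕ p.RandIdx ⊕ p.Reply1Idx → R := fun x =>
    Sum.elim (flat x.1) (Sum.elim (flat x.2.1) (Sum.elim x.2.2.1 x.2.2.2))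
  suffices H : Comp (fun f : Empty => f.elim) e (fun x =>
      Sum.elim (flat (encA p σ x.2.2.1 x.2.2.2 x.1)) (Sum.elim (flat (encB p σ x.2.2.1 x.2.2.2 x.2.1))
        (Sum.elim (check1Lhs p x.2.2.1 x.2.2.2) (check1Rhs p x.2.2.1 x.2.2.2))))
      (2 + 9 * (p.total * p.checks * p.total) +
        2 * (p.total * p.total * (2 * p.dim p.d + 2 * p.d + 4)) + 2 * p.total * weight p σ) by
    obtain ⟨c, hc, h⟩ := H
    exact ⟨c, fun A B ρ r₁ => h (A, B, ρ, r₁), hc⟩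
  let e₁ : Stage2 R p → (p.NIdx ⊕ p.NIdx ⊕ p.RandIdx ⊕ p.Reply1Idx) ⊕ Bool → R := fun x =>
    Sum.elim (e x) (fun b : Bool => cond b (1 : R) 0)
  let e₂ : Stage2 R p → ((p.NIdx ⊕ p.NIdx ⊕ p.RandIdx ⊕ p.Reply1Idx) ⊕ Bool) ⊕
      (Σ i : Fin p.d, Fin (p.dim i) × Fin p.checks) → R := fun x =>
    Sum.elim (e₁ x) (testProd p (rL p x.2.2.1) (rX1 p x.2.2.1))
  have hA : ∀ r c, IsWire e₂ fun x => x.1 r c := fun r c => ⟨.inl (.inl (.inl (r, c))), fun _ => rfl⟩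
  have hB : ∀ r c, IsWire e₂ fun x => x.2.1 r c := fun r c =>
    ⟨.inl (.inl (.inr (.inl (r, c)))), fun _ => rfl⟩
  have hρ₁ : ∀ v, IsWire e₁ fun x => x.2.2.1 v := fun v =>
    ⟨.inl (.inr (.inr (.inl v))), fun _ => rfl⟩
  have hρ : ∀ v, IsWire e₂ fun x => x.2.2.1 v := fun v => (hρ₁ v).inl _
  have hr : ∀ v, IsWire e₂ fun x => x.2.2.2 v := fun v =>
    ⟨.inl (.inl (.inr (.inr (.inr v)))), fun _ => rfl⟩
  have h0 : IsWire e₂ fun _ => 0 := ⟨.inl (.inr false), fun _ => rfl⟩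
  have h1 : IsWire e₂ fun _ => 1 := ⟨.inl (.inr true), fun _ => rfl⟩
  have hLX : ∀ v, IsWire e₂ fun x => testProd p (rL p x.2.2.1) (rX1 p x.2.2.1) v := fun v =>
    ⟨.inr v, fun _ => rfl⟩
  have cA : Comp (fun f : Empty => f.elim) e₂
      (fun x => flat (encA p σ x.2.2.1 x.2.2.2 x.1)) _ :=
    Comp.pi fun y => ((hA y.1 y.2).comp.add (CompOne.leftMask (σ := σ) (ρ := fun (x : Stage2 R p) => x.2.2.1) hρ
      (N := fun (x : Stage2 R p) i => (prodL p x.2.2.2 i)ᵀ)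
      (fun i hi r c => isWire_prodL hr h0 h1 hi c r) y.1 y.2))
  have cB : Comp (fun f : Empty => f.elim) e₂
      (fun x => flat (encB p σ x.2.2.1 x.2.2.2 x.2.1)) _ :=
    Comp.pi fun y => ((hB y.1 y.2).comp.add (CompOne.rightMask (σ := σ) (ρ := fun (x : Stage2 R p) => x.2.2.1) hρ
      (N := fun (x : Stage2 R p) i => prodL p x.2.2.2 i)
      (fun i hi r c => isWire_prodL hr h0 h1 hi r c) y.1 y.2))
  have cL : Comp (fun f : Empty => f.elim) e₂ (fun x => check1Lhs p x.2.2.1 x.2.2.2) _ :=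
    Comp.sigma fun j : Fin (p.d + 1) => Comp.checkLhs (P := fun (x : Stage2 R p) => row p x.2.2.2 j j.isLt)
      (Y := fun (x : Stage2 R p) => rX1 p x.2.2.1) (fun i r c => hr ⟨j, i, (r, c)⟩) (fun v => hρ _)
  have cR : Comp (fun f : Empty => f.elim) e₂ (fun x => check1Rhs p x.2.2.1 x.2.2.2) _ :=
    Comp.sigma fun j : Fin (p.d + 1) => Comp.checkRhs (M := fun (x : Stage2 R p) => (prodL p x.2.2.2 j)ᵀ)
      (P := fun (x : Stage2 R p) => row p x.2.2.2 j j.isLt) (L := fun (x : Stage2 R p) => rL p x.2.2.1)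
      (Y := fun (x : Stage2 R p) => rX1 p x.2.2.1)
      (fun r c => isWire_prodL hr h0 h1 (Nat.lt_succ_iff.1 j.isLt) c r)
      (fun i r c => hr ⟨j, i, (r, c)⟩) hLX
  have cX : Comp (fun f : Empty => f.elim) e₁
      (fun x => testProd p (rL p x.2.2.1) (rX1 p x.2.2.1)) _ :=
    Comp.testProd (L := fun (x : Stage2 R p) => rL p x.2.2.1) (Y := fun (x : Stage2 R p) => rX1 p x.2.2.1)
      (fun v => hρ₁ _) (fun v => hρ₁ _)
  refine (Comp.zeroOne (cX.bind (cA.pair (cB.pair (cL.pair cR))))).mono ?_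
  have b1 := testProd_cost_le hp hp'
  have b2 : ∑ j : Fin (p.d + 1), ∑ i : Fin p.d, p.dim j * p.checks * (2 * p.dim (i + 1) + 1) ≤
      3 * (p.total * p.checks * p.total) := by
    refine (Finset.sum_le_sum fun j _ => check_cost_le (f := fun i => p.dim (i + 1))
      (fun i hi => hp _ hi) (sum_dim_succ_le_total p)).trans_eq ?_
    rw [← Finset.mul_sum, ← Finset.sum_mul, ← Finset.sum_mul, sum_fin_dim_eq_total]
  have b3 : ∑ j : Fin (p.d + 1), ∑ i : Fin p.d, p.dim j * p.checks * (2 * p.dim i + 1) ≤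
      3 * (p.total * p.checks * p.total) := by
    refine (Finset.sum_le_sum fun j _ => check_cost_le (f := p.dim)
      (fun i hi => hp _ hi.le) (sum_dim_le_total p)).trans_eq ?_
    rw [← Finset.mul_sum, ← Finset.sum_mul, ← Finset.sum_mul, sum_fin_dim_eq_total]
  have hn := dim_zero_le_total p
  have b4 : p.dim 0 * p.checks * p.total ≤ p.total * p.checks * p.total := by gcongr
  have b5 : p.dim 0 * p.dim 0 ≤ p.total * p.total := by gcongr
  have b6 := Nat.mul_le_mul_right (2 * p.dim p.d + 2 * p.d + 4) b5
  have b7 := Nat.mul_le_mul_right (weight p σ) (Nat.mul_le_mul_left 2 hn)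
  have b8 := sum_rowWeight_add_sum_colWeight p σ
  simp only [Fintype.card_prod, Fintype.sum_prod_type, Finset.sum_add_distrib, Finset.sum_const, Finset.card_univ,
    Fintype.card_fin, smul_eq_mul, ← Finset.mul_sum] at b1 b2 b3 ⊢
  rw [← b8] at b7 ⊢
  linarith

variable (R) in
/-- The inputs of the last stage of the client. -/
abbrev Stage3 (p : Params) := Matrix (Fin (p.dim 0)) (Fin (p.dim 0)) R ×
  Matrix (Fin (p.dim 0)) (Fin (p.dim 0)) R × Matrix (Fin (p.dim 0)) (Fin (p.dim 0)) R ×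
  (p.RandIdx → R) × (p.Reply1Idx → R) × (p.Reply2Idx → R)

/-- The cost of the last stage, where the noise matrices have `w` nonzero entries. -/
theorem exists_stage3 (hp : ∀ i ≤ p.d, 1 ≤ p.dim i) (hp' : ∀ i ≤ p.d, p.dim i ≤ p.dim 0)
    (σ : p.MaskIdx → Bool) :
    ∃ c : ArithCircuit R (p.NIdx ⊕ p.NIdx ⊕ p.NIdx ⊕ p.RandIdx ⊕ p.Reply1Idx ⊕ p.Reply2Idx)
      (p.NIdx ⊕ p.Chk2Idx ⊕ p.Chk2Idx), ComputesStage3 p σ c ∧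
      c.size ≤ 2 + 9 * (p.total * p.checks * p.total) +
        p.total * p.total * (6 * p.dim p.d + 6 * p.d + 13) + 4 * p.total * weight p σ := by
  let e : Stage3 R p → p.NIdx ⊕ p.NIdx ⊕ p.NIdx ⊕ p.RandIdx ⊕ p.Reply1Idx ⊕ p.Reply2Idx → R :=
    fun x => Sum.elim (flat x.1) (Sum.elim (flat x.2.1) (Sum.elim (flat x.2.2.1)
      (Sum.elim x.2.2.2.1 (Sum.elim x.2.2.2.2.1 x.2.2.2.2.2))))
  suffices H : Comp (fun f : Empty => f.elim) e (fun x =>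
      Sum.elim (flat (output p σ x.2.2.2.1 x.2.2.2.2.1 x.1 x.2.2.1 x.2.2.2.2.2))
        (Sum.elim (check2Lhs p x.2.2.2.1 x.2.2.2.2.2)
          (check2Rhs p x.2.2.2.1 x.2.1 x.2.2.2.2.2)))
      (2 + 9 * (p.total * p.checks * p.total) +
        p.total * p.total * (6 * p.dim p.d + 6 * p.d + 13) + 4 * p.total * weight p σ) by
    obtain ⟨c, hc, h⟩ := H
    exact ⟨c, fun A Ae Be ρ r₁ r₂ => h (A, Ae, Be, ρ, r₁, r₂), hc⟩
  let e₁ : Stage3 R p →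
      (p.NIdx ⊕ p.NIdx ⊕ p.NIdx ⊕ p.RandIdx ⊕ p.Reply1Idx ⊕ p.Reply2Idx) ⊕ Bool → R := fun x =>
    Sum.elim (e x) (fun b : Bool => cond b (1 : R) 0)
  let e₂ : Stage3 R p →
      ((p.NIdx ⊕ p.NIdx ⊕ p.NIdx ⊕ p.RandIdx ⊕ p.Reply1Idx ⊕ p.Reply2Idx) ⊕ Bool) ⊕
      (Σ i : Fin p.d, Fin (p.dim i) × Fin p.checks) → R := fun x =>
    Sum.elim (e₁ x) (testProd p (rL p x.2.2.2.1) (rX2 p x.2.2.2.1))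
  -- the products `A L_1 ⋯ L_i`
  let AL : Stage3 R p → (Σ i : Fin p.d, Fin (p.dim 0) × Fin (p.dim (i + 1))) → R := fun x y =>
    prodAL p σ x.2.2.2.1 x.2.2.2.2.1 x.1 x.2.2.2.2.2 (y.1 + 1) y.2.1 y.2.2
  let e₃ := fun x : Stage3 R p => Sum.elim (e₂ x) (AL x)
  have hρ₁ : ∀ v, IsWire e₁ fun x => x.2.2.2.1 v := fun v =>
    ⟨.inl (.inr (.inr (.inr (.inl v)))), fun _ => rfl⟩
  have hA : ∀ r c, IsWire e₂ fun x => x.1 r c := fun r c => ⟨.inl (.inl (.inl (r, c))), fun _ => rfl⟩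
  have hAe : ∀ r c, IsWire e₂ fun x => x.2.1 r c := fun r c =>
    ⟨.inl (.inl (.inr (.inl (r, c)))), fun _ => rfl⟩
  have hBe : ∀ r c, IsWire e₂ fun x => x.2.2.1 r c := fun r c =>
    ⟨.inl (.inl (.inr (.inr (.inl (r, c))))), fun _ => rfl⟩
  have hρ : ∀ v, IsWire e₂ fun x => x.2.2.2.1 v := fun v => (hρ₁ v).inl _
  have hr₁ : ∀ v, IsWire e₂ fun x => x.2.2.2.2.1 v := fun v =>
    ⟨.inl (.inl (.inr (.inr (.inr (.inr (.inl v)))))), fun _ => rfl⟩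
  have hr₂ : ∀ v, IsWire e₂ fun x => x.2.2.2.2.2 v := fun v =>
    ⟨.inl (.inl (.inr (.inr (.inr (.inr (.inr v)))))), fun _ => rfl⟩
  have hLX : ∀ v, IsWire e₂ fun x => testProd p (rL p x.2.2.2.1) (rX2 p x.2.2.2.1) v := fun v =>
    ⟨.inr v, fun _ => rfl⟩
  have hAL : ∀ i ≤ p.d, ∀ r c, IsWire e₃ fun x =>
      prodAL p σ x.2.2.2.1 x.2.2.2.2.1 x.1 x.2.2.2.2.2 i r c := by
    intro i hi r c
    cases i with
    | zero => exact (hA r c).inl AL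
    | succ i => exact ⟨.inr ⟨⟨i, hi⟩, (r, c)⟩, fun _ => rfl⟩
  have cX : Comp (fun f : Empty => f.elim) e₁
      (fun x => testProd p (rL p x.2.2.2.1) (rX2 p x.2.2.2.1)) _ :=
    Comp.testProd (L := fun (x : Stage3 R p) => rL p x.2.2.2.1)
      (Y := fun (x : Stage3 R p) => rX2 p x.2.2.2.1)
      (fun v => hρ₁ _) (fun v => hρ₁ _)
  have cAL : Comp (fun f : Empty => f.elim) e₂ AL _ := Comp.sigma fun i : Fin p.d => Comp.pi
    (F := fun (x : Stage3 R p) (y : Fin (p.dim 0) × Fin (p.dim (i + 1))) =>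
      prodAL p σ x.2.2.2.1 x.2.2.2.2.1 x.1 x.2.2.2.2.2 (i + 1) y.1 y.2) fun y => by
    have hl : IsWire e₂ fun x => repLeft p x.2.2.2.2.2 i y.1 y.2 := hr₂ (.inl ⟨i, y⟩)
    have := hl.comp.sub (CompOne.leftMask (sem := fun f : Empty => f.elim) (σ := σ)
      (ρ := fun (x : Stage3 R p) => x.2.2.2.1) hρ
      (N := fun (x : Stage3 R p) j => if hj : j < p.d + 1 then
        prodLL p x.2.2.2.2.1 j hj (i + 1) else 0)
      (fun j hj r c => by
        simp only [Nat.lt_succ_iff.2 hj, dif_pos]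
        refine (hr₁ ⟨⟨j, Nat.lt_succ_iff.2 hj⟩, i, (r, c)⟩).congr fun x => ?_
        exact congrFun (congrFun (chain_succ p _ _ i) r) c) y.1 y.2)
    refine this.congr fun x => ?_
    funext
    have h1 : ∀ j : Fin p.d, (j : ℕ) < p.d + 1 := fun j => by omega
    simp only [h1, dif_pos, Nat.lt_succ_self]
    exact congrFun (congrFun (chain_succ p _ _ i) y.1) y.2
  have cO : Comp (fun f : Empty => f.elim) e₃
      (fun x => flat (output p σ x.2.2.2.1 x.2.2.2.2.1 x.1 x.2.2.1 x.2.2.2.2.2)) _ :=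
    Comp.pi fun y => by
    have hP : IsWire e₃ fun x => repProd p x.2.2.2.2.2 y.1 y.2 := (hr₂ (.inr (.inl y))).inl AL
    exact (hP.comp.sub (CompOne.rightMask (σ := σ)
      (ρ := fun (x : Stage3 R p) => x.2.2.2.1) (fun v => (hρ v).inl AL)
      (N := fun (x : Stage3 R p) i => prodAL p σ x.2.2.2.1 x.2.2.2.2.1 x.1 x.2.2.2.2.2 i)
      hAL y.1 y.2)).sub (CompOne.leftMask (σ := σ)
      (ρ := fun (x : Stage3 R p) => x.2.2.2.1) (fun v => (hρ v).inl AL)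
      (N := fun (x : Stage3 R p) i => repRight p x.2.2.1 x.2.2.2.2.2 i)
      (fun i hi r c => (isWire_repRight hBe hr₂ hi r c).inl AL) y.1 y.2)
  have cL : Comp (fun f : Empty => f.elim) e₃ (fun x => check2Lhs p x.2.2.2.1 x.2.2.2.2.2) _ :=
    Comp.checkLhs (P := fun (x : Stage3 R p) => repLeft p x.2.2.2.2.2)
      (Y := fun (x : Stage3 R p) => rX2 p x.2.2.2.1)
      (fun i r c => (hr₂ (.inl ⟨i, (r, c)⟩)).inl AL) (fun v => (hρ _).inl AL)
  have cR : Comp (fun f : Empty => f.elim) e₃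
      (fun x => check2Rhs p x.2.2.2.1 x.2.1 x.2.2.2.2.2) _ :=
    Comp.checkRhs (M := fun (x : Stage3 R p) => x.2.1)
      (P := fun (x : Stage3 R p) => repLeft p x.2.2.2.2.2)
      (L := fun (x : Stage3 R p) => rL p x.2.2.2.1) (Y := fun (x : Stage3 R p) => rX2 p x.2.2.2.1)
      (fun r c => (hAe r c).inl AL) (fun i r c => (hr₂ (.inl ⟨i, (r, c)⟩)).inl AL)
      (fun v => (hLX v).inl AL)
  refine (Comp.zeroOne (cX.bind (cAL.bind (cO.pair (cL.pair cR))))).mono ?_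
  have b1 := testProd_cost_le hp hp'
  have b2 := check_cost_le (a := p.dim 0) (f := fun i => p.dim (i + 1)) (fun i hi => hp _ hi)
    (sum_dim_succ_le_total p)
  have b3 := check_cost_le (a := p.dim 0) (f := p.dim) (fun i hi => hp _ hi.le)
    (sum_dim_le_total p)
  have hn := dim_zero_le_total p
  have b4 : p.dim 0 * p.checks * p.total ≤ p.total * p.checks * p.total := by gcongr
  have b5 : p.dim 0 * p.dim 0 ≤ p.total * p.total := by gcongr
  have b6 := Nat.mul_le_mul_right (4 * p.dim p.d + 4 * p.d + 8) b5
  have b7 := Nat.mul_le_mul_right (weight p σ) (Nat.mul_le_mul_left 2 hn)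
  have b8 := sum_rowWeight_add_sum_colWeight p σ
  have b9 := Nat.mul_le_mul (sum_dim_succ_le_total p)
    (show p.dim 0 * (2 * p.dim p.d + 2 * p.d + 4) + 2 * ∑ a, rowWeight p σ a ≤
      p.total * (2 * p.dim p.d + 2 * p.d + 4) + 2 * weight p σ by
        have := Nat.mul_le_mul_right (2 * p.dim p.d + 2 * p.d + 4) hn
        omega)
  have b10 : ∑ i : Fin p.d, ∑ y : Fin (p.dim 0) × Fin (p.dim (i + 1)),
      (0 + (2 * p.dim p.d + 2 * p.d + 3 + 2 * rowWeight p σ y.1) + 1) =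
      (∑ i : Fin p.d, p.dim (i + 1)) *
        (p.dim 0 * (2 * p.dim p.d + 2 * p.d + 4) + 2 * ∑ a, rowWeight p σ a) := by
    rw [Finset.sum_mul]
    refine Finset.sum_congr rfl fun i _ => ?_
    simp only [Fintype.card_prod, Fintype.sum_prod_type, Finset.sum_add_distrib, Finset.sum_const,
      Finset.card_univ, Fintype.card_fin, smul_eq_mul, ← Finset.mul_sum]
    ring
  have b11 : ∑ y : Fin (p.dim 0) × Fin (p.dim 0),
      (0 + (2 * p.dim p.d + 2 * p.d + 3 + 2 * colWeight p σ y.2) + 1 +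
        (2 * p.dim p.d + 2 * p.d + 3 + 2 * rowWeight p σ y.1) + 1) =
      p.dim 0 * p.dim 0 * (4 * p.dim p.d + 4 * p.d + 8) + 2 * p.dim 0 * weight p σ := by
    simp only [← b8, Fintype.card_prod, Fintype.sum_prod_type, Finset.sum_add_distrib,
      Finset.sum_const, Finset.card_univ, Fintype.card_fin, smul_eq_mul, ← Finset.mul_sum]
    ring
  rw [b10, b11]
  nlinarith

theorem maskAvg_weight (hp : p.RatesOk) :
    maskAvg (Sum.elim (fun x : p.SIdx => p.rate x.1) (fun x : p.TIdx => p.rate x.1))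
      (fun σ => (weight p σ : ℝ)) =
    ∑ i : Fin p.d, 2 * ((p.dim 0 : ℝ) * (p.dim i * p.rate i)) := by
  have h1 : ∀ y : p.MaskIdx, maskAvg (Sum.elim (fun x : p.SIdx => p.rate x.1)
      (fun x : p.TIdx => p.rate x.1)) (fun σ => if σ y = true then (1 : ℝ) else 0) =
      Sum.elim (fun x : p.SIdx => p.rate x.1) (fun x : p.TIdx => p.rate x.1) y := by
    intro y
    rw [maskAvg_eq]
    refine (prodAvg_comp_injective (J := Unit) (j := fun _ => y) hp.isDist
      (Function.injective_of_subsingleton _) (fun b => if b () = true then 1 else 0)).trans ?_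
    rw [prodAvg, ← (Equiv.funUnique Unit Bool).symm.sum_comp]
    simp [bitW]
  have h2 : maskAvg (Sum.elim (fun x : p.SIdx => p.rate x.1) (fun x : p.TIdx => p.rate x.1))
      (fun σ => (weight p σ : ℝ)) = ∑ y : p.MaskIdx,
      maskAvg (Sum.elim (fun x : p.SIdx => p.rate x.1) (fun x : p.TIdx => p.rate x.1))
        (fun σ => if σ y = true then (1 : ℝ) else 0) := by
    simp only [maskAvg]
    rw [Finset.sum_comm]
    refine Finset.sum_congr rfl fun σ _ => ?_
    rw [← Finset.mul_sum, weight]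
    push_cast
    rfl
  rw [h2]
  simp only [h1, Fintype.sum_sum_type, Sum.elim_inl, Sum.elim_inr, Fintype.sum_sigma,
    Finset.sum_const, Finset.card_univ, Fintype.card_prod, Fintype.card_fin, nsmul_eq_mul]
  rw [← Finset.sum_add_distrib]
  refine Finset.sum_congr rfl fun i _ => ?_
  push_cast
  ring

theorem card_randIdx_add_le (hp : ∀ i ≤ p.d, 1 ≤ p.dim i) (hp' : ∀ i ≤ p.d, p.dim i ≤ p.dim 0) :
    Fintype.card p.LIdx ≤ p.total * p.total ∧ Fintype.card p.SIdx ≤ p.total * p.total ∧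
    Fintype.card p.TIdx ≤ p.total * p.total ∧ Fintype.card p.Reply1Idx ≤ p.total * p.total ∧
    Fintype.card p.LeftIdx ≤ p.total * p.total ∧ Fintype.card p.RightIdx ≤ p.total * p.total ∧
    Fintype.card p.XIdx ≤ p.total * p.checks * p.total ∧
    Fintype.card p.Chk1Idx ≤ p.total * p.checks * p.total ∧
    Fintype.card p.Chk2Idx ≤ p.total * p.checks * p.total := by
  have h0 := dim_zero_le_total p
  have h1 := sum_dim_le_total p
  have h2 := sum_dim_succ_le_total p
  have h3 := sum_fin_dim_eq_total p
  have h4 := d_lt_total hp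
  have h5 : 1 ≤ p.total := by omega
  simp only [Fintype.card_sigma, Fintype.card_prod, Fintype.card_fin, ← Finset.mul_sum,
    ← Finset.sum_mul, Finset.sum_const, Finset.card_univ, smul_eq_mul, h3]
  have hs : ∑ i : Fin p.d, p.dim i * p.dim (i + 1) ≤ ∑ i : Fin p.d, p.dim 0 * p.dim (i + 1) :=
    Finset.sum_le_sum fun i _ => Nat.mul_le_mul_right _ (hp' i i.isLt.le)
  rw [← Finset.mul_sum] at hs
  refine ⟨hs.trans (Nat.mul_le_mul h0 h2), Nat.mul_le_mul h0 h1, Nat.mul_le_mul h1 h0,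
    Nat.mul_le_mul le_rfl h2, Nat.mul_le_mul h0 h2, Nat.mul_le_mul h2 h0, ?_, ?_, ?_⟩
  · calc _ ≤ p.total * p.checks * 1 := by rw [mul_one]; exact Nat.mul_le_mul_right _ h2
      _ ≤ _ := Nat.mul_le_mul_left _ h5
  · calc _ = p.d * (p.total * p.checks) := by
          rw [← h3]
          simp only [Finset.mul_sum, Finset.sum_mul]
          exact Finset.sum_congr rfl fun i _ => by ring
      _ ≤ p.total * (p.total * p.checks) := Nat.mul_le_mul_right _ h4.le
      _ = _ := by ring
  · calc _ ≤ p.total * (p.total * p.checks) := by gcongr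
      _ = _ := by ring

/-- The expected cost of the client. -/
theorem clientCostLE (R : Type u) [CommRing R] (hp : ∀ i ≤ p.d, 1 ≤ p.dim i)
    (hp' : ∀ i ≤ p.d, p.dim i ≤ p.dim 0) (hr : p.RatesOk) :
    ClientCostLE R p (40 * ((p.total : ℝ) ^ 2 * (p.dim p.d + p.d + p.checks + 1)) +
      12 * (p.total * ((p.dim 0 : ℝ) * ∑ i : Fin p.d, p.dim i * p.rate i))) := by
  choose c₂ h₂ s₂ using fun σ => exists_stage2 (R := R) hp hp' σ
  choose c₃ h₃ s₃ using fun σ => exists_stage3 (R := R) hp hp' σ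
  refine ⟨c₂, c₃, h₂, h₃, ?_⟩
  rw [maskAvg_eq]
  refine (prodAvg_mono (g := fun σ => 40 * ((p.total : ℝ) ^ 2 * (p.dim p.d + p.d + p.checks + 1)) +
    (6 * p.total) * (weight p σ : ℝ)) hr.isDist fun σ => ?_).trans_eq ?_
  · obtain ⟨k1, k2, k3, k4, k5, k6, k7, k8, k9⟩ := card_randIdx_add_le hp hp'
    have h0 := dim_zero_le_total p
    have hd : p.dim p.d ≤ p.total := (hp' _ le_rfl).trans h0
    have k10 : p.dim 0 * p.dim p.d ≤ p.total * p.total := Nat.mul_le_mul h0 hd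
    have k11 : p.dim p.d * p.dim 0 ≤ p.total * p.total := Nat.mul_le_mul hd h0
    have k12 : p.dim 0 * p.dim 0 ≤ p.total * p.total := Nat.mul_le_mul h0 h0
    have k13 : 1 ≤ p.total * p.total := Nat.mul_pos
      (by have := d_lt_total hp; omega) (by have := d_lt_total hp; omega)
    have := s₂ σ
    have := s₃ σ
    have key : Fintype.card p.RandIdx + Fintype.card p.MaskIdx + communication p +
        Fintype.card p.Chk1Idx + Fintype.card p.Chk2Idx + (c₂ σ).size + (c₃ σ).size ≤
        40 * (p.total ^ 2 * (p.dim p.d + p.d + p.checks + 1)) + 6 * p.total * weight p σ := by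
      simp only [communication, Fintype.card_sum] at *
      have e1 : Fintype.card p.NIdx = p.dim 0 * p.dim 0 := by simp
      have e2 : Fintype.card p.HIdx = p.dim 0 * p.dim p.d := by simp
      have e3 : Fintype.card p.GIdx = p.dim p.d * p.dim 0 := by simp
      rw [e1, e2, e3]
      have e4 : p.total * p.checks * p.total = p.total * p.total * p.checks := by ring
      rw [e4] at *
      nlinarith
    exact_mod_cast key
  · rw [prodAvg_add, prodAvg_const hr.isDist, prodAvg_const_mul, ← maskAvg_eq, maskAvg_weight hr,
      ← Finset.mul_sum, ← Finset.mul_sum]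
    ring

end Client

/-! ### The computation of the honest server -/

section Server

variable {R : Type u} [CommRing R] {X : Type*} {V : Type} {e : X → V → R}

/-- The optimal circuit for products of square matrices. -/
theorem Comp.squareMul {N : ℕ} {A B : X → Matrix (Fin N) (Fin N) R}
    (hA : ∀ i j, IsWire e fun x => A x i j) (hB : ∀ i j, IsWire e fun x => B x i j) :
    Comp (fun f : Empty => f.elim) e (fun x => flat (A x * B x)) (matMulCost R N) := by
  have hne : {s | ∃ c : ArithCircuit R ((Fin N × Fin N) ⊕ (Fin N × Fin N)) (Fin N × Fin N),
      (∀ A B : Matrix (Fin N) (Fin N) R, c.run (Sum.elim (flat A) (flat B)) = flat (A * B)) ∧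
      c.size = s}.Nonempty := by
    let e' : Matrix (Fin N) (Fin N) R × Matrix (Fin N) (Fin N) R →
        (Fin N × Fin N) ⊕ (Fin N × Fin N) → R := fun x => Sum.elim (flat x.1) (flat x.2)
    obtain ⟨c, -, hc⟩ := Comp.matMul (sem := fun f : Empty => f.elim) (e := e')
      (M := fun x => x.1) (N := fun x => x.2)
      (fun i j => ⟨.inl (i, j), fun _ => rfl⟩) (fun i j => ⟨.inr (i, j), fun _ => rfl⟩)
    exact ⟨c.size, c, fun A B => hc (A, B), rfl⟩
  obtain ⟨c, hc, hs⟩ := Nat.sInf_mem hne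
  have : Comp (fun f : Empty => f.elim)
      (fun x : Matrix (Fin N) (Fin N) R × Matrix (Fin N) (Fin N) R =>
        Sum.elim (flat x.1) (flat x.2)) (fun x => flat (x.1 * x.2)) (matMulCost R N) :=
    ⟨c, hs.le, fun x => hc x.1 x.2⟩
  refine (this.comap fun x : X => (A x, B x)).weaken ?_
  rintro (v | v)
  · exact hA v.1 v.2
  · exact hB v.1 v.2

variable (R) in
/-- The cost of multiplying an `a × b` by a `b × c` matrix, cut into blocks of size `c × c`. -/
def mulCost (a b c : ℕ) : ℕ :=
  1 + (a / c + 1) * (b / c + 1) * matMulCost R c + a * c * (b / c + 2)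

theorem sum_range_mul_eq {M : Type*} [AddCommMonoid M] (f : ℕ → M) (B c : ℕ) :
    ∑ t ∈ Finset.range (B * c), f t =
      ∑ j ∈ Finset.range B, ∑ k ∈ Finset.range c, f (j * c + k) := by
  induction B with
  | zero => simp
  | succ B ih => rw [Nat.succ_mul, Finset.sum_range_add, ih, Finset.sum_range_succ]

/-- The entry of a matrix at a position that may lie outside, where it is read as zero. -/
def padded {a b : ℕ} (A : Matrix (Fin a) (Fin b) R) (i j : ℕ) : R :=
  if h : i < a ∧ j < b then A ⟨i, h.1⟩ ⟨j, h.2⟩ else 0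

/-- The product of the blocks `(I, J)` of `A` and `(J, 0)` of `B`, where blocks have the size
`c × c` and are filled up with zeros. -/
def blockProd {a b c : ℕ} (A : Matrix (Fin a) (Fin b) R) (B : Matrix (Fin b) (Fin c) R)
    (I J : ℕ) : Matrix (Fin c) (Fin c) R :=
  (Matrix.of fun i k : Fin c => padded A (I * c + i) (J * c + k)) *
    (Matrix.of fun k j : Fin c => padded B (J * c + k) j)

/-- A rectangular product as a sum of products of square blocks. -/
theorem mul_apply_eq_sum_blocks {a b c : ℕ} (A : Matrix (Fin a) (Fin b) R)
    (B : Matrix (Fin b) (Fin c) R) (r : Fin a) (s : Fin c) :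
    (A * B) r s = ∑ J : Fin (b / c + 1),
      blockProd A B (r / c) J ⟨r % c, Nat.mod_lt _ s.pos⟩ s := by
  have hb : b ≤ (b / c + 1) * c := by
    have := Nat.div_add_mod b c
    have := Nat.mod_lt b s.pos
    rw [Nat.succ_mul, mul_comm]
    omega
  let f : ℕ → R := fun t => padded A r t * padded B t s
  have h1 : (A * B) r s = ∑ t ∈ Finset.range b, f t := by
    rw [Matrix.mul_apply, ← Fin.sum_univ_eq_sum_range]
    exact Finset.sum_congr rfl fun k _ => by simp [f, padded]
  have h2 : ∑ t ∈ Finset.range b, f t = ∑ t ∈ Finset.range ((b / c + 1) * c), f t := by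
    refine Finset.sum_subset (Finset.range_subset_range.2 hb) fun t _ ht => ?_
    have : ¬ t < b := by simpa using ht
    simp [f, padded, this]
  rw [h1, h2, sum_range_mul_eq, ← Fin.sum_univ_eq_sum_range
    (fun j => ∑ k ∈ Finset.range c, f (j * c + k))]
  refine Finset.sum_congr rfl fun J _ => ?_
  rw [blockProd, Matrix.mul_apply, ← Fin.sum_univ_eq_sum_range (fun k => f (J * c + k))]
  refine Finset.sum_congr rfl fun k _ => ?_
  have h3 : (r : ℕ) / c * c + r % c = r := by rw [mul_comm]; exact Nat.div_add_mod _ _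
  simp only [f, Matrix.of_apply, h3]

theorem isWire_padded {a b : ℕ} {A : X → Matrix (Fin a) (Fin b) R}
    (hA : ∀ i j, IsWire e fun x => A x i j) (h0 : IsWire e fun _ => 0) (i j : ℕ) :
    IsWire e fun x => padded (A x) i j := by
  by_cases h : i < a ∧ j < b
  · exact (hA ⟨i, h.1⟩ ⟨j, h.2⟩).congr fun x => by simp [padded, h]
  · exact h0.congr fun x => by simp [padded, h]

theorem Comp.blockMul {a b c : ℕ} {A : X → Matrix (Fin a) (Fin b) R}
    {B : X → Matrix (Fin b) (Fin c) R}
    (hA : ∀ i j, IsWire e fun x => A x i j) (hB : ∀ i j, IsWire e fun x => B x i j) :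
    Comp (fun f : Empty => f.elim) e (fun x => flat (A x * B x)) (mulCost R a b c) := by
  let e₁ : X → V ⊕ Unit → R := fun x => Sum.elim (e x) fun _ => 0
  have h0 : IsWire e₁ fun _ => 0 := ⟨.inr (), fun _ => rfl⟩
  let F : X → (Σ _ : Fin (a / c + 1) × Fin (b / c + 1), Fin c × Fin c) → R := fun x y =>
    flat (blockProd (A x) (B x) y.1.1 y.1.2) y.2
  have cF : Comp (fun f : Empty => f.elim) e₁ F
      (∑ _ : Fin (a / c + 1) × Fin (b / c + 1), matMulCost R c) :=
    Comp.sigma (F := fun (y : Fin (a / c + 1) × Fin (b / c + 1)) x =>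
      flat (blockProd (A x) (B x) y.1 y.2)) fun y => Comp.squareMul
      (A := fun x => Matrix.of fun i k : Fin c => padded (A x) (y.1 * c + i) (y.2 * c + k))
      (B := fun x => Matrix.of fun k j : Fin c => padded (B x) (y.2 * c + k) j)
      (fun i j => isWire_padded (fun i j => (hA i j).inl _) h0 _ _)
      (fun i j => isWire_padded (fun i j => (hB i j).inl _) h0 _ _)
  have cS : Comp (fun f : Empty => f.elim) (fun x => Sum.elim (e₁ x) (F x))
      (fun x => flat (A x * B x)) (∑ _ : Fin a × Fin c, (b / c + 2)) := Comp.pi fun y => by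
    have hr : (y.1 : ℕ) / c < a / c + 1 := Nat.lt_succ_of_le (Nat.div_le_div_right y.1.isLt.le)
    have h1 : ∀ J ∈ (Finset.univ : Finset (Fin (b / c + 1))),
        CompOne (fun f : Empty => f.elim) (fun x => Sum.elim (e₁ x) (F x))
          (fun x => blockProd (A x) (B x) (y.1 / c) J ⟨y.1 % c, Nat.mod_lt _ y.2.pos⟩ y.2) 0 :=
      fun J _ => IsWire.comp
        ⟨.inr ⟨(⟨(y.1 : ℕ) / c, hr⟩, J), (⟨y.1 % c, Nat.mod_lt _ y.2.pos⟩, y.2)⟩, fun _ => rfl⟩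
    refine ((CompOne.sum Finset.univ h1).congr fun x => ?_).mono ?_
    · funext
      exact mul_apply_eq_sum_blocks (A x) (B x) y.1 y.2
    · simp
  refine ((CompOne.const 0).bind (cF.bind cS)).mono ?_
  simp only [Finset.sum_const, Finset.card_univ, Fintype.card_prod, Fintype.card_fin, smul_eq_mul,
    mulCost]
  exact le_of_eq (by ring)

theorem mulCost_le {K ω : ℝ} (hK : MatMulBound R K ω) (hω : 2 ≤ ω) {a b c : ℕ} (hc : 1 ≤ c)
    (ha : c ≤ a) (hb : c ≤ b) {D : ℝ} (hD : (c : ℝ) ≤ D) :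
    (mulCost R a b c : ℝ) ≤ (4 * |K| + 4) * (a * b * D ^ (ω - 2)) := by
  have hc' : (1 : ℝ) ≤ c := by exact_mod_cast hc
  have hc0 : (0 : ℝ) < c := by linarith
  have ha' : (c : ℝ) ≤ a := by exact_mod_cast ha
  have hb' : (c : ℝ) ≤ b := by exact_mod_cast hb
  have h1 : ((a / c : ℕ) : ℝ) + 1 ≤ 2 * (a / c) := by
    have h2 : ((a / c : ℕ) : ℝ) ≤ a / c := Nat.cast_div_le
    have h3 : (1 : ℝ) ≤ a / c := (one_le_div hc0).2 ha'
    linarith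
  have hbc : (1 : ℝ) ≤ b / c := (one_le_div hc0).2 hb'
  have h2 : ((b / c : ℕ) : ℝ) ≤ b / c := Nat.cast_div_le
  have h3 : (matMulCost R c : ℝ) ≤ |K| * (c : ℝ) ^ ω :=
    (hK c hc).trans (by gcongr; exact le_abs_self K)
  have h4 : (c : ℝ) ^ ω = c ^ (ω - 2) * (c * c) := by
    rw [← sq, ← Real.rpow_natCast, ← Real.rpow_add hc0]
    norm_num
  have h5 : (c : ℝ) ^ (ω - 2) ≤ D ^ (ω - 2) := Real.rpow_le_rpow hc0.le hD (by linarith)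
  have h6 : (1 : ℝ) ≤ D ^ (ω - 2) := Real.one_le_rpow (hc'.trans hD) (by linarith)
  have h7 : (((a / c : ℕ) : ℝ) + 1) * (((b / c : ℕ) : ℝ) + 1) * matMulCost R c ≤
      4 * |K| * (a * b * D ^ (ω - 2)) := by
    calc _ ≤ (2 * ((a : ℝ) / c)) * (2 * (b / c)) * (|K| * (D ^ (ω - 2) * (c * c))) := by
          gcongr
          · linarith
          · exact h3.trans (by rw [h4]; gcongr)
      _ = _ := by field_simp; ring
  have h8 : (a : ℝ) * c * (((b / c : ℕ) : ℝ) + 2) ≤ 3 * (a * b) := by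
    calc _ ≤ (a : ℝ) * c * (3 * (b / c)) := by gcongr; linarith
      _ = _ := by field_simp
  have h9 : (1 : ℝ) ≤ a * b := by nlinarith
  have h10 : (a : ℝ) * b ≤ a * b * D ^ (ω - 2) := le_mul_of_one_le_right (by linarith) h6
  simp only [mulCost]
  push_cast
  linarith

variable {p : Params}

/-- The products `Q_i = Q_0 L_1 ⋯ L_i`, computed one after the other from `Q_k` on. -/
theorem Comp.products {a : ℕ} {L : X → p.LIdx → R} (hL : ∀ v, IsWire e fun x => L x v)
    {Q : X → (i : ℕ) → Matrix (Fin a) (Fin (p.dim i)) R}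
    (hQ : ∀ x, ∀ (i : ℕ) (h : i < p.d), Q x (i + 1) = Q x i * blkL p (L x) i h) {k : ℕ}
    (hk : ∀ i ≤ k, ∀ r c, IsWire e fun x => Q x i r c) {m : ℕ} (hkm : k ≤ m) (hm : m ≤ p.d) :
    Comp (fun f : Empty => f.elim) e
      (fun x (y : Σ i : Fin m, Fin a × Fin (p.dim (i + 1))) => Q x (y.1 + 1) y.2.1 y.2.2)
      (∑ i ∈ Finset.Ico k m, mulCost R a (p.dim i) (p.dim (i + 1))) := by
  induction m, hkm using Nat.le_induction with
  | base => simpa using Comp.of_wires fun y => hk _ y.1.isLt _ _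
  | succ m hkm ih =>
    rw [Finset.sum_Ico_succ_top hkm]
    let F : X → (Σ i : Fin m, Fin a × Fin (p.dim (i + 1))) → R := fun x y =>
      Q x (y.1 + 1) y.2.1 y.2.2
    have hQm : ∀ r c, IsWire (fun x => Sum.elim (e x) (F x)) fun x => Q x m r c := by
      intro r c
      rcases hkm.eq_or_lt with rfl | hlt
      · exact (hk _ le_rfl r c).inl F
      · obtain ⟨m, rfl⟩ : ∃ m', m = m' + 1 := ⟨m - 1, by omega⟩
        exact ⟨.inr ⟨⟨m, by omega⟩, (r, c)⟩, fun _ => rfl⟩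
    have h2 := Comp.blockMul (A := fun x => Q x m) (B := fun x => blkL p (L x) m hm) hQm
      (fun i j => (hL ⟨⟨m, hm⟩, (i, j)⟩).inl F)
    refine ((ih (by omega)).bind (h2.bind (s' := 0) (Comp.of_wires ?_))).mono (by omega)
    rintro ⟨⟨i, hi⟩, r, c⟩
    rcases Nat.lt_succ_iff_lt_or_eq.1 hi with h | rfl
    · exact ((IsWire.self (e := F) ⟨⟨i, h⟩, (r, c)⟩).inr e).inl _
    · refine ⟨.inr (r, c), fun x => ?_⟩
      exact congrFun (congrFun (hQ x i hm) r) c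

/-- The products `P_jᵀ P_i`. Those with `i ≥ j` are computed from left to right, and the others
are transposes of earlier ones. -/
theorem Comp.honest1 {L : X → p.LIdx → R} (hL : ∀ v, IsWire e fun x => L x v) :
    Comp (fun f : Empty => f.elim) e (fun x => honest1 p (L x))
      (2 + ∑ j ∈ Finset.range (p.d + 1), ∑ i ∈ Finset.Ico (j - 1) p.d,
        mulCost R (p.dim j) (p.dim i) (p.dim (i + 1))) := by
  refine Comp.zeroOne ?_
  let e₁ : X → V ⊕ Bool → R := fun x => Sum.elim (e x) fun b : Bool => cond b (1 : R) 0
  let G : (m : ℕ) → X → (Σ j : Fin m, Σ i : Fin p.d, Fin (p.dim j) × Fin (p.dim (i + 1))) → R :=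
    fun m x y => ((subProd p (L x) y.1)ᵀ * subProd p (L x) (y.2.1 + 1)) y.2.2.1 y.2.2.2
  suffices H : ∀ m ≤ p.d + 1, Comp (fun f : Empty => f.elim) e₁ (G m)
      (∑ j ∈ Finset.range m, ∑ i ∈ Finset.Ico (j - 1) p.d,
        mulCost R (p.dim j) (p.dim i) (p.dim (i + 1))) from
    (H _ le_rfl).congr fun x => funext fun y => honest1_apply p (L x) y
  intro m hm
  induction m with
  | zero => exact Comp.of_wires fun y => y.1.elim0
  | succ m ih =>
    rw [Finset.sum_range_succ]
    let Q : X → (i : ℕ) → Matrix (Fin (p.dim m)) (Fin (p.dim i)) R := fun x i =>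
      (subProd p (L x) m)ᵀ * subProd p (L x) i
    have hrow : Comp (fun f : Empty => f.elim) (fun x => Sum.elim (e₁ x) (G m x))
        (fun x (y : Σ i : Fin p.d, Fin (p.dim m) × Fin (p.dim (i + 1))) =>
          Q x (y.1 + 1) y.2.1 y.2.2)
        (∑ i ∈ Finset.Ico (m - 1) p.d, mulCost R (p.dim m) (p.dim i) (p.dim (i + 1))) := by
      refine Comp.products (L := L) (Q := Q) (k := m - 1)
        (fun v => ((hL v).inl _).inl (G m)) (fun x i h => ?_) (fun i hi r c => ?_) (by omega) le_rfl
      · simp only [Q]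
        rw [subProd_succ p (L x) h, Matrix.mul_assoc]
      · rcases m with _ | m
        · obtain rfl : i = 0 := by omega
          have : ∀ x, Q x 0 r c = if r = c then 1 else 0 := fun x => by
            simp only [Q, subProd_zero, Matrix.transpose_one, Matrix.one_mul]
            exact Matrix.one_apply
          split at this
          · exact ⟨.inl (.inr true), this⟩
          · exact ⟨.inl (.inr false), this⟩
        · refine ⟨.inr ⟨⟨i, by omega⟩, ⟨m, by omega⟩, (c, r)⟩, fun x => ?_⟩
          change ((subProd p (L x) (m + 1))ᵀ * subProd p (L x) i) r c =
            ((subProd p (L x) i)ᵀ * subProd p (L x) (m + 1)) c r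
          rw [← Matrix.transpose_apply (_ * _) r c, Matrix.transpose_mul, Matrix.transpose_transpose]
    refine ((ih (by omega)).bind (hrow.bind (s' := 0) (Comp.of_wires ?_))).mono (by omega)
    rintro ⟨⟨j, hj⟩, i, y⟩
    rcases Nat.lt_succ_iff_lt_or_eq.1 hj with h | rfl
    · exact ((IsWire.self (e := G m) ⟨⟨j, h⟩, i, y⟩).inr e₁).inl _
    · exact ⟨.inr ⟨i, y⟩, fun x => rfl⟩

theorem Comp.honest2 :
    Comp (fun f : Empty => f.elim) (fun m : p.MsgIdx → R => m) (fun m => honest2 p m)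
      (matMulCost R (p.dim 0) +
        2 * ∑ i ∈ Finset.range p.d, mulCost R (p.dim 0) (p.dim i) (p.dim (i + 1))) := by
  let L : (p.MsgIdx → R) → p.LIdx → R := fun m x => m (.inl x)
  let Ae : (p.MsgIdx → R) → Matrix (Fin (p.dim 0)) (Fin (p.dim 0)) R := fun m =>
    unflat fun x => m (.inr (.inl x))
  let Be : (p.MsgIdx → R) → Matrix (Fin (p.dim 0)) (Fin (p.dim 0)) R := fun m =>
    unflat fun x => m (.inr (.inr x))
  have hL : ∀ v, IsWire (fun m : p.MsgIdx → R => m) fun m => L m v := fun v =>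
    ⟨.inl v, fun _ => rfl⟩
  have hA : ∀ r c, IsWire (fun m : p.MsgIdx → R => m) fun m => Ae m r c := fun r c =>
    ⟨.inr (.inl (r, c)), fun _ => rfl⟩
  have hB : ∀ r c, IsWire (fun m : p.MsgIdx → R => m) fun m => Be m r c := fun r c =>
    ⟨.inr (.inr (r, c)), fun _ => rfl⟩
  have c1 := Comp.products (L := L) hL (Q := fun m i => prodsFrom p (Ae m) (L m) i)
    (fun m i h => prodsFrom_succ p _ _ h) (k := 0)
    (fun i hi r c => by obtain rfl : i = 0 := by omega
                        exact hA r c) (Nat.zero_le p.d) le_rfl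
  have c2 := Comp.squareMul (A := Ae) (B := Be) hA hB
  have c3 := Comp.products (L := L) hL (Q := fun m i => prodsFrom p (Be m)ᵀ (L m) i)
    (fun m i h => prodsFrom_succ p _ _ h) (k := 0)
    (fun i hi r c => by obtain rfl : i = 0 := by omega
                        exact hB c r) (Nat.zero_le p.d) le_rfl
  have c4 := c3.select fun y : p.RightIdx => ⟨y.1, (y.2.2, y.2.1)⟩
  refine ((c1.pair (c2.pair c4)).congr fun m => ?_).mono ?_
  · have h3 : ∀ (i : ℕ), (subProd p (L m) i)ᵀ * Be m = (prodsFrom p (Be m)ᵀ (L m) i)ᵀ := fun i => by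
      rw [prodsFrom_eq_mul, Matrix.transpose_mul, Matrix.transpose_transpose]
    funext y
    rcases y with y | y | y
    · rfl
    · rfl
    · exact congrFun (congrFun (h3 (y.1 + 1)) y.2.1) y.2.2
  · rw [Nat.Ico_zero_eq_range]
    omega

/-- The cost of the first reply in terms of the matrix multiplication exponent. -/
theorem honest1_cost_le {K ω : ℝ} (hK : MatMulBound R K ω) (hω : 2 ≤ ω)
    (hp : ∀ i ≤ p.d, 1 ≤ p.dim i) (hanti : ∀ i < p.d, p.dim (i + 1) ≤ p.dim i) {D : ℝ}
    (hD : ∀ i < p.d, (p.dim (i + 1) : ℝ) ≤ D) (hD1 : 1 ≤ D) :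
    ((2 + ∑ j ∈ Finset.range (p.d + 1), ∑ i ∈ Finset.Ico (j - 1) p.d,
        mulCost R (p.dim j) (p.dim i) (p.dim (i + 1)) : ℕ) : ℝ) ≤
      (4 * |K| + 6) * ((p.total : ℝ) ^ 2 * D ^ (ω - 2)) := by
  have hle : ∀ i j, i ≤ j → j ≤ p.d → p.dim j ≤ p.dim i := by
    intro i j hij hj
    induction j, hij using Nat.le_induction with
    | base => exact le_rfl
    | succ j hij ih => exact (hanti j hj).trans (ih (by omega))
  have hDp : (1 : ℝ) ≤ D ^ (ω - 2) := Real.one_le_rpow hD1 (by linarith)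
  have ht : (1 : ℝ) ≤ (p.total : ℝ) ^ 2 := by
    have := d_lt_total hp
    have h1 : (1 : ℝ) ≤ p.total := by exact_mod_cast (by omega : 1 ≤ p.total)
    nlinarith
  have h1 : ∀ j ∈ Finset.range (p.d + 1), ∑ i ∈ Finset.Ico (j - 1) p.d,
      (mulCost R (p.dim j) (p.dim i) (p.dim (i + 1)) : ℝ) ≤
      (4 * |K| + 4) * (p.dim j * p.total * D ^ (ω - 2)) := by
    intro j hj
    have hj := Finset.mem_range.1 hj
    calc _ ≤ ∑ i ∈ Finset.Ico (j - 1) p.d, (4 * |K| + 4) * (p.dim j * p.dim i * D ^ (ω - 2)) := by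
          refine Finset.sum_le_sum fun i hi => ?_
          obtain ⟨h1, h2⟩ := Finset.mem_Ico.1 hi
          exact mulCost_le hK hω (hp _ (by omega)) (hle _ _ (by omega) (by omega)) (hanti i h2)
            (hD i h2)
      _ = (4 * |K| + 4) * (p.dim j * (∑ i ∈ Finset.Ico (j - 1) p.d, (p.dim i : ℝ)) *
            D ^ (ω - 2)) := by
          rw [Finset.mul_sum, Finset.sum_mul, Finset.mul_sum]
      _ ≤ _ := by
          have : ∑ i ∈ Finset.Ico (j - 1) p.d, (p.dim i : ℝ) ≤ p.total := by
            rw [Params.total]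
            push_cast
            refine Finset.sum_le_sum_of_subset_of_nonneg (fun i hi => ?_) fun _ _ _ => by positivity
            have := Finset.mem_Ico.1 hi
            exact Finset.mem_range.2 (by omega)
          gcongr
  have h2 := Finset.sum_le_sum h1
  rw [← Finset.mul_sum, ← Finset.sum_mul, ← Finset.sum_mul] at h2
  have h3 : ∑ j ∈ Finset.range (p.d + 1), (p.dim j : ℝ) = p.total := by
    rw [Params.total]; push_cast; rfl
  rw [h3] at h2
  push_cast
  nlinarith

theorem serverCostLE {K ω : ℝ} (hK : MatMulBound R K ω) (hω : 2 ≤ ω)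
    (hp : ∀ i ≤ p.d, 1 ≤ p.dim i) (hanti : ∀ i < p.d, p.dim (i + 1) ≤ p.dim i) {D : ℝ}
    (hD : ∀ i < p.d, (p.dim (i + 1) : ℝ) ≤ D) (hD1 : 1 ≤ D) :
    ServerCostLE R p (matMulCost R (p.dim 0) +
      (12 * |K| + 21) * ((p.total : ℝ) ^ 2 * D ^ (ω - 2))) := by
  have hle : ∀ i ≤ p.d, p.dim i ≤ p.dim 0 := by
    intro i hi
    induction i with
    | zero => exact le_rfl
    | succ i ih => exact (hanti i hi).trans (ih (by omega))
  obtain ⟨c₁, s₁, h₁⟩ := Comp.honest1 (X := p.LIdx → R) (p := p) (e := fun L => L) (L := fun L => L)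
    fun v => IsWire.self v
  obtain ⟨c₂, s₂, h₂⟩ := Comp.honest2 (R := R) (p := p)
  refine ⟨c₁, c₂, h₁, h₂, ?_⟩
  have k0 : (c₁.size : ℝ) ≤ _ :=
    (Nat.cast_le.2 s₁).trans (honest1_cost_le hK hω hp hanti hD hD1)
  have k1 : (c₂.size : ℝ) ≤ matMulCost R (p.dim 0) +
      2 * ∑ i ∈ Finset.range p.d, (mulCost R (p.dim 0) (p.dim i) (p.dim (i + 1)) : ℝ) := by
    exact_mod_cast s₂
  have h0 := dim_zero_le_total p
  have hDp : (1 : ℝ) ≤ D ^ (ω - 2) := Real.one_le_rpow hD1 (by linarith)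
  have k2 : ∑ i ∈ Finset.range p.d, (mulCost R (p.dim 0) (p.dim i) (p.dim (i + 1)) : ℝ) ≤
      (4 * |K| + 4) * ((p.total : ℝ) ^ 2 * D ^ (ω - 2)) := by
    calc _ ≤ ∑ i ∈ Finset.range p.d, (4 * |K| + 4) * (p.dim 0 * p.dim i * D ^ (ω - 2)) := by
          refine Finset.sum_le_sum fun i hi => ?_
          have hi := Finset.mem_range.1 hi
          exact mulCost_le hK hω (hp _ hi) (hle _ hi) (hanti i hi) (hD i hi)
      _ = (4 * |K| + 4) * (p.dim 0 * (∑ i ∈ Finset.range p.d, (p.dim i : ℝ)) * D ^ (ω - 2)) := by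
          rw [Finset.mul_sum, Finset.sum_mul, Finset.mul_sum]
      _ ≤ _ := by
          have h1 : ∑ i ∈ Finset.range p.d, (p.dim i : ℝ) ≤ p.total := by
            have := sum_dim_le_total p
            rw [Fin.sum_univ_eq_sum_range] at this
            exact_mod_cast this
          have h2 : (p.dim 0 : ℝ) ≤ p.total := by exact_mod_cast h0
          rw [sq]
          gcongr
  obtain ⟨a1, -, -, a2, a3, a4, -⟩ := card_randIdx_add_le hp hle
  have k3 : (communication p : ℝ) ≤ 7 * ((p.total : ℝ) ^ 2 * D ^ (ω - 2)) := by
    have a5 : p.dim 0 * p.dim 0 ≤ p.total * p.total := Nat.mul_le_mul h0 h0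
    have : communication p ≤ 7 * p.total ^ 2 := by
      simp only [communication, Fintype.card_sum]
      have e1 : Fintype.card p.NIdx = p.dim 0 * p.dim 0 := by simp
      rw [e1, sq]
      omega
    have h2 : (communication p : ℝ) ≤ 7 * (p.total : ℝ) ^ 2 := by exact_mod_cast this
    nlinarith [sq_nonneg (p.total : ℝ)]
  push_cast
  linarith

end Server

/-! ### A generic attack on learning parity with noise -/

section Elimination

variable {R : Type u} [CommRing R]

/-- The element `a` generates a minimal ideal. -/
def IsMinimalGen (a : R) : Prop := a ≠ 0 ∧ ∀ x, a * x = 0 ∨ ∃ y, a * x * y = a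

theorem exists_isMinimalGen [Finite R] [Nontrivial R] : ∃ a : R, IsMinimalGen a := by
  obtain ⟨I, hI, -⟩ := (IsAtomic.eq_bot_or_exists_atom_le (⊤ : Ideal R)).resolve_left top_ne_bot
  obtain ⟨a, haI, ha⟩ := Submodule.exists_mem_ne_zero_of_ne_bot hI.1
  refine ⟨a, ha, fun x => or_iff_not_imp_left.2 fun hx => ?_⟩
  have h1 : Ideal.span {a * x} = I := by
    refine (hI.le_iff.1 ((Ideal.span_singleton_le_iff_mem _).2 (I.mul_mem_right x haI))).resolve_left
      fun h => hx (Ideal.span_singleton_eq_bot.1 h)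
  rw [← h1, Ideal.mem_span_singleton] at haI
  obtain ⟨y, hy⟩ := haI
  exact ⟨y, hy.symm⟩

/-- Each vector of the family has a coordinate of its own, where all the others vanish. This keeps
the vectors independent during the elimination. -/
def HasOwnCoordinates (a : R) {r m : ℕ} (K : Fin r → Fin m → R) : Prop :=
  ∃ q : Fin r → Fin m, (∀ i, a * K i (q i) ≠ 0) ∧ ∀ i i', i' ≠ i → K i' (q i) = 0

open Classical in
/-- Whether the products with `v` of the vectors before the `i`-th one are killed by `a`. -/
def noPivot (a : R) {r m : ℕ} (K : Fin r → Fin m → R) (v : Fin m → R) (i : ℕ) : R :=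
  if ∀ j : Fin r, (j : ℕ) < i → a * (K j ⬝ᵥ v) = 0 then 1 else 0

/-- The first vector whose product with `v` is not killed by `a`. -/
def pivot (a : R) {r m : ℕ} (K : Fin r → Fin m → R) (v : Fin m → R) : Fin m → R :=
  fun k => ∑ i : Fin r, (noPivot a K v i - noPivot a K v (i + 1)) * K i k

/-- One step of division-free elimination: the vectors are modified so that their products with
`v` are killed by `a`, where one vector is used up. -/
def elimStep (a : R) {r m : ℕ} (K : Fin (r + 1) → Fin m → R) (v : Fin m → R) :
    Fin r → Fin m → R :=
  fun i k => noPivot a K v (i + 1) * K i.castSucc k + (1 - noPivot a K v (i + 1)) *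
    ((pivot a K v ⬝ᵥ v) * K i.succ k - (K i.succ ⬝ᵥ v) * pivot a K v k)

theorem elimStep_spec (a : R) {r m : ℕ} (K : Fin (r + 1) → Fin m → R) (v : Fin m → R) :
    ((∀ i, a * (K i ⬝ᵥ v) = 0) ∧ ∀ i, elimStep a K v i = K i.castSucc) ∨
    ∃ t : Fin (r + 1), a * (K t ⬝ᵥ v) ≠ 0 ∧ ∀ i : Fin r,
      (i.castSucc < t ∧ a * (K i.castSucc ⬝ᵥ v) = 0 ∧ elimStep a K v i = K i.castSucc) ∨
      (t < i.succ ∧ elimStep a K v i = fun k => (K t ⬝ᵥ v) * K i.succ k - (K i.succ ⬝ᵥ v) * K t k) := by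
  classical
  by_cases h : ∀ i, a * (K i ⬝ᵥ v) = 0
  · left
    refine ⟨h, fun i => funext fun k => ?_⟩
    have : ∀ i, noPivot a K v i = 1 := fun i => if_pos fun j _ => h j
    simp [elimStep, this]
  · right
    push Not at h
    have hex : ∃ t : ℕ, ∃ ht : t < r + 1, a * (K ⟨t, ht⟩ ⬝ᵥ v) ≠ 0 := by
      obtain ⟨i, hi⟩ := h
      exact ⟨i, i.isLt, hi⟩
    obtain ⟨ht, htv⟩ := Nat.find_spec hex
    have hmin : ∀ j : Fin (r + 1), (j : ℕ) < Nat.find hex → a * (K j ⬝ᵥ v) = 0 := fun j hj => by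
      by_contra hne
      exact Nat.find_min hex hj ⟨j.isLt, hne⟩
    generalize Nat.find hex = t at ht htv hmin
    have h1 : ∀ i ≤ t, noPivot a K v i = 1 := fun i hi =>
      if_pos fun j hj => hmin j (lt_of_lt_of_le hj hi)
    have h0 : ∀ i, t < i → noPivot a K v i = 0 := fun i hi =>
      if_neg fun h => htv (h ⟨t, ht⟩ hi)
    have hp : pivot a K v = K ⟨t, ht⟩ := by
      funext k
      rw [pivot, Finset.sum_eq_single ⟨t, ht⟩]
      · rw [h1 t le_rfl, h0 (t + 1) (Nat.lt_succ_self t)]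
        ring
      · intro i _ hi
        have hi : (i : ℕ) ≠ t := fun h => hi (Fin.ext h)
        rcases lt_or_gt_of_ne hi with hlt | hgt
        · rw [h1 i hlt.le, h1 (i + 1) hlt]; ring
        · rw [h0 i hgt, h0 (i + 1) (by omega)]; ring
      · simp
    refine ⟨⟨t, ht⟩, htv, fun i => ?_⟩
    rcases lt_or_ge (i : ℕ) t with hlt | hge
    · exact .inl ⟨hlt, hmin i.castSucc hlt, funext fun k => by simp [elimStep, h1 _ hlt]⟩
    · refine .inr ⟨Nat.lt_succ_of_le hge, funext fun k => ?_⟩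
      simp [elimStep, h0 _ (Nat.lt_succ_of_le hge), hp]

theorem dot_elim {m : ℕ} (x y v : Fin m → R) (b c : R) :
    (fun k => b * x k - c * y k) ⬝ᵥ v = b * (x ⬝ᵥ v) - c * (y ⬝ᵥ v) := by
  simp only [dotProduct, sub_mul, Finset.sum_sub_distrib, Finset.mul_sum, mul_assoc]

theorem elimStep_dot_self (a : R) {r m : ℕ} (K : Fin (r + 1) → Fin m → R) (v : Fin m → R)
    (i : Fin r) : a * (elimStep a K v i ⬝ᵥ v) = 0 := by
  rcases elimStep_spec a K v with ⟨h, he⟩ | ⟨t, -, ht⟩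
  · rw [he, h]
  · rcases ht i with ⟨-, h1, h2⟩ | ⟨-, h2⟩
    · rw [h2, h1]
    · rw [h2, dot_elim]; ring

theorem elimStep_dot (a : R) {r m : ℕ} (K : Fin (r + 1) → Fin m → R) (v u : Fin m → R)
    (hu : ∀ i, a * (K i ⬝ᵥ u) = 0) (i : Fin r) : a * (elimStep a K v i ⬝ᵥ u) = 0 := by
  rcases elimStep_spec a K v with ⟨-, he⟩ | ⟨t, -, ht⟩
  · rw [he, hu]
  · rcases ht i with ⟨-, -, h2⟩ | ⟨-, h2⟩
    · rw [h2, hu]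
    · rw [h2, dot_elim]
      linear_combination (K t ⬝ᵥ v) * hu i.succ - (K i.succ ⬝ᵥ v) * hu t

theorem HasOwnCoordinates.elimStep {a : R} (ha : IsMinimalGen a) {r m : ℕ}
    {K : Fin (r + 1) → Fin m → R} (hK : HasOwnCoordinates a K) (v : Fin m → R) :
    HasOwnCoordinates a (elimStep a K v) := by
  obtain ⟨q, hq, hq'⟩ := hK
  rcases elimStep_spec a K v with ⟨-, he⟩ | ⟨t, hav, ht⟩
  · refine ⟨fun i => q i.castSucc, fun i => by rw [he]; exact hq _, fun i i' hi => ?_⟩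
    rw [he]
    exact hq' _ _ fun h => hi (Fin.castSucc_injective _ h)
  · have key : ∀ i : Fin r, ∃ s : Fin (r + 1), s ≠ t ∧
        ((s = i.castSucc ∧ s < t) ∨ (s = i.succ ∧ t < s)) ∧
        ∃ b c : R, a * b ≠ 0 ∧ ∀ k, Delegation.elimStep a K v i k = b * K s k - c * K t k := by
      intro i
      rcases ht i with ⟨h1, -, h2⟩ | ⟨h1, h2⟩
      · exact ⟨i.castSucc, h1.ne, .inl ⟨rfl, h1⟩, 1, 0, by rw [mul_one]; exact ha.1,
          fun k => by rw [h2]; ring⟩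
      · exact ⟨i.succ, h1.ne', .inr ⟨rfl, h1⟩, _, _, hav, fun k => by rw [h2]⟩
    choose s hst hs b c hb he using key
    refine ⟨fun i => q (s i), fun i => ?_, fun i i' hi => ?_⟩
    · rw [he, hq' (s i) t (hst i).symm, mul_zero, sub_zero]
      intro h
      obtain ⟨y, hy⟩ := (ha.2 (b i)).resolve_left (hb i)
      refine hq (s i) ?_
      rw [← hy]
      linear_combination y * h
    · have hne : s i' ≠ s i := by
        intro h
        refine hi (Fin.ext ?_)
        rcases hs i' with ⟨h1, h2⟩ | ⟨h1, h2⟩ <;> rcases hs i with ⟨h3, h4⟩ | ⟨h3, h4⟩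
        · have := h1.symm.trans (h.trans h3)
          simpa [Fin.ext_iff] using this
        · exact absurd (h ▸ h2) (not_lt_of_gt h4)
        · exact absurd (h ▸ h2) (not_lt_of_gt h4)
        · have := h1.symm.trans (h.trans h3)
          simpa [Fin.ext_iff] using this
      rw [he, hq' (s i) t (hst i).symm, hq' _ _ hne]
      ring

end Elimination

section EliminationCost

variable {R : Type u} [CommRing R] [Fintype R] [DecidableEq R]
  {enc : R ≃ Fin (Fintype.card R)} {X : Type*} {V : Type} {e : X → V → R}

theorem CompOne.isZero {f : X → R} {s : ℕ} (h : CompOne (TestOp.eval enc) e f s) :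
    CompOne (TestOp.eval enc) e (fun x => if f x = 0 then 1 else 0) (s + 1) :=
  h.un TestOp.isZero

theorem Comp.elimStep (a : R) {r m N : ℕ} (hr : r + 1 ≤ N) (hm : m ≤ N)
    {K : X → Fin (r + 1) → Fin m → R} {v : X → Fin m → R}
    (hK : ∀ i k, IsWire e fun x => K x i k) (hv : ∀ k, IsWire e fun x => v x k) :
    Comp (TestOp.eval enc) e (fun x (y : Fin r × Fin m) => elimStep a (K x) (v x) y.1 y.2)
      (100 * (N + 1) ^ 2) := by
  -- the products with `v` and the tests whether `a` kills them
  let F₁ : X → Fin (r + 1) → R := fun x i => K x i ⬝ᵥ v x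
  let e₁ := fun x => Sum.elim (e x) (F₁ x)
  have c₁ : Comp (TestOp.eval enc) e F₁ _ := Comp.pi fun i =>
    CompOne.dot Finset.univ (fun k _ => hK i k) (fun k _ => hv k)
  have w₁ : ∀ i, IsWire e₁ fun x => F₁ x i := fun i => ⟨.inr i, fun _ => rfl⟩
  let F₂ : X → Fin (r + 1) → R := fun x i => if a * F₁ x i = 0 then 1 else 0
  let e₂ := fun x => Sum.elim (e₁ x) (F₂ x)
  have c₂ : Comp (TestOp.eval enc) e₁ F₂ _ := Comp.pi fun i =>
    ((CompOne.const a).mul (w₁ i).comp).isZero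
  let F₃ : X → Fin (r + 2) → R := fun x i => noPivot a (K x) (v x) i
  let e₃ := fun x => Sum.elim (e₂ x) (F₃ x)
  have c₃ : Comp (TestOp.eval enc) e₂ F₃ (∑ _ : Fin (r + 2), (r + 2)) := Comp.pi fun i => by
    refine ((CompOne.prod (Finset.univ.filter fun j : Fin (r + 1) => (j : ℕ) < i)
      (f := fun j x => F₂ x j) fun j _ => IsWire.comp ⟨.inr j, fun _ => rfl⟩).congr
        fun x => ?_).mono ?_
    · funext
      simp only [F₃, F₂, F₁, noPivot, Finset.prod_ite_zero, Finset.prod_const_one,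
        Finset.mem_filter, Finset.mem_univ, true_and]
      congr
    · have := Finset.card_filter_le (Finset.univ : Finset (Fin (r + 1))) fun j => (j : ℕ) < i
      simp only [Finset.card_univ, Fintype.card_fin] at this
      simpa using this
  have w₃ : ∀ i, i < r + 2 → IsWire e₃ fun x => noPivot a (K x) (v x) i := fun i hi =>
    ⟨.inr ⟨i, hi⟩, fun _ => rfl⟩
  have wK : ∀ i k, IsWire e₃ fun x => K x i k := fun i k => (((hK i k).inl _).inl _).inl _
  have wv : ∀ k, IsWire e₃ fun x => v x k := fun k => (((hv k).inl _).inl _).inl _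
  have wd : ∀ i, IsWire e₃ fun x => K x i ⬝ᵥ v x := fun i => ((w₁ i).inl _).inl _
  let F₄ : X → Fin m → R := fun x => pivot a (K x) (v x)
  let e₄ := fun x => Sum.elim (e₃ x) (F₄ x)
  have c₄ : Comp (TestOp.eval enc) e₃ F₄ _ := Comp.pi fun k =>
    CompOne.sum Finset.univ fun i _ =>
      ((w₃ i (by omega)).comp.sub (w₃ (i + 1) (by omega)).comp).mul (wK i k).comp
  let F₅ : X → Unit → R := fun x _ => pivot a (K x) (v x) ⬝ᵥ v x
  let e₅ := fun x => Sum.elim (e₄ x) (F₅ x)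
  have c₅ : Comp (TestOp.eval enc) e₄ F₅ _ :=
    CompOne.dot Finset.univ (fun k _ => ⟨.inr k, fun _ => rfl⟩) (fun k _ => (wv k).inl _)
  have w₅ : ∀ i, i < r + 2 → IsWire e₅ fun x => noPivot a (K x) (v x) i := fun i hi =>
    ((w₃ i hi).inl _).inl _
  have wK₅ : ∀ i k, IsWire e₅ fun x => K x i k := fun i k => ((wK i k).inl _).inl _
  have wd₅ : ∀ i, IsWire e₅ fun x => K x i ⬝ᵥ v x := fun i => ((wd i).inl _).inl _
  have wp : ∀ k, IsWire e₅ fun x => pivot a (K x) (v x) k := fun k => ⟨.inl (.inr k), fun _ => rfl⟩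
  have wpv : IsWire e₅ fun x => pivot a (K x) (v x) ⬝ᵥ v x := ⟨.inr (), fun _ => rfl⟩
  have c₆ : Comp (TestOp.eval enc) e₅
      (fun x (y : Fin r × Fin m) => Delegation.elimStep a (K x) (v x) y.1 y.2) _ := Comp.pi fun y =>
    ((w₅ (y.1 + 1) (by omega)).comp.mul (wK₅ y.1.castSucc y.2).comp).add
      (((CompOne.const 1).sub (w₅ (y.1 + 1) (by omega)).comp).mul
        ((wpv.comp.mul (wK₅ y.1.succ y.2).comp).sub ((wd₅ y.1.succ).comp.mul (wp y.2).comp)))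
  refine (c₁.bind (c₂.bind (c₃.bind (c₄.bind (c₅.bind c₆))))).mono ?_
  simp only [Finset.sum_const, Finset.card_univ, Fintype.card_prod, Fintype.card_fin, smul_eq_mul]
  have h1 : (r + 1) * (2 * m + 1) ≤ N * (2 * N + 1) := Nat.mul_le_mul hr (by omega)
  have h2 : (r + 2) * (r + 2) ≤ (N + 1) * (N + 1) := Nat.mul_le_mul (by omega) (by omega)
  have h3 : m * ((r + 1) * 3) ≤ N * (N * 3) := Nat.mul_le_mul hm (by omega)
  have h4 : r * m ≤ N * N := Nat.mul_le_mul (by omega) hm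
  nlinarith

/-- A nonzero left kernel vector modulo a maximal ideal, computed without divisions. -/
theorem exists_kernel_circuit {a : R} (ha : IsMinimalGen a) {n : ℕ}
    {L : X → Fin (n + 1) → Fin n → R} (hL : ∀ i j, IsWire e fun x => L x i j) :
    ∃ c : X → Fin (n + 1) → R, Comp (TestOp.eval enc) e c (101 * (n + 2) ^ 3) ∧
      ∀ x, (∃ k, a * c x k ≠ 0) ∧ ∀ j, a * (c x ⬝ᵥ fun k => L x k j) = 0 := by
  suffices H : ∀ j r, r + j = n → ∃ K : X → Fin (r + 1) → Fin (n + 1) → R,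
      Comp (TestOp.eval enc) e (fun x (y : Fin (r + 1) × Fin (n + 1)) => K x y.1 y.2)
        ((n + 2) ^ 2 + j * (100 * (n + 2) ^ 2)) ∧
      ∀ x, HasOwnCoordinates a (K x) ∧
        ∀ j' : Fin n, (j' : ℕ) < j → ∀ i, a * (K x i ⬝ᵥ fun k => L x k j') = 0 by
    obtain ⟨K, hc, hK⟩ := H n 0 (zero_add n)
    refine ⟨fun x => K x 0, (hc.select fun k => ((0 : Fin 1), k)).mono ?_, fun x => ?_⟩
    · nlinarith
    · obtain ⟨⟨q, hq, -⟩, h⟩ := hK x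
      exact ⟨⟨q 0, hq 0⟩, fun j => h j j.isLt 0⟩
  intro j
  induction j with
  | zero =>
    rintro r rfl
    refine ⟨fun _ i k => if i = k then 1 else 0, ?_, fun x => ⟨⟨id, fun i => ?_, fun i i' h => ?_⟩,
      fun j' hj => absurd hj (Nat.not_lt_zero _)⟩⟩
    · refine (Comp.pi (F := fun (_ : X) (y : Fin (r + 0 + 1) × Fin (r + 0 + 1)) =>
        if y.1 = y.2 then (1 : R) else 0) (s := fun _ => 1) fun y => CompOne.const _).mono ?_
      simp only [Finset.sum_const, Finset.card_univ, Fintype.card_prod, Fintype.card_fin,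
        smul_eq_mul]
      nlinarith
    · simpa using ha.1
    · exact if_neg h
  | succ j ih =>
    intro r hr
    obtain ⟨K, hc, hK⟩ := ih (r + 1) (by omega)
    let v : X → Fin (n + 1) → R := fun x k => L x k ⟨j, by omega⟩
    refine ⟨fun x => elimStep a (K x) (v x), (hc.bind (Comp.elimStep (N := n + 1) a (by omega) le_rfl
      (K := K) (v := v) (fun i k => ⟨.inr (i, k), fun _ => rfl⟩)
      (fun k => (hL k _).inl _))).mono ?_, fun x => ⟨(hK x).1.elimStep ha _, fun j' hj' i => ?_⟩⟩
    · exact le_of_eq (by ring)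
    · rcases Nat.lt_succ_iff_lt_or_eq.1 hj' with h | h
      · exact elimStep_dot a _ _ _ (fun i => (hK x).2 j' h i) i
      · have h2 : (fun k => L x k j') = v x := by
          funext k
          simp only [v, ← h]
        rw [h2]
        exact elimStep_dot_self a _ _ i

end EliminationCost

section Attack

variable {R : Type u} [CommRing R] [Fintype R] [DecidableEq R]

/-- The probability of the kernel of a homomorphism. -/
theorem unifAvg_hom_eq_zero {I : Type} [Fintype I] [DecidableEq I] (φ : (I → R) →+ R) :
    unifAvg (fun x => ind (φ x = 0)) = (Nat.card φ.range : ℝ)⁻¹ := by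
  classical
  have h1 : ∑ x : I → R, ind (φ x = 0) = Nat.card φ.ker := by
    rw [Nat.card_eq_fintype_card, Fintype.card_of_subtype
      (Finset.univ.filter fun x => φ x = 0) (fun x => by simp [AddMonoidHom.mem_ker]),
      Finset.natCast_card_filter]
    exact Finset.sum_congr rfl fun x _ => by unfold ind; congr
  have h2 : (Nat.card φ.ker : ℝ) * Nat.card φ.range = (Fintype.card R : ℝ) ^ Fintype.card I := by
    rw [← AddSubgroup.index_ker]
    have := φ.ker.card_mul_index
    rw [Nat.card_eq_fintype_card (α := I → R), Fintype.card_fun] at this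
    exact_mod_cast this
  have h3 : (Nat.card φ.ker : ℝ) ≠ 0 := by exact_mod_cast Nat.card_pos.ne'
  have h4 : (Nat.card φ.range : ℝ) ≠ 0 := by exact_mod_cast Nat.card_pos.ne'
  rw [unifAvg, h1, ← h2]
  field_simp

/-- Setting some coordinates to zero can only make it more likely that a linear form vanishes,
because it can only make the image of the form smaller. -/
theorem unifAvg_dot_le_masked {I : Type} [Fintype I] [DecidableEq I] (B : I → R) (σ : I → Bool) :
    unifAvg (fun x : I → R => ind (∑ i, B i * x i = 0)) ≤
      unifAvg (fun x : I → R => ind (∑ i, B i * masked σ x i = 0)) := by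
  let φ : (I → R) →+ R := AddMonoidHom.mk' (fun x => ∑ i, B i * x i) fun x y => by
    simp only [Pi.add_apply, mul_add, Finset.sum_add_distrib]
  let ψ : (I → R) →+ R := AddMonoidHom.mk' (fun x => ∑ i, B i * masked σ x i) fun x y => by
    rw [← Finset.sum_add_distrib]
    refine Finset.sum_congr rfl fun i _ => ?_
    simp only [masked, Pi.add_apply]
    split <;> ring
  have h : ψ.range ≤ φ.range := by
    rintro _ ⟨x, rfl⟩
    exact ⟨masked σ x, rfl⟩
  have h1 := unifAvg_hom_eq_zero φ
  have h2 := unifAvg_hom_eq_zero ψ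
  refine h1.trans_le (le_trans ?_ h2.symm.le)
  refine inv_anti₀ (by exact_mod_cast Nat.card_pos) ?_
  exact_mod_cast Nat.card_le_card_of_injective _ (AddSubgroup.inclusion_injective h)

/-- A linear form with a nonzero coefficient vanishes with probability at most one half. -/
theorem unifAvg_dot_le_half {b : ℕ} (B : Fin b → R) (hB : B ≠ 0) :
    unifAvg (fun x : Fin b → R => ind (∑ i, B i * x i = 0)) ≤ 1 / 2 := by
  have h := unifAvg_dot_eq_zero_le (c := 1) B hB
  rw [unifAvg_eq] at h ⊢
  let j : Fin b → Fin b × Fin 1 := fun i => (i, 0)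
  have hj : Function.Injective j := fun x y hxy => by simpa [j] using hxy
  refine ((prodAvg_comp_injective isDist_unifW hj
    (fun x : Fin b → R => ind (∑ i, B i * x i = 0))).symm.trans_le (le_trans ?_ h)).trans ?_
  · refine prodAvg_mono isDist_unifW fun x => ind_mono fun hx k => ?_
    rw [Subsingleton.elim k 0]
    exact hx
  · rw [Nat.cast_one, Real.rpow_neg_one]; norm_num

/-- If `κ + 1` rows without noise suffice to tell an LPN sample from a random one, then the
security is bounded by the probability that a column has no noise in these rows. -/
theorem le_of_lpnSecure [Nontrivial R] (enc : R ≃ Fin (Fintype.card R)) {N κ c T : ℕ} {μ bits : ℝ}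
    (h0 : 0 ≤ μ) (h1 : μ ≤ 1) (hN : κ + 1 ≤ N) (hc : 0 < c) (hT : 102 * (κ + 2) ^ 3 ≤ T)
    (h : LPNSecure enc N κ c μ T bits) : (1 - μ) ^ (κ + 1) / 2 ≤ (2 : ℝ) ^ (-bits) := by
  obtain ⟨a, ha⟩ := exists_isMinimalGen (R := R)
  let ι : Fin (κ + 1) → Fin N × Fin c := fun k => (Fin.castLE hN k, ⟨0, hc⟩)
  have hι : Function.Injective ι := fun x y hxy => by simpa [ι] using hxy
  obtain ⟨b, hb, hb'⟩ := exists_kernel_circuit (enc := enc) (e := fun L : Fin N × Fin κ → R => L)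
    (n := κ) ha (L := fun L i j => L (Fin.castLE hN i, j)) (fun i j => ⟨_, fun _ => rfl⟩)
  let test : (Fin N × Fin κ → R) → (Fin (κ + 1) → R) → R := fun L y => a * (b L ⬝ᵥ y)
  obtain ⟨D, hD, hD'⟩ : Comp (TestOp.eval enc) (fun x : LPNIdx N κ c → R => x)
      (fun x (_ : Unit) => if test (fun y => x (.inl y)) (fun k => x (.inr (ι k))) = 0
        then (1 : R) else 0) (102 * (κ + 2) ^ 3) := by
    have c1 := (hb.comap fun x : LPNIdx N κ c → R => fun y => x (.inl y)).weaken
      (e' := fun x : LPNIdx N κ c → R => x) fun v => ⟨.inl v, fun _ => rfl⟩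
    refine (c1.bind ((CompOne.const a).mul (CompOne.dot Finset.univ
      (f := fun k x => b (fun y => x (.inl y)) k)
      (g := fun k x => x (.inr (ι k))) (fun k _ => ⟨.inr k, fun _ => rfl⟩)
      (fun k _ => ⟨.inl (.inr (ι k)), fun _ => rfl⟩))).isZero).mono ?_
    simp only [Finset.card_univ, Fintype.card_fin]
    have : (κ + 2) * 4 ≤ (κ + 2) ^ 3 := by
      rw [pow_succ' (κ + 2) 2]
      exact Nat.mul_le_mul_left _ (Nat.pow_le_pow_left (by omega : 2 ≤ κ + 2) 2)
    generalize (κ + 2) ^ 3 = z at *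
    omega
  have hrun : ∀ x : LPNIdx N κ c → R, (AdvCircuit.run enc D x () = 1) ↔
      test (fun y => x (.inl y)) (fun k => x (.inr (ι k))) = 0 := by
    intro x
    rw [AdvCircuit.run, hD' x]
    beta_reduce
    split <;> simp_all
  have hsum : ∀ L y, test L y = ∑ k, (a * b L k) * y k := fun L y => by
    simp only [test, dotProduct, Finset.mul_sum, mul_assoc]
  -- the probability of acceptance depends on the noise only
  have hlin : ∀ L (H : Fin κ × Fin c → R) S, test L (fun k => flat (unflat L * unflat H +
      unflat S) (ι k)) = ∑ k, (a * b L k) * S (ι k) := by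
    intro L H S
    rw [hsum]
    simp only [flat, Matrix.add_apply, mul_add, Finset.sum_add_distrib, Matrix.mul_apply]
    rw [show (∑ k, a * b L k * ∑ j, unflat L (ι k).1 j * unflat H j (ι k).2) = 0 from ?_, zero_add]
    · rfl
    · simp only [Finset.mul_sum]
      rw [Finset.sum_comm]
      refine Finset.sum_eq_zero fun j _ => ?_
      have := (hb' L).2 j
      rw [dotProduct, Finset.mul_sum] at this
      rw [← zero_mul (H (j, ⟨0, hc⟩)), ← this, Finset.sum_mul]
      exact Finset.sum_congr rfl fun k _ => by simp only [unflat, Matrix.of_apply, ι]; ring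
  let P : (Fin (κ + 1) → Bool) → (Fin N × Fin κ → R) → ℝ := fun σ L =>
    prodAvg (unifW R (Fin (κ + 1))) fun x => ind (∑ k, (a * b L k) * masked σ x k = 0)
  let Q : (Fin N × Fin κ → R) → ℝ := fun L =>
    prodAvg (unifW R (Fin (κ + 1))) fun x => ind (∑ k, (a * b L k) * x k = 0)
  have hreal : lpnReal enc N κ c μ D = prodAvg (bitW fun _ : Fin (κ + 1) => μ) fun σ =>
      prodAvg (unifW R (Fin N × Fin κ)) fun L => P σ L := by
    simp only [lpnReal, maskAvg_eq, unifAvg_eq, hrun, Sum.elim_inl, Sum.elim_inr, hlin]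
    refine Eq.trans ?_ (prodAvg_comp_injective (isDist_bitW (fun _ => h0) (fun _ => h1)) hι
      (fun σ => prodAvg (unifW R (Fin N × Fin κ)) fun L => P σ L))
    refine congrArg _ (funext fun σ => congrArg _ (funext fun L => ?_))
    rw [prodAvg_const isDist_unifW]
    exact prodAvg_comp_injective isDist_unifW hι
      (fun x => ind (∑ k, (a * b L k) * masked (fun i => σ (ι i)) x k = 0))
  have hideal : lpnIdeal enc N κ c D = prodAvg (unifW R (Fin N × Fin κ)) Q := by
    simp only [lpnIdeal, unifAvg_eq, hrun, Sum.elim_inl, Sum.elim_inr, hsum]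
    refine congrArg _ (funext fun L => ?_)
    exact prodAvg_comp_injective isDist_unifW hι (fun x => ind (∑ k, (a * b L k) * x k = 0))
  have hd : IsDist (bitW fun _ : Fin (κ + 1) => μ) := isDist_bitW (fun _ => h0) (fun _ => h1)
  have hQ : ∀ L, Q L ≤ 1 / 2 := fun L => by
    have := unifAvg_dot_le_half (fun k => a * b L k) (by
      obtain ⟨k, hk⟩ := (hb' L).1
      exact fun h => hk (congrFun h k))
    rwa [unifAvg_eq] at this
  have hPQ : ∀ σ L, Q L ≤ P σ L := fun σ L => by
    have := unifAvg_dot_le_masked (fun k => a * b L k) σ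
    rwa [unifAvg_eq, unifAvg_eq] at this
  have hP : ∀ L, P (fun _ => false) L = 1 := fun L => by
    simp only [P, masked, Bool.false_eq_true, if_false, mul_zero, Finset.sum_const_zero,
      ind_of_true]
    exact prodAvg_const isDist_unifW 1
  have key : (1 - μ) ^ (κ + 1) / 2 ≤ lpnReal enc N κ c μ D - lpnIdeal enc N κ c D := by
    rw [hreal, hideal, ← prodAvg_const hd (prodAvg (unifW R (Fin N × Fin κ)) Q), ← prodAvg_sub]
    have hz : ∀ σ, 0 ≤ prodAvg (unifW R (Fin N × Fin κ)) (fun L => P σ L) -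
        prodAvg (unifW R (Fin N × Fin κ)) Q := fun σ =>
      sub_nonneg.2 (prodAvg_mono isDist_unifW fun L => hPQ σ L)
    refine le_trans ?_ (Finset.single_le_sum (f := fun σ => (∏ i, bitW (fun _ => μ) i (σ i)) *
      (prodAvg (unifW R (Fin N × Fin κ)) (fun L => P σ L) -
        prodAvg (unifW R (Fin N × Fin κ)) Q)) (fun σ _ => mul_nonneg
        (Finset.prod_nonneg fun i _ => hd.nonneg _ _) (hz σ)) (Finset.mem_univ fun _ => false))
    simp only [hP, prodAvg_const (isDist_unifW (R := R)), bitW, Bool.false_eq_true, if_false,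
      Finset.prod_const, Finset.card_univ, Fintype.card_fin]
    have := prodAvg_le (w := unifW R (Fin N × Fin κ)) isDist_unifW hQ
    have h3 : (0 : ℝ) ≤ (1 - μ) ^ (κ + 1) := pow_nonneg (sub_nonneg.2 h1) _
    nlinarith
  exact key.trans ((le_abs_self _).trans (h D (hD.trans hT)))

end Attack

/-! ### The view of the server -/

section Pack

variable {R : Type u} [CommRing R] {n b : ℕ}

/-- The column `c` of a block `[Aᵀ | B]` belongs to `Aᵀ` if `c < n` and to `B` otherwise. -/
def packIdx (n b : ℕ) (x : Fin b × Fin (2 * n)) : (Fin n × Fin b) ⊕ (Fin b × Fin n) :=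
  if h : (x.2 : ℕ) < n then .inl (⟨x.2, h⟩, x.1) else .inr (x.1, ⟨x.2 - n, by omega⟩)

theorem packIdx_injective : Function.Injective (packIdx n b) := by
  rintro ⟨r, c⟩ ⟨r', c'⟩ h
  simp only [packIdx] at h
  split at h <;> split at h <;> simp only [Sum.inl.injEq, Sum.inr.injEq, Prod.mk.injEq,
    Fin.mk.injEq, reduceCtorEq] at h
  · exact Prod.ext h.2 (Fin.ext h.1)
  · exact Prod.ext h.1 (Fin.ext (by simp only; omega))

/-- The matrix `[Aᵀ | B]`. -/
def pack (A : Matrix (Fin n) (Fin b) R) (B : Matrix (Fin b) (Fin n) R) :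
    Matrix (Fin b) (Fin (2 * n)) R :=
  Matrix.of fun r c => (Sum.elim (flat A) (flat B) : _ → R) (packIdx n b (r, c))

/-- The matrix `A` of a block `[Aᵀ | B]`. -/
def leftHalf (Z : Matrix (Fin b) (Fin (2 * n)) R) : Matrix (Fin n) (Fin b) R :=
  Matrix.of fun r c => Z c ⟨r, by omega⟩

/-- The matrix `B` of a block `[Aᵀ | B]`. -/
def rightHalf (Z : Matrix (Fin b) (Fin (2 * n)) R) : Matrix (Fin b) (Fin n) R :=
  Matrix.of fun r c => Z r ⟨n + c, by omega⟩

theorem leftHalf_add (Z Z' : Matrix (Fin b) (Fin (2 * n)) R) :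
    leftHalf (Z + Z') = leftHalf Z + leftHalf Z' := rfl

theorem rightHalf_add (Z Z' : Matrix (Fin b) (Fin (2 * n)) R) :
    rightHalf (Z + Z') = rightHalf Z + rightHalf Z' := rfl

theorem leftHalf_sum {I : Type*} (S : Finset I) (Z : I → Matrix (Fin b) (Fin (2 * n)) R) :
    leftHalf (∑ i ∈ S, Z i) = ∑ i ∈ S, leftHalf (Z i) := by
  ext r c
  simp only [leftHalf, Matrix.of_apply, Matrix.sum_apply]

theorem rightHalf_sum {I : Type*} (S : Finset I) (Z : I → Matrix (Fin b) (Fin (2 * n)) R) :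
    rightHalf (∑ i ∈ S, Z i) = ∑ i ∈ S, rightHalf (Z i) := by
  ext r c
  simp only [rightHalf, Matrix.of_apply, Matrix.sum_apply]

theorem leftHalf_pack (A : Matrix (Fin n) (Fin b) R) (B : Matrix (Fin b) (Fin n) R) :
    leftHalf (pack A B) = A := by
  ext r c
  simp [leftHalf, pack, packIdx, flat]

theorem rightHalf_pack (A : Matrix (Fin n) (Fin b) R) (B : Matrix (Fin b) (Fin n) R) :
    rightHalf (pack A B) = B := by
  ext r c
  simp [rightHalf, pack, packIdx, flat]

theorem leftHalf_mul {a : ℕ} (P : Matrix (Fin a) (Fin b) R) (Z : Matrix (Fin b) (Fin (2 * n)) R) :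
    leftHalf (P * Z) = leftHalf Z * Pᵀ := by
  ext r c
  simp only [leftHalf, Matrix.of_apply, Matrix.mul_apply, Matrix.transpose_apply]
  exact Finset.sum_congr rfl fun k _ => mul_comm _ _

theorem rightHalf_mul {a : ℕ} (P : Matrix (Fin a) (Fin b) R) (Z : Matrix (Fin b) (Fin (2 * n)) R) :
    rightHalf (P * Z) = P * rightHalf Z := rfl

end Pack

section View

variable {R : Type u} [CommRing R] [Fintype R] [DecidableEq R] {p : Params}

open Classical in
/-- What the distinguisher outputs on the view of the server if the client uses the matrices `L`,
sends `[A_encᵀ | B_enc] = Z`, tests the second reply with `Y`, and accepts the first reply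
exactly if it is correct. -/
def idealView (enc : R ≃ Fin (Fintype.card R)) (adv : Adversary R p) (L : p.LIdx → R)
    (Y : p.XIdx → R) (Z : Matrix (Fin (p.dim 0)) (Fin (2 * p.dim 0)) R) : Prop :=
  let m := message p L (leftHalf Z) (rightHalf Z)
  let r₂ := adv.reply2.run enc m
  let verdict : R := if (fun y : p.Chk2Idx => checkLhs p (repLeft p r₂) Y y.1 y.2.1 y.2.2) =
    (fun y => checkRhs p (leftHalf Z) (repLeft p r₂) L Y y.1 y.2.1 y.2.2) then 1 else 0
  if adv.reply1.run enc L = honest1 p L then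
    adv.dist.run enc (Sum.elim m fun _ => verdict) () = 1
  else adv.distAbort.run enc L () = 1

section Cost

variable {enc : R ≃ Fin (Fintype.card R)} {X : Type*} {V : Type} {e : X → V → R}

open Classical in
theorem CompOne.allEq {I : Type} [Fintype I] {F G : X → I → R}
    (hF : ∀ i, IsWire e fun x => F x i) (hG : ∀ i, IsWire e fun x => G x i) :
    CompOne (TestOp.eval enc) e (fun x => if F x = G x then 1 else 0)
      (3 * Fintype.card I + 1) := by
  refine ((CompOne.prod Finset.univ fun i _ =>
    ((hF i).comp.sub (hG i).comp).isZero).congr fun x => ?_).mono ?_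
  · funext
    simp only [Finset.prod_ite_zero, Finset.prod_const_one, Finset.mem_univ, true_imp_iff,
      sub_eq_zero, funext_iff]
  · simp [mul_comm]

/-- An adversary's circuit run on wires. -/
theorem Comp.run {W O : Type} (c : AdvCircuit R W O) {F : X → W → R}
    (hF : ∀ w, IsWire e fun x => F x w) :
    Comp (TestOp.eval enc) e (fun x => AdvCircuit.run enc c (F x)) c.size :=
  Comp.weaken (e := F) ⟨c, le_rfl, fun _ => rfl⟩ hF

theorem CompOne.idealView (adv : Adversary R p) (hp : ∀ i ≤ p.d, 1 ≤ p.dim i)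
    (hp' : ∀ i ≤ p.d, p.dim i ≤ p.dim 0)
    {h₁ : ℕ} (hh : ∀ {W : Type} (e : (p.LIdx → R) → W → R), (∀ v, IsWire e fun L => L v) →
      Comp (fun f : Empty => f.elim) e (fun L => honest1 p L) h₁)
    {L : X → p.LIdx → R} {Y : X → p.XIdx → R}
    {Z : X → Matrix (Fin (p.dim 0)) (Fin (2 * p.dim 0)) R}
    (hL : ∀ v, IsWire e fun x => L x v) (hY : ∀ v, IsWire e fun x => Y x v)
    (hZ : ∀ r c, IsWire e fun x => Z x r c) :
    ∃ f : X → R, CompOne (TestOp.eval enc) e f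
        (adv.size + h₁ + 3 * (p.total * p.total) + 12 * (p.total * p.checks * p.total) + 7) ∧
      ∀ x, f x = 1 ↔ idealView enc adv (L x) (Y x) (Z x) := by
  classical
  let m : X → p.MsgIdx → R := fun x => message p (L x) (leftHalf (Z x)) (rightHalf (Z x))
  have hm : ∀ v, IsWire e fun x => m x v := by
    rintro (v | v | v)
    · exact hL v
    · exact hZ _ _
    · exact hZ _ _
  let r₁ : X → p.Reply1Idx → R := fun x => AdvCircuit.run enc adv.reply1 (L x)
  let o₁ : X → p.Reply1Idx → R := fun x => honest1 p (L x)
  let r₂ : X → p.Reply2Idx → R := fun x => AdvCircuit.run enc adv.reply2 (m x)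
  let q : X → _ → R := fun x => testProd p (L x) (Y x)
  have cr₁ : Comp (TestOp.eval enc) e r₁ _ := Comp.run adv.reply1 hL
  have co₁ : Comp (TestOp.eval enc) e o₁ h₁ :=
    (((hh (fun L => L) fun v => IsWire.self v).ofArith).comap L).weaken hL
  have cr₂ : Comp (TestOp.eval enc) e r₂ _ := Comp.run adv.reply2 hm
  have cq : Comp (TestOp.eval enc) e q _ := Comp.testProd hL hY
  let e₁ := fun x => Sum.elim (e x) (Sum.elim (r₁ x) (Sum.elim (o₁ x) (Sum.elim (r₂ x) (q x))))
  have hr₁ : ∀ v, IsWire e₁ fun x => r₁ x v := fun v => ⟨.inr (.inl v), fun _ => rfl⟩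
  have ho₁ : ∀ v, IsWire e₁ fun x => o₁ x v := fun v => ⟨.inr (.inr (.inl v)), fun _ => rfl⟩
  have hr₂ : ∀ v, IsWire e₁ fun x => r₂ x v := fun v =>
    ⟨.inr (.inr (.inr (.inl v))), fun _ => rfl⟩
  have hq : ∀ v, IsWire e₁ fun x => q x v := fun v => ⟨.inr (.inr (.inr (.inr v))), fun _ => rfl⟩
  let E : X → R := fun x => if r₁ x = o₁ x then 1 else 0
  let l : X → p.Chk2Idx → R := fun x y => checkLhs p (repLeft p (r₂ x)) (Y x) y.1 y.2.1 y.2.2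
  let r : X → p.Chk2Idx → R := fun x y =>
    checkRhs p (leftHalf (Z x)) (repLeft p (r₂ x)) (L x) (Y x) y.1 y.2.1 y.2.2
  have cE : CompOne (TestOp.eval enc) e₁ E _ := CompOne.allEq hr₁ ho₁
  have cl : Comp (TestOp.eval enc) e₁ l _ :=
    Comp.checkLhs (P := fun x => repLeft p (r₂ x)) (Y := Y)
      (fun i a b => hr₂ (.inl ⟨i, (a, b)⟩)) (fun v => (hY v).inl _)
  have cr : Comp (TestOp.eval enc) e₁ r _ :=
    Comp.checkRhs (M := fun x => leftHalf (Z x)) (P := fun x => repLeft p (r₂ x)) (L := L) (Y := Y)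
      (fun a b => (hZ _ _).inl _) (fun i a b => hr₂ (.inl ⟨i, (a, b)⟩)) hq
  let e₂ := fun x => Sum.elim (e₁ x) (Sum.elim (fun _ : Unit => E x) (Sum.elim (l x) (r x)))
  let v : X → R := fun x => if l x = r x then 1 else 0
  have cv : CompOne (TestOp.eval enc) e₂ v _ := CompOne.allEq
    (fun i => ⟨.inr (.inr (.inl i)), fun _ => rfl⟩) (fun i => ⟨.inr (.inr (.inr i)), fun _ => rfl⟩)
  let e₃ := fun x => Sum.elim (e₂ x) fun _ : Unit => v x
  have hE : IsWire e₃ E := ⟨.inl (.inr (.inl ())), fun _ => rfl⟩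
  have cd : CompOne (TestOp.eval enc) e₃
      (fun x => AdvCircuit.run enc adv.dist (Sum.elim (m x) fun _ => v x) ()) adv.dist.size :=
    (Comp.run adv.dist (F := fun x => Sum.elim (m x) fun _ => v x) (by
      rintro (w | w)
      · exact (((hm w).inl _).inl _).inl _
      · exact ⟨.inr (), fun _ => rfl⟩))
  have ca : CompOne (TestOp.eval enc) e₃
      (fun x => AdvCircuit.run enc adv.distAbort (L x) ()) adv.distAbort.size :=
    (Comp.run adv.distAbort (F := L) fun w => (((hL w).inl _).inl _).inl _)
  have cf := (hE.comp.mul cd).add (((CompOne.const 1).sub hE.comp).mul ca)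
  refine ⟨_, ((cr₁.pair (co₁.pair (cr₂.pair cq))).bind
    ((cE.pair (cl.pair cr)).bind (cv.bind cf))).mono ?_, fun x => ?_⟩
  · have b1 := testProd_cost_le hp hp'
    have b2 := check_cost_le (a := p.dim 0) (f := fun i => p.dim (i + 1)) (fun i hi => hp _ hi)
      (sum_dim_succ_le_total p)
    have b3 := check_cost_le (a := p.dim 0) (f := p.dim) (fun i hi => hp _ hi.le)
      (sum_dim_le_total p)
    have b4 : p.dim 0 * p.checks * p.total ≤ p.total * p.checks * p.total := by
      gcongr
      exact dim_zero_le_total p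
    obtain ⟨-, -, -, b5, -, -, -, -, b6⟩ := card_randIdx_add_le hp hp'
    simp only [Adversary.size]
    omega
  · simp only [Delegation.idealView]
    by_cases h : AdvCircuit.run enc adv.reply1 (L x) = honest1 p (L x)
    · rw [if_pos h, show E x = 1 from if_pos h, one_mul, sub_self, zero_mul, add_zero]
    · rw [if_neg h, show E x = 0 from if_neg h, zero_mul, sub_zero, one_mul, zero_add]

end Cost

end View

/-! ### Hybrids between the view and a one-time pad -/

section Hybrids

variable {R : Type u} [CommRing R] [Fintype R] [DecidableEq R]

/-- One application of the LPN assumption. A sample with fewer rows and a higher noise rate than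
the assumption speaks of is obtained from a sample by forgetting rows and adding noise; as
adversaries are non-uniform, the added noise `z` may be fixed. -/
theorem abs_sub_le_of_lpnSecure {enc : R ≃ Fin (Fintype.card R)} {a κ c N T : ℕ} {μ μ' bits : ℝ}
    (haN : a ≤ N) (h0 : 0 ≤ μ) (hμ : μ ≤ μ') (h1 : μ' ≤ 1)
    (h : LPNSecure enc N κ c μ T bits)
    (g : Matrix (Fin a) (Fin κ) R → Matrix (Fin a) (Fin c) R → Prop)
    (hg : ∀ z : Fin a × Fin c → R, ∃ f : (LPNIdx a κ c → R) → R,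
      CompOne (TestOp.eval enc) (fun x => x) f T ∧
      ∀ x, f x = 1 ↔ g (unflat fun y => x (.inl y)) (unflat (fun y => x (.inr y)) + unflat z)) :
    |(prodAvg (bitW fun _ : Fin a × Fin c => μ') fun s =>
        prodAvg (unifW R (Fin a × Fin κ)) fun l => prodAvg (unifW R (Fin a × Fin c)) fun y =>
          prodAvg (unifW R (Fin κ × Fin c)) fun v =>
            ind (g (unflat l) (unflat l * unflat v + unflat (masked s y)))) -
      prodAvg (unifW R (Fin a × Fin κ)) fun l => prodAvg (unifW R (Fin a × Fin c)) fun v =>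
        ind (g (unflat l) (unflat v))| ≤ (2 : ℝ) ^ (-bits) := by
  obtain ⟨μ'', hμ0, hμ1, hμ''⟩ : ∃ μ'', 0 ≤ μ'' ∧ μ'' ≤ 1 ∧ 1 - μ' = (1 - μ) * (1 - μ'') := by
    rcases (hμ.trans h1).eq_or_lt with h | h
    · exact ⟨0, le_rfl, zero_le_one, by rw [h] at hμ ⊢; linarith [le_antisymm hμ h1]⟩
    · have h2 : 0 < 1 - μ := sub_pos.2 h
      refine ⟨1 - (1 - μ') / (1 - μ), ?_, ?_, ?_⟩
      · rw [sub_nonneg, div_le_one h2]; linarith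
      · linarith [div_nonneg (sub_nonneg.2 h1) h2.le]
      · field_simp; ring
  let G : (Fin a × Fin c → R) → ℝ := fun y =>
    prodAvg (unifW R (Fin a × Fin κ)) fun l => prodAvg (unifW R (Fin κ × Fin c)) fun v =>
      ind (g (unflat l) (unflat l * unflat v + unflat y))
  have hd : IsDist (noiseW R fun _ : Fin a × Fin c => μ'') :=
    isDist_noiseW (fun _ => hμ0) fun _ => hμ1
  -- split the noise into the noise of the sample and additional noise
  have hsplit : (prodAvg (bitW fun _ : Fin a × Fin c => μ') fun s =>
        prodAvg (unifW R (Fin a × Fin κ)) fun l => prodAvg (unifW R (Fin a × Fin c)) fun y =>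
          prodAvg (unifW R (Fin κ × Fin c)) fun v =>
            ind (g (unflat l) (unflat l * unflat v + unflat (masked s y)))) =
      prodAvg (noiseW R fun _ : Fin a × Fin c => μ'') fun z =>
        prodAvg (bitW fun _ : Fin a × Fin c => μ) fun s =>
          prodAvg (unifW R (Fin a × Fin c)) fun y => G (masked s y + z) := by
    refine Eq.trans (prodAvg_congr (fun s => prodAvg_comm _ _)) ?_
    have h2 := maskAvg_unifAvg_masked (fun _ : Fin a × Fin c => μ') G
    rw [prodAvg_noiseW_add (fun _ => hμ'')] at h2
    simp only [maskAvg_eq, unifAvg_eq] at h2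
    refine h2.trans (prodAvg_congr (fun z => ?_))
    have h3 := maskAvg_unifAvg_masked (fun _ : Fin a × Fin c => μ) fun y => G (y + z)
    simp only [maskAvg_eq, unifAvg_eq] at h3
    exact h3.symm
  rw [hsplit, ← prodAvg_const hd (prodAvg (unifW R (Fin a × Fin κ)) fun l =>
    prodAvg (unifW R (Fin a × Fin c)) fun v => ind (g (unflat l) (unflat v)))]
  refine abs_prodAvg_sub_le hd fun z => ?_
  obtain ⟨f, hf, hfg⟩ := hg z
  let ι : Fin a × Fin c → Fin N × Fin c := fun x => (Fin.castLE haN x.1, x.2)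
  have hι : Function.Injective ι := fun x y hxy => by
    simpa [ι, Prod.ext_iff, Fin.ext_iff] using hxy
  let ι' : Fin a × Fin κ → Fin N × Fin κ := fun x => (Fin.castLE haN x.1, x.2)
  have hι' : Function.Injective ι' := fun x y hxy => by
    simpa [ι', Prod.ext_iff, Fin.ext_iff] using hxy
  obtain ⟨D, hD, hD'⟩ : CompOne (TestOp.eval enc) (fun x : LPNIdx N κ c → R => x)
      (fun x => f (Sum.elim (fun y => x (.inl (ι' y))) fun y => x (.inr (ι y)))) T := by
    refine (hf.comap fun x : LPNIdx N κ c → R =>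
      Sum.elim (fun y => x (.inl (ι' y))) fun y => x (.inr (ι y))).weaken ?_
    rintro (v | v)
    · exact ⟨.inl (ι' v), fun _ => rfl⟩
    · exact ⟨.inr (ι v), fun _ => rfl⟩
  have hrun : ∀ x : LPNIdx N κ c → R, (AdvCircuit.run enc D x () = 1) ↔
      g (unflat fun y => x (.inl (ι' y))) (unflat (fun y => x (.inr (ι y))) + unflat z) := by
    intro x
    rw [AdvCircuit.run, hD' x, hfg]
    rfl
  have hreal : lpnReal enc N κ c μ D = prodAvg (bitW fun _ : Fin a × Fin c => μ) fun s =>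
      prodAvg (unifW R (Fin a × Fin c)) fun y => G (masked s y + z) := by
    have e1 : (prodAvg (bitW fun _ : Fin a × Fin c => μ) fun s =>
        prodAvg (unifW R (Fin a × Fin c)) fun y => G (masked s y + z)) =
        prodAvg (bitW fun _ : Fin a × Fin c => μ) fun s =>
        prodAvg (unifW R (Fin a × Fin κ)) fun l => prodAvg (unifW R (Fin κ × Fin c)) fun v =>
        prodAvg (unifW R (Fin a × Fin c)) fun y =>
          ind (g (unflat l) (unflat l * unflat v + unflat (masked s y + z))) := by
      refine prodAvg_congr (fun s => ?_)
      rw [prodAvg_comm]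
      exact prodAvg_congr (fun l => prodAvg_comm _ _)
    rw [e1]
    simp only [lpnReal, maskAvg_eq, unifAvg_eq, hrun, Sum.elim_inl, Sum.elim_inr]
    refine Eq.trans (prodAvg_congr (fun σ => ?_)) (prodAvg_comp_injective
      (isDist_bitW (fun _ => h0) (fun _ => hμ.trans h1)) hι _)
    refine Eq.trans (prodAvg_congr (fun L => ?_)) (prodAvg_comp_injective
      (isDist_unifW (R := R)) hι' _)
    refine prodAvg_congr (fun H => ?_)
    refine Eq.trans (prodAvg_congr (fun S => ?_)) (prodAvg_comp_injective
      (isDist_unifW (R := R)) hι _)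
    congr 2
    ext r k
    simp only [unflat, flat, Matrix.add_apply, Matrix.of_apply, Matrix.mul_apply, masked,
      Pi.add_apply, ι, ι', add_assoc]
  have hideal : lpnIdeal enc N κ c D = prodAvg (unifW R (Fin a × Fin κ)) fun l =>
      prodAvg (unifW R (Fin a × Fin c)) fun v => ind (g (unflat l) (unflat v)) := by
    simp only [lpnIdeal, unifAvg_eq, hrun, Sum.elim_inl, Sum.elim_inr]
    refine Eq.trans (prodAvg_congr (fun L => ?_)) (prodAvg_comp_injective
      (isDist_unifW (R := R)) hι' _)
    refine Eq.trans (prodAvg_comp_injective (isDist_unifW (R := R)) hι fun v =>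
      ind (g (unflat fun y => L (ι' y)) (unflat v + unflat z))) ?_
    exact prodAvg_unifW_add z fun v => ind (g (unflat fun y => L (ι' y)) (unflat v))
  rw [← hreal, ← hideal]
  exact h D hD

variable {p : Params}

/-- The position of a noise bit, for an entry of the block `[S_{i+1}ᵀ | T_{i+1}]`. -/
def maskPos (i : Fin p.d) :
    (Fin (p.dim 0) × Fin (p.dim i)) ⊕ (Fin (p.dim i) × Fin (p.dim 0)) → p.MaskIdx :=
  Sum.elim (fun x => .inl ⟨i, x⟩) fun x => .inr ⟨i, x⟩

/-- The position of a noise value, for an entry of the block `[S_{i+1}ᵀ | T_{i+1}]`. -/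
def noisePos (i : Fin p.d) :
    (Fin (p.dim 0) × Fin (p.dim i)) ⊕ (Fin (p.dim i) × Fin (p.dim 0)) → p.RandIdx :=
  Sum.elim (fun x => .inr (.inr (.inr (.inl ⟨i, x⟩))))
    fun x => .inr (.inr (.inr (.inr (.inl ⟨i, x⟩))))

/-- The position of an entry of the block `[Hᵀ | G]`. -/
def seedPos : (Fin (p.dim 0) × Fin (p.dim p.d)) ⊕ (Fin (p.dim p.d) × Fin (p.dim 0)) → p.RandIdx :=
  Sum.elim (fun x => .inr (.inl x)) fun x => .inr (.inr (.inl x))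

/-- The position of an entry of the block `L_{i+1}`. -/
def subPos (i : Fin p.d) (x : Fin (p.dim i) × Fin (p.dim (i + 1))) : p.RandIdx := .inl ⟨i, x⟩

theorem maskPos_injective (i : Fin p.d) : Function.Injective (maskPos i) := by
  rintro (x | x) (y | y) h <;> simp [maskPos] at h ⊢ <;> exact h

theorem noisePos_injective (i : Fin p.d) : Function.Injective (noisePos i) := by
  rintro (x | x) (y | y) h <;> simp [noisePos] at h ⊢ <;> exact h

theorem seedPos_injective : Function.Injective (seedPos (p := p)) := by
  rintro (x | x) (y | y) h <;> simp [seedPos] at h ⊢ <;> exact h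

theorem subPos_injective (i : Fin p.d) : Function.Injective (subPos i) := by
  intro x y h
  simpa [subPos] using h

/-- The noise block `[S_{i+1}ᵀ | T_{i+1}]`. -/
def noise (σ : p.MaskIdx → Bool) (ρ : p.RandIdx → R) (i : ℕ) :
    Matrix (Fin (p.dim i)) (Fin (2 * p.dim 0)) R :=
  if h : i < p.d then pack (rS p σ ρ ⟨i, h⟩) (rT p σ ρ ⟨i, h⟩) else 0

theorem noise_apply (σ : p.MaskIdx → Bool) (ρ : p.RandIdx → R) (i : Fin p.d) (r c) :
    noise σ ρ i r c = if σ (maskPos i (packIdx _ _ (r, c))) = true then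
      ρ (noisePos i (packIdx _ _ (r, c))) else 0 := by
  simp only [noise, i.isLt, dif_pos, pack, Matrix.of_apply]
  generalize packIdx _ _ (r, c) = y
  rcases y with y | y <;> rfl

theorem subProd_congr {L L' : p.LIdx → R} {k : ℕ} (hk : k ≤ p.d)
    (h : ∀ x : p.LIdx, (x.1 : ℕ) < k → L x = L' x) : subProd p L k = subProd p L' k := by
  induction k with
  | zero => rfl
  | succ k ih =>
    rw [subProd_succ p L hk, subProd_succ p L' hk, ih (by omega) fun x hx => h x (by omega)]
    congr 1
    ext r c
    exact h ⟨⟨k, hk⟩, (r, c)⟩ (Nat.lt_succ_self k)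

/-- The message in the `k`-th hybrid, in which `[A'ᵀ | B'] = P_k V + ∑_{i < k} P_i N_{i+1}` for a
uniformly random matrix `V`. -/
def hybridMsg (σ : p.MaskIdx → Bool) (ρ : p.RandIdx → R) (k : ℕ)
    (V : Matrix (Fin (p.dim k)) (Fin (2 * p.dim 0)) R) :
    Matrix (Fin (p.dim 0)) (Fin (2 * p.dim 0)) R :=
  subProd p (rL p ρ) k * V + ∑ i ∈ Finset.range k, subProd p (rL p ρ) i * noise σ ρ i

/-- The probability that the distinguisher outputs `1` in the `k`-th hybrid, for inputs
`[Aᵀ | B] = W`. -/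
def hybridProb (enc : R ≃ Fin (Fintype.card R)) (adv : Adversary R p)
    (W : Matrix (Fin (p.dim 0)) (Fin (2 * p.dim 0)) R) (k : ℕ) : ℝ :=
  prodAvg (bitW (Sum.elim (fun x : p.SIdx => p.rate x.1) (fun x : p.TIdx => p.rate x.1))) fun σ =>
    prodAvg (unifW R p.RandIdx) fun ρ =>
      prodAvg (unifW R (Fin (p.dim k) × Fin (2 * p.dim 0))) fun v =>
        ind (idealView enc adv (rL p ρ) (rX2 p ρ) (W + hybridMsg σ ρ k (unflat v)))

/-- In the first hybrid the message is a one-time pad. -/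
theorem hybridProb_zero (enc : R ≃ Fin (Fintype.card R)) (adv : Adversary R p)
    (W W' : Matrix (Fin (p.dim 0)) (Fin (2 * p.dim 0)) R) :
    hybridProb enc adv W 0 = hybridProb enc adv W' 0 := by
  suffices H : ∀ W, hybridProb enc adv W 0 = hybridProb enc adv 0 0 from (H W).trans (H W').symm
  intro W
  refine prodAvg_congr (fun σ => prodAvg_congr (fun ρ => ?_))
  refine Eq.trans (prodAvg_congr (fun v => ?_)) (prodAvg_unifW_add (flat W) _)
  congr 2
  simp only [hybridMsg, subProd_zero, Matrix.one_mul, Finset.range_zero, Finset.sum_empty]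
  ext r c
  simp only [unflat, flat, Matrix.add_apply, Matrix.of_apply, Pi.add_apply, Matrix.zero_apply]
  ring

/-- Consecutive hybrids differ by one LPN sample: `P_{k+1} V + P_k N_{k+1} = P_k (L_{k+1} V +
N_{k+1})`. -/
theorem abs_hybridProb_sub_le {enc : R ≃ Fin (Fintype.card R)} {adv : Adversary R p}
    (hr : p.RatesOk) (W : Matrix (Fin (p.dim 0)) (Fin (2 * p.dim 0)) R) (k : Fin p.d) {N T : ℕ}
    {μ bits : ℝ} (hN : p.dim k ≤ N) (h0 : 0 ≤ μ) (hμ : μ ≤ p.rate k)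
    (h : LPNSecure enc N (p.dim (k + 1)) (2 * p.dim 0) μ T bits)
    (hT : ∀ (σ : p.MaskIdx → Bool) (ρ : p.RandIdx → R) (z : Fin (p.dim k) × Fin (2 * p.dim 0) → R),
      ∃ f : (LPNIdx (p.dim k) (p.dim (k + 1)) (2 * p.dim 0) → R) → R,
        CompOne (TestOp.eval enc) (fun x => x) f T ∧ ∀ x, f x = 1 ↔
          idealView enc adv (rL p (Function.extend (subPos k) (fun y => x (.inl y)) ρ)) (rX2 p ρ)
            (W + hybridMsg σ ρ k (unflat (fun y => x (.inr y)) + unflat z))) :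
    |hybridProb enc adv W (k + 1) - hybridProb enc adv W k| ≤ (2 : ℝ) ^ (-bits) := by
  let jσ : Fin (p.dim k) × Fin (2 * p.dim 0) → p.MaskIdx := fun x => maskPos k (packIdx _ _ x)
  let jρ : Fin (p.dim k) × Fin (2 * p.dim 0) → p.RandIdx := fun x => noisePos k (packIdx _ _ x)
  have hjσ : Function.Injective jσ := (maskPos_injective k).comp packIdx_injective
  have hjρ : Function.Injective jρ := (noisePos_injective k).comp packIdx_injective
  have hne : ∀ x y, jρ x ≠ subPos k y := by
    intro x y
    simp only [jρ]
    rcases packIdx _ _ x with z | z <;> simp [noisePos, subPos]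
  let g : (p.MaskIdx → Bool) → (p.RandIdx → R) → (Fin (p.dim k) × Fin (p.dim (k + 1)) → R) →
      Matrix (Fin (p.dim k)) (Fin (2 * p.dim 0)) R → Prop := fun σ ρ l V =>
    idealView enc adv (rL p (Function.extend (subPos k) l ρ)) (rX2 p ρ) (W + hybridMsg σ ρ k V)
  have hX : ∀ l ρ, rX2 p (Function.extend (subPos k) l ρ) = rX2 p (R := R) ρ := fun l ρ =>
    funext fun x => extend_apply_of_forall_ne fun y => by simp [subPos]
  have hX' : ∀ y ρ, rX2 p (Function.extend jρ y ρ) = rX2 p (R := R) ρ := fun y ρ =>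
    funext fun x => extend_apply_of_forall_ne fun x => by
      simp only [jρ]
      rcases packIdx _ _ x with z | z <;> simp [noisePos]
  have hL' : ∀ y ρ, rL p (Function.extend jρ y ρ) = rL p (R := R) ρ := fun y ρ =>
    funext fun x => extend_apply_of_forall_ne fun x => by
      simp only [jρ]
      rcases packIdx _ _ x with z | z <;> simp [noisePos]
  have hP : ∀ (l : _ → R) ρ i, i ≤ (k : ℕ) →
      subProd p (rL p (Function.extend (subPos k) l ρ)) i = subProd p (rL p ρ) i := by
    intro l ρ i hi
    refine subProd_congr (by omega) fun x hx => extend_apply_of_forall_ne fun y hy => ?_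
    simp only [subPos, Sum.inl.injEq] at hy
    rw [← hy] at hx
    exact absurd hx (by simp only; omega)
  have hB : ∀ (l : _ → R) ρ, blkL p (rL p (Function.extend (subPos k) l ρ)) k k.isLt = unflat l := by
    intro l ρ
    ext r c
    exact (subPos_injective k).extend_apply l ρ (r, c)
  -- noise outside of the `k`-th block is not affected by what is drawn again
  have hNl : ∀ σ (l : _ → R) ρ (i : Fin p.d),
      noise σ (Function.extend (subPos k) l ρ) i = noise σ ρ i := by
    intro σ l ρ i
    ext r c
    rw [noise_apply, noise_apply, extend_apply_of_forall_ne fun y => ?_]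
    rcases packIdx _ _ (r, c) with z | z <;> simp [noisePos, subPos]
  have hNi : ∀ s σ y (ρ : _ → R) (i : Fin p.d), (i : ℕ) < k →
      noise (Function.extend jσ s σ) (Function.extend jρ y ρ) i = noise σ ρ i := by
    intro s σ y ρ i hi
    ext r c
    have hik : k ≠ i := fun h => by rw [h] at hi; exact lt_irrefl _ hi
    rw [noise_apply, noise_apply, extend_apply_of_forall_ne fun x => ?_,
      extend_apply_of_forall_ne fun x => ?_]
    · simp only [jρ]
      rcases packIdx _ _ x with z | z <;> rcases packIdx _ _ (r, c) with z' | z' <;>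
        simp [noisePos, hik]
    · simp only [jσ]
      rcases packIdx _ _ x with z | z <;> rcases packIdx _ _ (r, c) with z' | z' <;>
        simp [maskPos, hik]
  have hNk : ∀ s σ y (ρ : _ → R),
      noise (Function.extend jσ s σ) (Function.extend jρ y ρ) k = unflat (masked s y) := by
    intro s σ y ρ
    ext r c
    rw [noise_apply]
    change (if Function.extend jσ s σ (jσ (r, c)) = true then
      Function.extend jρ y ρ (jρ (r, c)) else 0) = _
    rw [hjσ.extend_apply, hjρ.extend_apply]
    rfl
  have hlow : hybridProb enc adv W k = prodAvg (bitW (Sum.elim (fun x : p.SIdx => p.rate x.1)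
      (fun x : p.TIdx => p.rate x.1))) fun σ => prodAvg (unifW R p.RandIdx) fun ρ =>
        prodAvg (unifW R (Fin (p.dim k) × Fin (p.dim (k + 1)))) fun l =>
        prodAvg (unifW R (Fin (p.dim k) × Fin (2 * p.dim 0))) fun v =>
          ind (g σ ρ l (unflat v)) := by
    refine prodAvg_congr (fun σ => ?_)
    rw [prodAvg_resample isDist_unifW (subPos_injective k)]
    refine prodAvg_congr (fun ρ => prodAvg_congr (fun l => prodAvg_congr (fun v => ?_)))
    simp only [g, hX]
    congr 3
    simp only [hybridMsg]
    rw [hP l ρ k le_rfl]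
    congr 1
    refine Finset.sum_congr rfl fun i hi => ?_
    have hi := Finset.mem_range.1 hi
    rw [hP l ρ i hi.le, hNl σ l ρ ⟨i, by omega⟩]
  have hhigh : hybridProb enc adv W (k + 1) = prodAvg (bitW (Sum.elim (fun x : p.SIdx => p.rate x.1)
      (fun x : p.TIdx => p.rate x.1))) fun σ => prodAvg (unifW R p.RandIdx) fun ρ =>
        prodAvg (bitW fun _ : Fin (p.dim k) × Fin (2 * p.dim 0) => p.rate k) fun s =>
        prodAvg (unifW R (Fin (p.dim k) × Fin (p.dim (k + 1)))) fun l =>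
        prodAvg (unifW R (Fin (p.dim k) × Fin (2 * p.dim 0))) fun y =>
        prodAvg (unifW R (Fin (p.dim (k + 1)) × Fin (2 * p.dim 0))) fun v =>
          ind (g σ ρ l (unflat l * unflat v + unflat (masked s y))) := by
    rw [hybridProb, prodAvg_resample hr.isDist hjσ]
    refine prodAvg_congr (fun σ => ?_)
    have hw : (fun x => bitW (Sum.elim (fun x : p.SIdx => p.rate x.1)
        (fun x : p.TIdx => p.rate x.1)) (jσ x)) =
        bitW fun _ : Fin (p.dim k) × Fin (2 * p.dim 0) => p.rate k := by
      funext x b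
      simp only [jσ, bitW]
      rcases packIdx _ _ x with z | z <;> simp [maskPos]
    rw [hw]
    refine Eq.trans (prodAvg_congr fun s => ?_) (prodAvg_comm _ _)
    rw [prodAvg_resample isDist_unifW hjρ, prodAvg_resample isDist_unifW (subPos_injective k)]
    refine prodAvg_congr (fun ρ => prodAvg_congr (fun l => prodAvg_congr (fun y =>
      prodAvg_congr (fun v => ?_))))
    simp only [g, hX, hX', hL']
    congr 3
    simp only [hybridMsg, hL']
    rw [Finset.sum_range_succ, hNk, subProd_succ p _ k.isLt, hB, hP l ρ k le_rfl, Matrix.mul_assoc,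
      Matrix.mul_add]
    have : ∑ i ∈ Finset.range (k : ℕ), subProd p (rL p (Function.extend (subPos k) l ρ)) i *
        noise (Function.extend jσ s σ) (Function.extend jρ y (Function.extend (subPos k) l ρ)) i =
        ∑ i ∈ Finset.range (k : ℕ), subProd p (rL p ρ) i * noise σ ρ i := by
      refine Finset.sum_congr rfl fun i hi => ?_
      have hi := Finset.mem_range.1 hi
      rw [hP l ρ i hi.le, hNi s σ y _ ⟨i, by omega⟩ hi, hNl σ l ρ ⟨i, by omega⟩]
    rw [this]
    abel
  rw [hlow, hhigh]
  refine abs_prodAvg_sub_le hr.isDist fun σ => abs_prodAvg_sub_le isDist_unifW fun ρ => ?_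
  exact abs_sub_le_of_lpnSecure hN h0 hμ (hr k k.isLt).2 h
    (fun l V => g σ ρ (flat l) V) (hT σ ρ)

end Hybrids

/-! ### Zero-knowledge from the hybrids -/

section ZeroKnowledge

variable {R : Type u} [CommRing R] [Fintype R] [DecidableEq R] {p : Params}

/-- The distinguisher between consecutive hybrids, as a circuit: everything but the LPN sample is
a constant. -/
theorem exists_compOne_idealView (enc : R ≃ Fin (Fintype.card R)) (adv : Adversary R p)
    (hp : ∀ i ≤ p.d, 1 ≤ p.dim i) (hp' : ∀ i ≤ p.d, p.dim i ≤ p.dim 0)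
    {h₁ : ℕ} (hh : ∀ {W : Type} (e : (p.LIdx → R) → W → R), (∀ v, IsWire e fun L => L v) →
      Comp (fun f : Empty => f.elim) e (fun L => honest1 p L) h₁)
    (W : Matrix (Fin (p.dim 0)) (Fin (2 * p.dim 0)) R) (k : Fin p.d)
    (σ : p.MaskIdx → Bool) (ρ : p.RandIdx → R) (z : Fin (p.dim k) × Fin (2 * p.dim 0) → R) :
    ∃ f : (LPNIdx (p.dim k) (p.dim (k + 1)) (2 * p.dim 0) → R) → R,
      CompOne (TestOp.eval enc) (fun x => x) f (adv.size + h₁ +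
        (4 * (p.total * p.total * p.total) + 11 * (p.total * p.total) +
          13 * (p.total * p.checks * p.total) + 7)) ∧ ∀ x, f x = 1 ↔
        idealView enc adv (rL p (Function.extend (subPos k) (fun y => x (.inl y)) ρ)) (rX2 p ρ)
          (W + hybridMsg σ ρ k (unflat (fun y => x (.inr y)) + unflat z)) := by
  let X := LPNIdx (p.dim k) (p.dim (k + 1)) (2 * p.dim 0) → R
  let P := subProd p (rL p ρ) k
  let M := W + hybridMsg σ ρ k (unflat z)
  let L : X → p.LIdx → R := fun x => rL p (Function.extend (subPos k) (fun y => x (.inl y)) ρ)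
  let V : X → Matrix (Fin (p.dim k)) (Fin (2 * p.dim 0)) R := fun x => unflat fun y => x (.inr y)
  let c : X → p.LIdx ⊕ p.XIdx ⊕ (Fin (p.dim 0) × Fin (p.dim k)) ⊕
      (Fin (p.dim 0) × Fin (2 * p.dim 0)) → R := fun _ =>
    Sum.elim (rL p ρ) (Sum.elim (rX2 p ρ) (Sum.elim (flat P) (flat M)))
  have hc := Comp.pi (sem := TestOp.eval enc) (e := fun x : X => x) (F := c) (s := fun _ => 1)
    fun i => CompOne.const _
  let e₁ : X → _ → R := fun x => Sum.elim x (c x)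
  let Z : X → Fin (p.dim 0) × Fin (2 * p.dim 0) → R := fun x y => M y.1 y.2 + (P * V x) y.1 y.2
  have hZ : Comp (TestOp.eval enc) e₁ Z _ := Comp.pi fun y =>
    (IsWire.comp (e := e₁) (f := fun _ => M y.1 y.2)
      ⟨.inr (.inr (.inr (.inr y))), fun _ => rfl⟩).add
    (CompOne.dot Finset.univ (f := fun j (_ : X) => P y.1 j) (g := fun j x => V x j y.2)
      (fun j _ => ⟨.inr (.inr (.inr (.inl (y.1, j)))), fun _ => rfl⟩)
      (fun j _ => ⟨.inl (.inr (j, y.2)), fun _ => rfl⟩))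
  let e₂ : X → _ → R := fun x => Sum.elim (e₁ x) (Z x)
  have hL : ∀ v, IsWire e₂ fun x => L x v := by
    rintro ⟨i, y⟩
    by_cases hi : i = k
    · subst hi
      exact ⟨.inl (.inl (.inl y)), fun x => (subPos_injective i).extend_apply _ ρ y⟩
    · refine ⟨.inl (.inr (.inl ⟨i, y⟩)), fun x => extend_apply_of_forall_ne fun y' h => hi ?_⟩
      simp only [subPos, Sum.inl.injEq] at h
      exact (congrArg Sigma.fst h).symm
  obtain ⟨f, hf, hfv⟩ := CompOne.idealView (e := e₂) (enc := enc) adv hp hp' hh (L := L)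
    (Y := fun _ => rX2 p ρ) (Z := fun x => unflat (Z x)) hL
    (fun v => ⟨.inl (.inr (.inr (.inl v))), fun _ => rfl⟩)
    (fun r c => ⟨.inr (r, c), fun _ => rfl⟩)
  refine ⟨f, (hc.bind (hZ.bind hf)).mono ?_, fun x => (hfv x).trans ?_⟩
  · have b1 := dim_zero_le_total p
    have b2 := (hp' k k.isLt.le).trans b1
    obtain ⟨b3, -, -, -, -, -, b4, -, -⟩ := card_randIdx_add_le hp hp'
    have b5 : p.dim 0 * p.dim k ≤ p.total * p.total := Nat.mul_le_mul b1 b2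
    have b6 : p.dim 0 * p.dim 0 ≤ p.total * p.total := Nat.mul_le_mul b1 b1
    have b7 : p.dim 0 * p.dim 0 * p.dim k ≤ p.total * p.total * p.total := Nat.mul_le_mul b6 b2
    simp only [Finset.sum_const, Finset.card_univ, Fintype.card_sum, Fintype.card_prod,
      Fintype.card_fin, smul_eq_mul] at b3 b4 ⊢
    have b8 : p.dim 0 * (2 * p.dim 0) * (0 + (2 * p.dim k + 1) + 1) =
        4 * (p.dim 0 * p.dim 0 * p.dim k) + 4 * (p.dim 0 * p.dim 0) := by ring
    have b9 : p.dim 0 * (2 * p.dim 0) = 2 * (p.dim 0 * p.dim 0) := by ring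
    rw [b8, b9]
    omega
  · have : unflat (Z x) = W + hybridMsg σ ρ k (unflat (fun y => x (.inr y)) + unflat z) := by
      change M + P * V x = _
      simp only [M, P, V, hybridMsg, Matrix.mul_add]
      abel
    rw [this]

/-- Up to the probability that a wrong first reply passes the tests, the view is the last
hybrid. -/
theorem abs_viewProb_sub_hybridProb_le (enc : R ≃ Fin (Fintype.card R)) (adv : Adversary R p)
    (hr : p.RatesOk) (A B : Matrix (Fin (p.dim 0)) (Fin (p.dim 0)) R) :
    |viewProb enc adv A B - hybridProb enc adv (pack A B) p.d| ≤ (2 : ℝ) ^ (-(p.checks : ℝ)) := by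
  classical
  let j : Fin (p.dim p.d) × Fin (2 * p.dim 0) → p.RandIdx := fun x => seedPos (packIdx _ _ x)
  have hj : Function.Injective j := seedPos_injective.comp packIdx_injective
  let J : (p.MaskIdx → Bool) → (p.RandIdx → R) → ℝ := fun σ ρ =>
    ind (idealView enc adv (rL p ρ) (rX2 p ρ)
      (pack A B + hybridMsg σ ρ p.d (pack (rH p ρ) (rG p ρ))))
  have hne : ∀ (v : _ → R) ρ i, (∀ y, seedPos y ≠ i) → Function.extend j v ρ i = ρ i :=
    fun v ρ i h => extend_apply_of_forall_ne fun x => h _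
  have hJ : hybridProb enc adv (pack A B) p.d = prodAvg (bitW (Sum.elim
      (fun x : p.SIdx => p.rate x.1) (fun x : p.TIdx => p.rate x.1))) fun σ =>
        prodAvg (unifW R p.RandIdx) (J σ) := by
    refine prodAvg_congr fun σ => ?_
    refine Eq.trans ?_ (prodAvg_resample isDist_unifW hj (J σ)).symm
    refine prodAvg_congr fun ρ => prodAvg_congr fun v => ?_
    have h1 : rL p (Function.extend j v ρ) = rL p ρ := funext fun x =>
      hne v ρ _ fun y => by rcases y with y | y <;> simp [seedPos]
    have h2 : rX2 p (Function.extend j v ρ) = rX2 p ρ := funext fun x =>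
      hne v ρ _ fun y => by rcases y with y | y <;> simp [seedPos]
    have h3 : pack (rH p (Function.extend j v ρ)) (rG p (Function.extend j v ρ)) = unflat v := by
      ext r c
      refine Eq.trans ?_ (hj.extend_apply v ρ (r, c))
      simp only [pack, Matrix.of_apply, j]
      generalize packIdx _ _ (r, c) = y
      rcases y with y | y <;> rfl
    have h4 : ∀ i : Fin p.d, noise σ (Function.extend j v ρ) i = noise σ ρ i := fun i => by
      ext r c
      rw [noise_apply, noise_apply, hne v ρ _ fun y => ?_]
      rcases packIdx _ _ (r, c) with z | z <;> rcases y with y | y <;> simp [noisePos, seedPos]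
    simp only [J, h1, h2, h3, hybridMsg]
    rw [Finset.sum_congr rfl fun i hi => congrArg (subProd p (rL p ρ) i * ·)
      (h4 ⟨i, Finset.mem_range.1 hi⟩).symm]
  rw [hJ, viewProb, clientAvg_eq]
  refine abs_prodAvg_sub_le hr.isDist fun σ => le_trans (abs_prodAvg_sub_le_prodAvg isDist_unifW
    fun ρ => ?_) ((unifAvg_eq _).symm.trans_le
      (unifAvg_check1_le p fun L => AdvCircuit.run enc adv.reply1 L))
  dsimp only [J, idealView]
  by_cases h : AdvCircuit.run enc adv.reply1 (rL p ρ) = honest1 p (rL p ρ)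
  · have hsum : ∀ i : Fin p.d, prodL p (honest1 p (rL p ρ)) i = subProd p (rL p ρ) i := fun i =>
      prodL_honest1 p _ i.isLt.le
    have hA : leftHalf (pack A B + hybridMsg σ ρ p.d (pack (rH p ρ) (rG p ρ))) =
        encA p σ ρ (honest1 p (rL p ρ)) A := by
      simp only [hybridMsg, leftHalf_add, leftHalf_sum, leftHalf_mul, leftHalf_pack, encA, maskA,
        hsum, prodL_honest1 p _ le_rfl]
      rw [Finset.sum_range]
      congr 2
      refine Finset.sum_congr rfl fun i _ => ?_
      rw [noise, dif_pos i.isLt, leftHalf_pack]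
    have hB : rightHalf (pack A B + hybridMsg σ ρ p.d (pack (rH p ρ) (rG p ρ))) =
        encB p σ ρ (honest1 p (rL p ρ)) B := by
      simp only [hybridMsg, rightHalf_add, rightHalf_sum, rightHalf_mul, rightHalf_pack, encB,
        maskB, hsum, prodL_honest1 p _ le_rfl]
      rw [Finset.sum_range]
      congr 2
      refine Finset.sum_congr rfl fun i _ => ?_
      rw [noise, dif_pos i.isLt, rightHalf_pack]
    rw [h, if_pos (check1_honest1 p ρ), hA, hB, if_pos rfl]
    refine le_of_eq_of_le (abs_eq_zero.2 (sub_eq_zero.2 ?_)) (ind_nonneg _)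
    congr!
  · rw [if_neg h]
    by_cases h' : Check1 p ρ (AdvCircuit.run enc adv.reply1 (rL p ρ))
    · rw [ind_of_true (P := _ ∧ _) ⟨h', h⟩, if_pos h', abs_sub_le_iff]
      constructor <;> linarith [ind_nonneg (AdvCircuit.run enc adv.distAbort (rL p ρ) () = 1),
        ind_le_one (AdvCircuit.run enc adv.distAbort (rL p ρ) () = 1),
        ind_nonneg (AdvCircuit.run enc adv.dist (Sum.elim (message p (rL p ρ)
          (encA p σ ρ (AdvCircuit.run enc adv.reply1 (rL p ρ)) A)
          (encB p σ ρ (AdvCircuit.run enc adv.reply1 (rL p ρ)) B)) fun _ =>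
            if Check2 p ρ (encA p σ ρ (AdvCircuit.run enc adv.reply1 (rL p ρ)) A)
              (AdvCircuit.run enc adv.reply2 (message p (rL p ρ)
                (encA p σ ρ (AdvCircuit.run enc adv.reply1 (rL p ρ)) A)
                (encB p σ ρ (AdvCircuit.run enc adv.reply1 (rL p ρ)) B))) then 1 else 0) () = 1),
        ind_le_one (AdvCircuit.run enc adv.dist (Sum.elim (message p (rL p ρ)
          (encA p σ ρ (AdvCircuit.run enc adv.reply1 (rL p ρ)) A)
          (encB p σ ρ (AdvCircuit.run enc adv.reply1 (rL p ρ)) B)) fun _ =>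
            if Check2 p ρ (encA p σ ρ (AdvCircuit.run enc adv.reply1 (rL p ρ)) A)
              (AdvCircuit.run enc adv.reply2 (message p (rL p ρ)
                (encA p σ ρ (AdvCircuit.run enc adv.reply1 (rL p ρ)) A)
                (encB p σ ρ (AdvCircuit.run enc adv.reply1 (rL p ρ)) B))) then 1 else 0) () = 1)]
    · rw [if_neg h', sub_self, abs_zero]
      exact ind_nonneg _

/-- The views for both inputs differ by at most two wrong replies that pass the tests, and by `d`
hybrid steps each from the first hybrid, which does not depend on the inputs. -/
theorem isCZK {enc : R ≃ Fin (Fintype.card R)} {t T : ℕ} {sec bits : ℝ}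
    (hp : ∀ i ≤ p.d, 1 ≤ p.dim i) (hp' : ∀ i ≤ p.d, p.dim i ≤ p.dim 0) (hr : p.RatesOk)
    {h₁ : ℕ} (hh : ∀ {W : Type} (e : (p.LIdx → R) → W → R), (∀ v, IsWire e fun L => L v) →
      Comp (fun f : Empty => f.elim) e (fun L => honest1 p L) h₁)
    (hT : t + h₁ + (4 * (p.total * p.total * p.total) + 11 * (p.total * p.total) +
      13 * (p.total * p.checks * p.total) + 7) ≤ T)
    (h : ∀ k < p.d, ∃ (N : ℕ) (μ : ℝ), p.dim k ≤ N ∧ 0 ≤ μ ∧ μ ≤ p.rate k ∧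
      LPNSecure enc N (p.dim (k + 1)) (2 * p.dim 0) μ T bits)
    (hsec : 2 * (p.d * (2 : ℝ) ^ (-bits)) + 2 * (2 : ℝ) ^ (-(p.checks : ℝ)) ≤ (2 : ℝ) ^ (-sec)) :
    IsCZK enc p t sec := by
  intro adv hadv A B
  have hstep : ∀ W, ∀ k ≤ p.d, |hybridProb enc adv W k - hybridProb enc adv W 0| ≤
      k * (2 : ℝ) ^ (-bits) := by
    intro W k
    induction k with
    | zero => simp
    | succ k ih =>
      intro hk
      obtain ⟨N, μ, hN, h0, hμ, hlpn⟩ := h k hk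
      have h1 := abs_hybridProb_sub_le (adv := adv) hr W ⟨k, hk⟩ hN h0 hμ hlpn fun σ ρ z => by
        obtain ⟨f, hf, hfv⟩ := exists_compOne_idealView enc adv hp hp' hh W ⟨k, hk⟩ σ ρ z
        exact ⟨f, hf.mono (by omega), hfv⟩
      have h2 := abs_sub_le (hybridProb enc adv W (k + 1)) (hybridProb enc adv W k)
        (hybridProb enc adv W 0)
      push_cast
      linarith [ih (by omega)]
  have h1 := abs_le.1 (hstep (pack A B) p.d le_rfl)
  have h2 := abs_le.1 (hstep (pack 0 0) p.d le_rfl)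
  have h3 := hybridProb_zero enc adv (pack A B) (pack 0 0)
  have h4 := abs_le.1 (abs_viewProb_sub_hybridProb_le enc adv hr A B)
  have h5 := abs_le.1 (abs_viewProb_sub_hybridProb_le enc adv hr 0 0)
  rw [abs_le]
  constructor <;> linarith [h1.1, h1.2, h2.1, h2.2, h4.1, h4.2, h5.1, h5.2]

end ZeroKnowledge

/-! ### The choice of the dimensions -/

/-- The dimensions shrink by the factor `δ` in each level, as far as the security of LPN
permits. The bound `8` on the last dimension leaves room for rounding: before it is reached,
`a i - 1` is halved in each level, `a i ≤ 2 (a i - 1)`, and the number of levels, unless it is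
zero, is smaller than `lg n` by at least two. -/
theorem exists_dims {δ : ℝ} (hδ0 : 0 < δ) (hδ : δ < 1 / 2) {n ι : ℕ} (hι : 1 ≤ ι)
    (hn : (ι : ℝ) ≤ δ * n) :
    ∃ (d : ℕ) (a : ℕ → ℕ), a 0 = n ∧ (∀ i ≤ d, 1 ≤ a i ∧ a i ≤ n) ∧
      (∀ i < d, a (i + 1) ≤ a i ∧ ι ≤ a (i + 1) ∧ (a (i + 1) : ℝ) ≤ 2 * (δ * n) ∧
        δ * a i ≤ a (i + 1)) ∧
      (∀ i < d, 2 ^ i * a i ≤ 2 * n) ∧ a d ≤ ι + 8 ∧ (d = 0 ∨ 2 ^ (d + 2) ≤ n) := by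
  have hι' : (1 : ℝ) ≤ ι := by exact_mod_cast hι
  let f : ℕ → ℕ := fun m => max ⌈δ * m⌉₊ ι
  let a : ℕ → ℕ := fun i => f^[i] n
  have ha : ∀ i, a (i + 1) = max ⌈δ * a i⌉₊ ι := fun i => Function.iterate_succ_apply' f i n
  have hhalf : ∀ m : ℕ, ⌈δ * m⌉₊ ≤ (m + 1) / 2 := fun m => by
    rw [Nat.ceil_le]
    have h1 : m ≤ 2 * ((m + 1) / 2) := by omega
    have h2 : (m : ℝ) ≤ 2 * ((m + 1) / 2 : ℕ) := by exact_mod_cast h1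
    nlinarith [(Nat.cast_nonneg m : (0 : ℝ) ≤ m)]
  have hn1 : ι ≤ n := by
    have : (ι : ℝ) ≤ n := by nlinarith [(Nat.cast_nonneg n : (0 : ℝ) ≤ n)]
    exact_mod_cast this
  have han : ∀ i, 1 ≤ a i ∧ a i ≤ n := by
    intro i
    induction i with
    | zero => exact ⟨hι.trans hn1, le_rfl⟩
    | succ i ih =>
      rw [ha]
      exact ⟨hι.trans (le_max_right _ _), max_le ((hhalf _).trans (by omega)) hn1⟩
  have hex : ∃ i, a i ≤ max ι 8 := by
    by_contra! h
    have h1 : ∀ i, a i + i ≤ n := by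
      intro i
      induction i with
      | zero => exact le_rfl
      | succ i ih =>
        have h2 := h i
        have h3 := h (i + 1)
        have h4 := hhalf (a i)
        rw [ha] at h3 ⊢
        omega
    have := h1 (n + 1)
    omega
  classical
  let d := Nat.find hex
  have hd : a d ≤ max ι 8 := Nat.find_spec hex
  have hlt : ∀ i < d, max ι 8 < a i := fun i hi => not_le.1 (Nat.find_min hex hi)
  -- before the last level, the maximum with `ι` has no effect
  have hgeom : ∀ i < d, 2 ^ i * (a i - 1) ≤ n - 1 := by
    intro i
    induction i with
    | zero => intro _; simp [a]
    | succ i ih =>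
      intro hi
      have h1 := hlt (i + 1) hi
      have h2 := hhalf (a i)
      have h3 : 2 * (a (i + 1) - 1) ≤ a i - 1 := by
        rw [ha] at h1 ⊢
        omega
      calc 2 ^ (i + 1) * (a (i + 1) - 1) = 2 ^ i * (2 * (a (i + 1) - 1)) := by ring
        _ ≤ 2 ^ i * (a i - 1) := Nat.mul_le_mul_left _ h3
        _ ≤ n - 1 := ih (by omega)
  refine ⟨d, a, rfl, fun i _ => han i, fun i hi => ⟨?_, ?_, ?_, ?_⟩, fun i hi => ?_, ?_, ?_⟩
  · have h1 := hlt i hi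
    have h2 := hhalf (a i)
    rw [ha]
    omega
  · rw [ha]
    exact le_max_right _ _
  · rw [ha, Nat.cast_max]
    refine max_le ?_ (by linarith)
    have h1 : (a i : ℝ) ≤ n := by exact_mod_cast (han i).2
    have h2 := (Nat.ceil_lt_add_one (mul_nonneg hδ0.le (Nat.cast_nonneg (a i)))).le
    nlinarith
  · rw [ha, Nat.cast_max]
    exact (Nat.le_ceil _).trans (le_max_left _ _)
  · -- `a i ≤ 2 (a i - 1)`, as `a i` exceeds `8`
    have h1 := hgeom i hi
    have h2 := hlt i hi
    have h3 : 2 ^ i * a i ≤ 2 ^ i * (2 * (a i - 1)) := Nat.mul_le_mul_left _ (by omega)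
    have h4 : 2 ^ i * (2 * (a i - 1)) = 2 * (2 ^ i * (a i - 1)) := by ring
    omega
  · omega
  · rcases Nat.eq_zero_or_pos d with h | h
    · exact .inl h
    · right
      have h1 := hgeom (d - 1) (by omega)
      have h2 := hlt (d - 1) (by omega)
      have h3 : 2 ^ (d - 1) * 8 ≤ 2 ^ (d - 1) * (a (d - 1) - 1) := Nat.mul_le_mul_left _ (by omega)
      have h4 : 2 ^ (d + 2) = 2 ^ (d - 1) * 8 := by
        rw [show d + 2 = d - 1 + 3 by omega, pow_add]; norm_num
      omega

theorem sum_pow_half_le {r : ℝ} (h0 : 0 ≤ r) (h1 : r < 1) (d : ℕ) :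
    ∑ i ∈ Finset.range d, r ^ i ≤ (1 - r)⁻¹ := by
  rw [← tsum_geometric_of_lt_one h0 h1]
  exact (summable_geometric_of_lt_one h0 h1).sum_le_tsum _ fun i _ => pow_nonneg h0 i

section Sums

variable {n d : ℕ} {a : ℕ → ℕ}

theorem sum_dims_rpow_le {s : ℝ} (hs : 0 < s) (h : ∀ i < d, 2 ^ i * a i ≤ 2 * n) :
    ∑ i ∈ Finset.range d, (a i : ℝ) ^ s ≤ (1 - 2 ^ (-s))⁻¹ * (2 * n) ^ s := by
  have h2 : (2 : ℝ) ^ (-s) < 1 := Real.rpow_lt_one_of_one_lt_of_neg (by norm_num) (by linarith)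
  have h0 : (0 : ℝ) ≤ (2 : ℝ) ^ (-s) := by positivity
  refine le_trans ?_ (mul_le_mul_of_nonneg_right (sum_pow_half_le h0 h2 d)
    (by positivity : (0 : ℝ) ≤ (2 * n) ^ s))
  rw [Finset.sum_mul]
  refine Finset.sum_le_sum fun i hi => ?_
  have h3 : ((2 : ℝ) ^ i * a i) ≤ 2 * n := by exact_mod_cast h i (Finset.mem_range.1 hi)
  have h4 := Real.rpow_le_rpow (by positivity) h3 hs.le
  rw [Real.mul_rpow (by positivity) (by positivity)] at h4
  have h5 : ((2 : ℝ) ^ (-s)) ^ i * ((2 : ℝ) ^ i) ^ s = 1 := by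
    rw [← Real.rpow_natCast, ← Real.rpow_natCast, ← Real.rpow_mul (by norm_num),
      ← Real.rpow_mul (by norm_num), ← Real.rpow_add (by norm_num)]
    ring_nf
    exact Real.rpow_zero 2
  calc (a i : ℝ) ^ s = ((2 : ℝ) ^ (-s)) ^ i * (((2 : ℝ) ^ i) ^ s * (a i : ℝ) ^ s) := by
        rw [← mul_assoc, h5, one_mul]
    _ ≤ _ := mul_le_mul_of_nonneg_left h4 (by positivity)

theorem sum_dims_le (h : ∀ i < d, 2 ^ i * a i ≤ 2 * n) (hd : a d ≤ n) :
    ∑ i ∈ Finset.range (d + 1), a i ≤ 5 * n := by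
  have h1 := sum_dims_rpow_le (s := 1) one_pos h
  have h2 : (2 : ℝ) ^ (-1 : ℝ) = 2⁻¹ := Real.rpow_neg_one 2
  simp only [Real.rpow_one, h2] at h1
  rw [Finset.sum_range_succ]
  have h3 : ((∑ i ∈ Finset.range d, a i : ℕ) : ℝ) ≤ (4 * n : ℕ) := by
    push_cast
    refine h1.trans (le_of_eq ?_)
    ring
  have h4 : ∑ i ∈ Finset.range d, a i ≤ 4 * n := by exact_mod_cast h3
  omega

end Sums

/-! ### The level of security that learning parity with noise can have -/

section Security

variable {R : Type u} [CommRing R] [Fintype R] [DecidableEq R]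

/-- The set that defines the threshold is not empty, as it contains `n + 1`. -/
theorem lpnThreshold_spec (enc : R ≃ Fin (Fintype.card R)) (δ ε sec : ℝ) (n T : ℕ) :
    0 < lpnThreshold enc δ ε sec n T ∧ ∀ κ : ℕ, lpnThreshold enc δ ε sec n T ≤ κ → κ ≤ n →
      LPNSecure enc ⌊(κ : ℝ) / δ⌋₊ κ (2 * n) (((κ : ℝ) / δ) ^ (ε - 1)) T
        (sec + Real.logb 2 (Real.logb 2 n) + 1) :=
  Nat.sInf_mem (s := {ι | 0 < ι ∧ ∀ κ : ℕ, ι ≤ κ → κ ≤ n →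
    LPNSecure enc ⌊(κ : ℝ) / δ⌋₊ κ (2 * n) (((κ : ℝ) / δ) ^ (ε - 1)) T
      (sec + Real.logb 2 (Real.logb 2 n) + 1)}) ⟨n + 1, n.succ_pos, fun κ h h' => by omega⟩

/-- With this many bits of security, the generic attack is excluded. In particular, the security
level is at most of the order of the expected number of errors in `n` noisy positions. -/
theorem le_of_lpnSecure_self [Nontrivial R] {enc : R ≃ Fin (Fintype.card R)} {δ ε bits : ℝ}
    {n T : ℕ} (hδ0 : 0 < δ) (hδ : δ < 1 / 2) (hε1 : ε < 1) (hn : 3 ≤ n)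
    (hT : 102 * (n + 2) ^ 3 ≤ T)
    (h : LPNSecure enc ⌊(n : ℝ) / δ⌋₊ n (2 * n) (((n : ℝ) / δ) ^ (ε - 1)) T bits) :
    bits ≤ 1 + 2 / ((1 - 6 ^ (ε - 1)) * Real.log 2) * (n : ℝ) ^ ε := by
  have hn' : (3 : ℝ) ≤ n := by exact_mod_cast hn
  have h2 : 2 * (n : ℝ) ≤ n / δ := by
    rw [le_div_iff₀ hδ0]; nlinarith
  set μ := ((n : ℝ) / δ) ^ (ε - 1) with hμ
  have h6 : (6 : ℝ) ^ (ε - 1) < 1 := Real.rpow_lt_one_of_one_lt_of_neg (by norm_num) (by linarith)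
  have hμ6 : μ ≤ 6 ^ (ε - 1) :=
    Real.rpow_le_rpow_of_nonpos (by norm_num) (by linarith) (by linarith)
  have hμn : μ ≤ (n : ℝ) ^ (ε - 1) :=
    Real.rpow_le_rpow_of_nonpos (by linarith) (by linarith) (by linarith)
  have hμ0 : 0 ≤ μ := by positivity
  have hN : n + 1 ≤ ⌊(n : ℝ) / δ⌋₊ := by
    refine Nat.le_floor ?_
    push_cast
    linarith
  have h3 := le_of_lpnSecure enc hμ0 (by linarith) hN (by omega) hT h
  have h4 : 0 < 1 - μ := by linarith
  have hl2 : 0 < Real.log 2 := Real.log_pos (by norm_num)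
  have h5 := Real.log_le_log (by positivity) h3
  rw [Real.log_div (by positivity) (by norm_num), Real.log_pow, Real.log_rpow (by norm_num)] at h5
  have h7 := Real.one_sub_inv_le_log_of_pos h4
  have h8 : (1 - μ)⁻¹ - 1 ≤ μ / (1 - 6 ^ (ε - 1)) := by
    have : (1 - μ)⁻¹ - 1 = μ / (1 - μ) := by field_simp; ring
    rw [this]
    exact div_le_div_of_nonneg_left hμ0 (by linarith) (by linarith)
  have h9 : (n : ℝ) * μ ≤ (n : ℝ) ^ ε := by
    refine (mul_le_mul_of_nonneg_left hμn (by linarith)).trans (le_of_eq ?_)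
    rw [mul_comm, ← Real.rpow_add_one (by linarith)]
    ring_nf
  have h10 : (bits - 1) * Real.log 2 ≤ 2 * n * (μ / (1 - 6 ^ (ε - 1))) := by
    have h11 : -Real.log (1 - μ) ≤ μ / (1 - 6 ^ (ε - 1)) := by linarith
    have h12 : 0 ≤ μ / (1 - 6 ^ (ε - 1)) := div_nonneg hμ0 (by linarith)
    push_cast at h5
    nlinarith
  have h13 : 2 * n * (μ / (1 - 6 ^ (ε - 1))) = 2 * (n * μ) / (1 - 6 ^ (ε - 1)) := by ring
  have h14 : 2 * (n * μ) / (1 - 6 ^ (ε - 1)) ≤ 2 * (n : ℝ) ^ ε / (1 - 6 ^ (ε - 1)) :=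
    div_le_div_of_nonneg_right (by linarith) (by linarith)
  have h15 : bits - 1 ≤ 2 * (n : ℝ) ^ ε / (1 - 6 ^ (ε - 1)) / Real.log 2 := by
    rw [le_div_iff₀ hl2]
    linarith
  have h16 : 2 * (n : ℝ) ^ ε / (1 - 6 ^ (ε - 1)) / Real.log 2 =
      2 / ((1 - 6 ^ (ε - 1)) * Real.log 2) * (n : ℝ) ^ ε := by
    rw [div_div]; ring
  linarith

theorem logb_two_le_rpow {ε : ℝ} (hε : 0 < ε) {x : ℝ} (hx : 0 ≤ x) :
    Real.logb 2 x ≤ (ε * Real.log 2)⁻¹ * x ^ ε := by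
  have hl2 : 0 < Real.log 2 := Real.log_pos (by norm_num)
  rw [Real.logb, div_le_iff₀ hl2]
  refine (Real.log_le_rpow_div hx hε).trans (le_of_eq ?_)
  field_simp

end Security

/-! ### The choice of the parameters -/

section Parameters

theorem one_lt_logb_two {n : ℕ} (hn : 3 ≤ n) : 1 < Real.logb 2 n := by
  have hn' : (3 : ℝ) ≤ n := by exact_mod_cast hn
  rw [Real.lt_logb_iff_rpow_lt (by norm_num) (by linarith)]
  norm_num
  linarith

theorem add_half_le_logb_two {n d : ℕ} (hn : 3 ≤ n) (hd : d = 0 ∨ 2 ^ (d + 2) ≤ n) :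
    (d : ℝ) + 1 / 2 ≤ Real.logb 2 n := by
  rcases hd with rfl | hd
  · have := one_lt_logb_two hn
    norm_num
    linarith
  · have hn' : (3 : ℝ) ≤ n := by exact_mod_cast hn
    have h1 : (d : ℝ) + 2 ≤ Real.logb 2 n := by
      rw [Real.le_logb_iff_rpow_le (by norm_num) (by linarith)]
      exact_mod_cast hd
    linarith

/-- The security loss of `2 d` hybrid steps and two tests. The term `lg lg n` in the level of
security of LPN pays for the number of levels, which is below `lg n`. -/
theorem security_loss_le {n d c : ℕ} {sec : ℝ} (hn : 3 ≤ n) (hd : d = 0 ∨ 2 ^ (d + 2) ≤ n)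
    (hc : sec + Real.logb 2 (Real.logb 2 n) + 2 ≤ c) :
    2 * (d * (2 : ℝ) ^ (-(sec + Real.logb 2 (Real.logb 2 n) + 1))) +
      2 * (2 : ℝ) ^ (-(c : ℝ)) ≤ (2 : ℝ) ^ (-sec) := by
  have h1 := one_lt_logb_two hn
  have h2 := add_half_le_logb_two hn hd
  set l := Real.logb 2 n
  have hpow : ∀ k : ℝ, (2 : ℝ) ^ (-(sec + Real.logb 2 l + k)) = 2 ^ (-sec) / (l * 2 ^ k) := by
    intro k
    rw [Real.rpow_neg (by norm_num), Real.rpow_add (by norm_num), Real.rpow_add (by norm_num),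
      Real.rpow_logb (by norm_num) (by norm_num) (by linarith), Real.rpow_neg (by norm_num)]
    field_simp
  have h3 : (2 : ℝ) ^ (-(c : ℝ)) ≤ 2 ^ (-sec) / (l * 2 ^ (2 : ℝ)) :=
    (Real.rpow_le_rpow_of_exponent_le (by norm_num) (neg_le_neg hc)).trans_eq (hpow 2)
  rw [hpow 1]
  have hs : (0 : ℝ) < 2 ^ (-sec) := by positivity
  have h4 : 2 * (d * ((2 : ℝ) ^ (-sec) / (l * 2 ^ (1 : ℝ)))) + 2 * (2 ^ (-sec) / (l * 2 ^ (2 : ℝ))) =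
      2 ^ (-sec) * ((d + 1 / 2) / l) := by
    norm_num
    field_simp
    ring
  have h5 : ((d : ℝ) + 1 / 2) / l ≤ 1 := (div_le_one (by linarith)).2 h2
  nlinarith

/-- The number of checks is at most `checkBound ε * n ^ ε`: the generic attack on LPN permits no
higher level of security. -/
def checkBound (ε : ℝ) : ℝ := 2 / ((1 - 6 ^ (ε - 1)) * Real.log 2) + 3

/-- The overhead of the reduction to LPN, and the size of the attack that bounds the number of
checks. -/
def reductionCost (ε ω K : ℝ) : Polynomial ℕ :=
  Polynomial.C ⌈25 * (4 * |K| + 6)⌉₊ * Polynomial.X ^ ⌈ω⌉₊ +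
    Polynomial.C (782 + 325 * ⌈checkBound ε⌉₊) * Polynomial.X ^ 3 +
    Polynomial.C 102 * (Polynomial.X + Polynomial.C 2) ^ 3

theorem eval_reductionCost (ε ω K : ℝ) (n : ℕ) : (reductionCost ε ω K).eval n =
    ⌈25 * (4 * |K| + 6)⌉₊ * n ^ ⌈ω⌉₊ + (782 + 325 * ⌈checkBound ε⌉₊) * n ^ 3 +
      102 * (n + 2) ^ 3 := by
  simp only [reductionCost, Polynomial.eval_add, Polynomial.eval_mul, Polynomial.eval_pow,
    Polynomial.eval_C, Polynomial.eval_X]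

/-- The constant in the bounds on the costs of the client and the server. -/
def costBound (ε ω K : ℝ) : ℝ :=
  1000 * ((ε * Real.log 2)⁻¹ + checkBound ε + 9) + 120 * (1 - 2 ^ (-ε))⁻¹ +
    (12 * |K| + 21) * (25 * 2 ^ (ω - 2))

theorem checkBound_nonneg {ε : ℝ} (hε1 : ε < 1) : 0 ≤ checkBound ε := by
  have h6 : (6 : ℝ) ^ (ε - 1) < 1 := Real.rpow_lt_one_of_one_lt_of_neg (by norm_num) (by linarith)
  have hl2 : 0 < Real.log 2 := Real.log_pos (by norm_num)
  have : 0 ≤ 2 / ((1 - (6 : ℝ) ^ (ε - 1)) * Real.log 2) :=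
    div_nonneg (by norm_num) (mul_nonneg (by linarith) hl2.le)
  rw [checkBound]
  linarith

theorem le_costBound {ε : ℝ} (hε0 : 0 < ε) (hε1 : ε < 1) (ω K : ℝ) :
    1000 * ((ε * Real.log 2)⁻¹ + checkBound ε + 9) + 120 * (1 - 2 ^ (-ε))⁻¹ ≤ costBound ε ω K ∧
      1000 ≤ costBound ε ω K ∧ (12 * |K| + 21) * (25 * 2 ^ (ω - 2)) ≤ costBound ε ω K := by
  have h2 : (2 : ℝ) ^ (-ε) < 1 := Real.rpow_lt_one_of_one_lt_of_neg (by norm_num) (by linarith)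
  have hl2 : 0 < Real.log 2 := Real.log_pos (by norm_num)
  have a1 : 0 ≤ (ε * Real.log 2)⁻¹ := by positivity
  have a2 : 0 ≤ (1 - (2 : ℝ) ^ (-ε))⁻¹ := inv_nonneg.2 (by linarith)
  have a3 : 0 ≤ (12 * |K| + 21) * (25 * (2 : ℝ) ^ (ω - 2)) := by positivity
  have a4 := checkBound_nonneg hε1
  rw [costBound]
  refine ⟨?_, ?_, ?_⟩ <;> linarith

/-- The bound of `clientCostLE` in terms of the problem size, where `N` stands for `n ^ ε`, `s` for
the last dimension, `τ` for the sum of the dimensions and `e` for the expected number of errors in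
a row of noise. -/
theorem client_cost_arith {ε ω K n N ν d s τ c e : ℝ} (hε0 : 0 < ε) (hε1 : ε < 1) (hn : 0 ≤ n)
    (hN : 1 ≤ N) (hτ0 : 0 ≤ τ) (hτ : τ ≤ 5 * n) (hν : 0 ≤ ν) (hs : s ≤ ν + 8) (hd0 : 0 ≤ d)
    (hs0 : 0 ≤ s) (hc0 : 0 ≤ c)
    (hd : d ≤ (ε * Real.log 2)⁻¹ * N) (hc : c ≤ checkBound ε * N)
    (he : e ≤ (1 - 2 ^ (-ε))⁻¹ * (2 * N)) (he0 : 0 ≤ e) :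
    40 * (τ ^ 2 * (s + d + c + 1)) + 12 * (τ * (n * e)) ≤ costBound ε ω K * (n ^ 2 * (N + ν)) := by
  obtain ⟨b1, b2, -⟩ := le_costBound hε0 hε1 ω K
  have h1 : τ ^ 2 ≤ 25 * n ^ 2 := by nlinarith
  have h2 : 40 * (τ ^ 2 * (s + d + c + 1)) ≤ 40 * (25 * n ^ 2 * (s + d + c + 1)) := by
    gcongr
  have h3 : 12 * (τ * (n * e)) ≤ 12 * (5 * n * (n * e)) := by gcongr
  have h4 : 40 * (25 * n ^ 2 * (s + d + c + 1)) + 12 * (5 * n * (n * e)) =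
      n ^ 2 * (1000 * (s + d + c + 1) + 60 * e) := by ring
  have h5 : 1000 * (s + d + c + 1) + 60 * e ≤ costBound ε ω K * (N + ν) := by
    have h6 := mul_le_mul_of_nonneg_right b1 (zero_le_one.trans hN)
    have h7 := mul_le_mul_of_nonneg_right b2 hν
    nlinarith
  have h8 := mul_le_mul_of_nonneg_left h5 (sq_nonneg n)
  calc _ ≤ _ := add_le_add h2 h3
    _ = _ := h4
    _ ≤ _ := h8
    _ = _ := by ring

variable {R : Type u} [CommRing R] [Fintype R] [DecidableEq R]

/-- The protocol is run with dimensions that shrink as far as LPN stays secure, and with one check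
for each bit of security, as a check may catch an error with probability `1 / 2` only. That many
checks are affordable because the generic attack on LPN limits `sec` to the order of `n ^ ε`. -/
theorem exists_params [Nontrivial R] {ε ω K : ℝ} (hε0 : 0 < ε) (hε1 : ε < 1) (hω : 2 ≤ ω)
    (enc : R ≃ Fin (Fintype.card R)) (hK : MatMulBound R K ω) {δ sec : ℝ} {n t : ℕ}
    (hδ0 : 0 < δ) (hδ : δ < 1 / 2) (hsec : 0 < sec)
    (hν : nu enc δ ε sec n (t + (reductionCost ε ω K).eval n) ≤ δ * n) :
    ∃ p : Params, p.dim 0 = n ∧ (∀ i < p.d, p.rate i = (p.dim i : ℝ) ^ (ε - 1)) ∧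
      IsCorrect R p ∧ IsCZK enc p t sec ∧ DetectsDeviation R p sec ∧
      ClientCostLE R p (costBound ε ω K *
        ((n : ℝ) ^ 2 * ((n : ℝ) ^ ε + nu enc δ ε sec n (t + (reductionCost ε ω K).eval n)))) ∧
      ServerCostLE R p (matMulCost R n + costBound ε ω K * (δ ^ (ω - 2) * (n : ℝ) ^ ω)) := by
  set T := t + (reductionCost ε ω K).eval n with hT
  rw [eval_reductionCost] at hT
  set ι := lpnThreshold enc δ ε sec n T with hι
  obtain ⟨hι0, hlpn⟩ := lpnThreshold_spec enc δ ε sec n T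
  rw [← hι] at hι0 hlpn
  have hιν : (ι : ℝ) ≤ nu enc δ ε sec n T := le_max_right _ _
  set ν := nu enc δ ε sec n T
  have hι1 : (1 : ℝ) ≤ ι := by exact_mod_cast hι0
  have hδn : (ι : ℝ) ≤ δ * n := hιν.trans hν
  have hn3 : 3 ≤ n := by
    have h1 : (0 : ℝ) ≤ n := Nat.cast_nonneg n
    have h2 : (2 : ℝ) < n := by nlinarith
    exact_mod_cast h2
  have hn3' : (3 : ℝ) ≤ n := by exact_mod_cast hn3
  have hιn : ι ≤ n := by
    have : (ι : ℝ) ≤ n := by nlinarith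
    exact_mod_cast this
  obtain ⟨d, a, ha0, han, hstep, hgeom, had, hd⟩ := exists_dims hδ0 hδ hι0 hδn
  have hll : 0 < Real.logb 2 (Real.logb 2 n) := Real.logb_pos (by norm_num) (one_lt_logb_two hn3)
  set c : ℕ := ⌈sec + Real.logb 2 (Real.logb 2 n) + 2⌉₊ with hc
  have hcle : sec + Real.logb 2 (Real.logb 2 n) + 2 ≤ c := Nat.le_ceil _
  have hN1 : 1 ≤ (n : ℝ) ^ ε := Real.one_le_rpow (by linarith) hε0.le
  -- the only place where the LPN assumption is used at the top dimension `κ = n`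
  have hcN : (c : ℝ) ≤ checkBound ε * (n : ℝ) ^ ε := by
    have h1 := le_of_lpnSecure_self hδ0 hδ hε1 hn3 (by rw [hT]; omega) (hlpn n hιn le_rfl)
    have h2 := (Nat.ceil_lt_add_one
      (by linarith : 0 ≤ sec + Real.logb 2 (Real.logb 2 n) + 2)).le
    rw [checkBound]
    linarith
  have hcn : c ≤ ⌈checkBound ε⌉₊ * n := by
    have h1 : (n : ℝ) ^ ε ≤ n := by
      simpa using Real.rpow_le_rpow_of_exponent_le (by linarith : (1 : ℝ) ≤ n) hε1.le
    have h2 : (c : ℝ) ≤ ⌈checkBound ε⌉₊ * n := by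
      refine hcN.trans (mul_le_mul (Nat.le_ceil _) h1 (by linarith) (Nat.cast_nonneg _))
    exact_mod_cast h2
  let p : Params := ⟨d, a, fun i => (a i : ℝ) ^ (ε - 1), c⟩
  have hp : ∀ i ≤ p.d, 1 ≤ p.dim i := fun i hi => (han i hi).1
  have hp' : ∀ i ≤ p.d, p.dim i ≤ p.dim 0 := fun i hi => (han i hi).2.trans ha0.ge
  have hanti : ∀ i < p.d, p.dim (i + 1) ≤ p.dim i := fun i hi => (hstep i hi).1
  have hr : p.RatesOk := fun i hi => ⟨by positivity, Real.rpow_le_one_of_one_le_of_nonpos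
    (by exact_mod_cast hp i hi.le) (by linarith)⟩
  have hτ : p.total ≤ 5 * n := sum_dims_le hgeom (han d le_rfl).2
  have hτ' : (p.total : ℝ) ≤ 5 * n := by exact_mod_cast hτ
  have hτ2 : (p.total : ℝ) ^ 2 ≤ 25 * (n : ℝ) ^ 2 := by
    nlinarith [(Nat.cast_nonneg p.total : (0 : ℝ) ≤ p.total)]
  have hnω : (n : ℝ) ^ 2 * (n : ℝ) ^ (ω - 2) = (n : ℝ) ^ ω := by
    rw [← Real.rpow_natCast, ← Real.rpow_add (by linarith)]
    norm_num
  refine ⟨p, ha0, fun _ _ => rfl, isCorrect p, ?_, detectsDeviation hr (by linarith), ?_, ?_⟩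
  · refine isCZK (T := T) (bits := sec + Real.logb 2 (Real.logb 2 n) + 1) hp hp' hr
      (fun e he => Comp.honest1 (p := p) (L := fun L => L) he) ?_ (fun k hk => ?_)
      (security_loss_le hn3 hd hcle)
    · have h1 : 2 + ∑ j ∈ Finset.range (p.d + 1), ∑ i ∈ Finset.Ico (j - 1) p.d,
          mulCost R (p.dim j) (p.dim i) (p.dim (i + 1)) ≤
            ⌈25 * (4 * |K| + 6)⌉₊ * n ^ ⌈ω⌉₊ := by
        have h2 := honest1_cost_le hK hω hp hanti (D := n)
          (fun i hi => by exact_mod_cast (han (i + 1) hi).2) (by linarith)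
        have h3 : (n : ℝ) ^ ω ≤ (n : ℝ) ^ ⌈ω⌉₊ := by
          rw [← Real.rpow_natCast]
          exact Real.rpow_le_rpow_of_exponent_le (by linarith) (Nat.le_ceil ω)
        have h4 : (4 * |K| + 6) * ((p.total : ℝ) ^ 2 * (n : ℝ) ^ (ω - 2)) ≤
            ⌈25 * (4 * |K| + 6)⌉₊ * (n : ℝ) ^ ⌈ω⌉₊ := by
          calc (4 * |K| + 6) * ((p.total : ℝ) ^ 2 * (n : ℝ) ^ (ω - 2))
              ≤ (4 * |K| + 6) * (25 * (n : ℝ) ^ 2 * (n : ℝ) ^ (ω - 2)) := by gcongr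
            _ = 25 * (4 * |K| + 6) * (n : ℝ) ^ ω := by rw [← hnω]; ring
            _ ≤ _ := mul_le_mul (Nat.le_ceil _) h3 (by positivity) (Nat.cast_nonneg _)
        exact_mod_cast h2.trans h4
      have h5 : p.total * p.total ≤ 25 * n ^ 3 := by
        calc p.total * p.total ≤ 5 * n * (5 * n) := Nat.mul_le_mul hτ hτ
          _ = 25 * n ^ 2 := by ring
          _ ≤ 25 * n ^ 3 := Nat.mul_le_mul_left _ (Nat.pow_le_pow_right (by omega) (by norm_num))
      have h6 : p.total * p.total * p.total ≤ 125 * n ^ 3 := by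
        calc p.total * p.total * p.total ≤ 5 * n * (5 * n) * (5 * n) :=
              Nat.mul_le_mul (Nat.mul_le_mul hτ hτ) hτ
          _ = 125 * n ^ 3 := by ring
      have h7 : p.total * p.checks * p.total ≤ 25 * (⌈checkBound ε⌉₊ * n ^ 3) := by
        calc p.total * p.checks * p.total ≤ 5 * n * (⌈checkBound ε⌉₊ * n) * (5 * n) :=
              Nat.mul_le_mul (Nat.mul_le_mul hτ hcn) hτ
          _ = 25 * (⌈checkBound ε⌉₊ * n ^ 3) := by ring
      -- the coefficient `782` is `4 * 125 + 11 * 25 + 7`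
      have h8 : 1 ≤ n ^ 3 := Nat.one_le_pow _ _ (by omega)
      have h9 : (782 + 325 * ⌈checkBound ε⌉₊) * n ^ 3 =
          782 * n ^ 3 + 325 * (⌈checkBound ε⌉₊ * n ^ 3) := by ring
      rw [hT, h9]
      omega
    · obtain ⟨-, h1, -, h2⟩ := hstep k hk
      have h3 : (a k : ℝ) ≤ (a (k + 1) : ℝ) / δ := by
        rw [le_div_iff₀ hδ0]; linarith
      have h4 : (1 : ℝ) ≤ a k := by exact_mod_cast (han k hk.le).1
      refine ⟨⌊(a (k + 1) : ℝ) / δ⌋₊, ((a (k + 1) : ℝ) / δ) ^ (ε - 1), Nat.le_floor h3,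
        by positivity, Real.rpow_le_rpow_of_nonpos (by linarith) h3 (by linarith), ?_⟩
      rw [show p.dim 0 = n from ha0]
      exact hlpn _ h1 (han _ hk).2
  · have h1 : ∑ i : Fin p.d, (p.dim i : ℝ) * p.rate i ≤ (1 - 2 ^ (-ε))⁻¹ * (2 * (n : ℝ) ^ ε) := by
      have h2 : ∀ i : Fin p.d, (p.dim i : ℝ) * p.rate i = (a i : ℝ) ^ ε := fun i => by
        have : (0 : ℝ) < a i := by exact_mod_cast (han i i.isLt.le).1
        change (a i : ℝ) * (a i : ℝ) ^ (ε - 1) = _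
        rw [mul_comm, ← Real.rpow_add_one this.ne']
        ring_nf
      have h3 : (2 : ℝ) ^ (-ε) < 1 := Real.rpow_lt_one_of_one_lt_of_neg (by norm_num) (by linarith)
      have h4 : (2 : ℝ) ^ ε ≤ 2 := by
        simpa using Real.rpow_le_rpow_of_exponent_le (by norm_num : (1 : ℝ) ≤ 2) hε1.le
      rw [Finset.sum_congr rfl fun i _ => h2 i, Fin.sum_univ_eq_sum_range fun i => (a i : ℝ) ^ ε]
      refine (sum_dims_rpow_le hε0 hgeom).trans ?_
      rw [Real.mul_rpow (by norm_num) (by linarith)]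
      have := inv_nonneg.2 (sub_nonneg.2 h3.le)
      gcongr
    have h5 : (d : ℝ) ≤ (ε * Real.log 2)⁻¹ * (n : ℝ) ^ ε := by
      have := add_half_le_logb_two hn3 hd
      have := logb_two_le_rpow hε0 (Nat.cast_nonneg (α := ℝ) n)
      linarith
    have h6 : (a d : ℝ) ≤ ν + 8 := by
      have : (a d : ℝ) ≤ ι + 8 := by exact_mod_cast had
      linarith
    obtain ⟨c₂, c₃, h₂, h₃, h⟩ := clientCostLE R hp hp' hr
    refine ⟨c₂, c₃, h₂, h₃, h.trans ?_⟩
    rw [show p.dim 0 = n from ha0]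
    exact client_cost_arith hε0 hε1 (by linarith) hN1 (Nat.cast_nonneg _) hτ' (by linarith) h6
      (Nat.cast_nonneg _) (Nat.cast_nonneg _) (Nat.cast_nonneg _) h5 hcN h1
      (Finset.sum_nonneg fun i _ => mul_nonneg (Nat.cast_nonneg _) (hr i i.isLt).1)
  · -- the rounding of the dimensions is covered by `1 ≤ ι ≤ δ n`, so all but the first are at
    -- most `2 δ n`
    have h1 := serverCostLE hK hω hp hanti (D := 2 * (δ * n)) (fun i hi => (hstep i hi).2.2.1)
      (by linarith)
    obtain ⟨c₁, c₂, h₁, h₂, h⟩ := h1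
    refine ⟨c₁, c₂, h₁, h₂, h.trans ?_⟩
    rw [show p.dim 0 = n from ha0]
    have h3 : (2 * (δ * n)) ^ (ω - 2) = 2 ^ (ω - 2) * δ ^ (ω - 2) * (n : ℝ) ^ (ω - 2) := by
      rw [Real.mul_rpow (by norm_num) (by positivity), Real.mul_rpow hδ0.le (by linarith),
        mul_assoc]
    have h4 : (12 * |K| + 21) * ((p.total : ℝ) ^ 2 * (2 * (δ * n)) ^ (ω - 2)) ≤
        costBound ε ω K * (δ ^ (ω - 2) * (n : ℝ) ^ ω) := by
      calc (12 * |K| + 21) * ((p.total : ℝ) ^ 2 * (2 * (δ * n)) ^ (ω - 2))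
          ≤ (12 * |K| + 21) * (25 * (n : ℝ) ^ 2 * (2 * (δ * n)) ^ (ω - 2)) := by gcongr
        _ = (12 * |K| + 21) * (25 * 2 ^ (ω - 2)) * (δ ^ (ω - 2) * (n : ℝ) ^ ω) := by
          rw [h3, ← hnω]; ring
        _ ≤ _ := mul_le_mul_of_nonneg_right (le_costBound hε0 hε1 ω K).2.2 (by positivity)
    linarith

end Parameters

end

end Delegation

theorem corollary1 (ε ω K : ℝ) (hε0 : 0 < ε) (hε1 : ε < 1) (hω : 2 ≤ ω) :
    ∃ (C : ℝ) (q : Polynomial ℕ),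
      ∀ (R : Type u) [CommRing R] [Fintype R] [DecidableEq R] [Nontrivial R]
        (enc : R ≃ Fin (Fintype.card R)),
        Delegation.MatMulBound R K ω →
        ∀ (δ sec : ℝ) (n t : ℕ), 0 < δ → δ < 1 / 2 → 0 < sec →
          Delegation.nu enc δ ε sec n (t + q.eval n) ≤ δ * n →
          ∃ p : Delegation.Params,
            p.dim 0 = n ∧
            (∀ i < p.d, p.rate i = (p.dim i : ℝ) ^ (ε - 1)) ∧
            Delegation.IsCorrect R p ∧
            Delegation.IsCZK enc p t sec ∧
            Delegation.DetectsDeviation R p sec ∧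
            Delegation.ClientCostLE R p
              (C * ((n : ℝ) ^ 2 *
                ((n : ℝ) ^ ε + Delegation.nu enc δ ε sec n (t + q.eval n)))) ∧
            Delegation.ServerCostLE R p
              (Delegation.matMulCost R n + C * (δ ^ (ω - 2) * (n : ℝ) ^ ω)) := by
  refine ⟨Delegation.costBound ε ω K, Delegation.reductionCost ε ω K, ?_⟩
  intro R _ _ _ _ enc hK δ sec n t hδ0 hδ hsec hν
  exact Delegation.exists_params hε0 hε1 hω enc hK hδ0 hδ hsec hν
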